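/- **Setting.** Let $m,n\ge 1$. The honeycomb lattice $H$ has white vertices $\mathsf w_{I,J}$ and black vertices $\mathsf b_{I,J}$, $(I,J)\in\mathbb Z^2$; $\mathsf w_{I,J}$ is joined to $\mathsf b_{I,J}$ by an $a$-edge, to $\mathsf b_{I,J+1}$ by a $b$-edge and to $\mathsf b_{I-1,J}$ by a $c$-edge, with positive weights $a_{IJ},b_{IJ},c_{IJ}$ that are $m$-periodic in the row $I$ and $n$-periodic in the column $J$. Let $K(z,w)$ be the $mn\times mn$ Fourier transform of the weighted adjacency (Kasteleyn) matrix (rows: white vertices modulo the periods; columns: black ones), in which a $c$-edge leaving the fundamental domain $0\le I<m$, $0\le J<n$ carries a factor $z$ and a $b$-edge leaving it a factor $w$; $P=\det K$, and $Q$ is the adjugate of $K$. For a magnetic field $(B_x,B_y)$, the weights $\mathrm K_B(\mathsf e)$ on $H$ are the entries of $K(e^{B_x},e^{B_y})$, edge by edge, and $$\mathrm K_B^{-1}(\mathsf b,\mathsf w)=\iint_{\mathbb T^2} z^{-y}w^{x}\,\frac{Q_{\mathsf b\mathsf w}(e^{B_x}z,e^{B_y}w)}{P(e^{B_x}z,e^{B_y}w)}\,\frac{dz}{2i\pi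 z}\frac{dw}{2i\pi w},$$ where $(x,y)$ (columns, rows) is the translation from the fundamental domain of $\mathsf w$ to that of $\mathsf b$. The Gibbs measure $\mathbb P_B$ is the probability measure on dimer configurations $\mathcal C$ of $H$ with, for distinct edges $\mathsf e_i=(\mathsf w_i,\mathsf b_i)$, $\mathbb P_B(\mathsf e_1,\dots,\mathsf e_k\in\mathcal C)=\prod_i \mathrm K_B(\mathsf e_i)\,\det[\mathrm K_B^{-1}(\mathsf b_i,\mathsf w_j)]_{i,j}$. Put $r_j=\prod_{i=1}^m a_{ij}/c_{ij}$. Fix a column $j_1$ with $r_j\ne r_{j_1}$ for all $j\neq j_1$ modulo $n$, and $\gamma\in(-1,1)$, let $X=(-1)^m r_{j_1}$ and $\beta=-\partial_2P(X,0)/(X\,\partial_1P(X,0))$, and for small $t>0$ take the field inside the corresponding tentacle of the amoeba $$B_x=\log r_{j_1}+\gamma\beta t,\qquad B_y=\log t .$$ Then for all small $t>0$ there is $(z_0,w_0)$ with $|z_0|=|w_0|=1$ and $P(e^{B_x}z_0,e^{B_y}w_0)=0$. For any choice of such roots $(z_0(t),w_0(t))$, let $\ell_t(\mathsf e)=|iK_{\mathsf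 e}\,Q_{\mathsf b\mathsf w}|$, evaluated at $(e^{B_x}z_0,e^{B_y}w_0)$, where $K_{\mathsf e}$ is the contribution of the edge $\mathsf e=(\mathsf w,\mathsf b)$ to $K$; this is the length of the edge dual to $\mathsf e$ in the mapping of the dual graph to the plane whose increments are given by the divergence-free flow $\mathsf e\mapsto iK_{\mathsf e}Q_{\mathsf b\mathsf w}$. **Proposition.** Let $\mathsf e$ be the $b$-edge at $\mathsf w_{I_0,J_0}$ (the bead), and let column $J_0$ be frozen with typical edges of kind $a$, i.e. $r_{j_1}<r_{J_0}$. Let $L$ be the number of successive $c$-edges (non-typical edges) at $\mathsf w_{I_0+1,J_0},\mathsf w_{I_0+2,J_0},\dots$ that belong to the configuration. As $t\to0^+$: 1. for every $N\geq 0$, $\displaystyle \mathbb P_t(L\ge N\mid \mathsf e\in\mathcal C)=\prod_{i=1}^N\frac{\ell_t(c_{I_0+i,J_0})}{\ell_t(a_{I_0+i-1,J_0})}+O(t)$, where inside $\ell_t$ an edge is denoted by its weight; 2. $\prod_{i=1}^m \ell_t(c_{i,J_0})/\ell_t(a_{i,J_0})$ converges to some $q\in(0,1)$, and conditionally on $\mathsf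 e\in\mathcal C$ the number $\lfloor L/m\rfloor$ of fundamental domains covered by the run is asymptotically geometric with parameter $q$: for every $p\geq 0$, $\mathbb P_t(L\ge pm\mid \mathsf e\in\mathcal C)\to q^p$ and $\mathbb P_t(\lfloor L/m\rfloor=p\mid \mathsf e\in\mathcal C)\to(1-q)q^p$. If instead column $J_0$ is frozen with typical edges of kind $c$, i.e. $r_{J_0}<r_{j_1}$, the same holds for the number $L$ of successive $a$-edges at $\mathsf w_{I_0-1,J_0},\mathsf w_{I_0-2,J_0},\dots$, with $\prod_{i=1}^N \ell_t(a_{I_0-i,J_0})/\ell_t(c_{I_0-i+1,J_0})$ in 1 and $\prod_{i=1}^m\ell_t(a_{i,J_0})/\ell_t(c_{i,J_0})$ in 2. -/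

import Mathlib

open Filter Topology Asymptotics MeasureTheory ProbabilityTheory

namespace HoneycombDimer

noncomputable section

/-- The three orientations of the edges of the honeycomb lattice. -/
inductive EdgeKind
  | a
  | b
  | c

/-- An edge of the honeycomb lattice, given by its white end `(row, col)` and its kind.
The white and the black vertices are both indexed by `ℤ × ℤ`; the white vertex `(I, J)` is joined
to the black vertices `(I, J)` by an `a`-edge, `(I, J + 1)` by a `b`-edge, `(I - 1, J)` by a
`c`-edge. The `a`- and `c`-edges lie inside the columns, the `b`-edges join neighbouring columns,
crossing the vertical dual path (thread) that separates them. -/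
structure Edge where
  row : ℤ
  col : ℤ
  kind : EdgeKind

/-- The white end of an edge. -/
def Edge.white (e : Edge) : ℤ × ℤ := (e.row, e.col)

/-- The black end of an edge. -/
def Edge.black (e : Edge) : ℤ × ℤ :=
  match e.kind with
  | .a => (e.row, e.col)
  | .b => (e.row, e.col + 1)
  | .c => (e.row - 1, e.col)

/-- A dimer configuration: a set of edges such that every vertex is incident with exactly one of
them. -/
def DimerConfig : Type :=
  {ω : Set Edge // (∀ v : ℤ × ℤ, ∃! e, e ∈ ω ∧ e.white = v) ∧
    (∀ v : ℤ × ℤ, ∃! e, e ∈ ω ∧ e.black = v)}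

/-- The σ-algebra generated by the events `e ∈ ω`. -/
instance : MeasurableSpace DimerConfig := inferInstanceAs (MeasurableSpace (Subtype _))

/-- Positive edge weights, periodic with a fundamental domain of `m` rows and `n` columns:
`a i j`, `b i j`, `c i j` are the weights of the edges around the white vertices of class
`(i, j)`. -/
structure Weights (m n : ℕ) where
  a : ZMod m → ZMod n → ℝ
  b : ZMod m → ZMod n → ℝ
  c : ZMod m → ZMod n → ℝ
  a_pos : ∀ i j, 0 < a i j
  b_pos : ∀ i j, 0 < b i j
  c_pos : ∀ i j, 0 < c i j

variable {m n : ℕ}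

/-- The class of a (white or black) vertex modulo the period lattice. -/
def vertexClass (m n : ℕ) (v : ℤ × ℤ) : ZMod m × ZMod n := ((v.1 : ZMod m), (v.2 : ZMod n))

/-- Coefficient of the edge of kind `k` at the white vertex of class `p` in the Fourier transform
of the Kasteleyn operator: the weight, times `z` if a `c`-edge leaves the fundamental domain and
times `w` if a `b`-edge does. -/
def coeff {R : Type*} [CommRing R] [Algebra ℝ R] (W : Weights m n) (z w : R) (k : EdgeKind)
    (p : ZMod m × ZMod n) : R :=
  match k with
  | .a => algebraMap ℝ R (W.a p.1 p.2)
  | .b => algebraMap ℝ R (W.b p.1 p.2) * (if p.2 + 1 = 0 then w else 1)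
  | .c => algebraMap ℝ R (W.c p.1 p.2) * (if p.1 = 0 then z else 1)

/-- The Fourier transform `K(z, w)` of the Kasteleyn operator (rows: white vertices of the
fundamental domain, columns: black vertices). -/
def kasteleyn {R : Type*} [CommRing R] [Algebra ℝ R] (W : Weights m n) (z w : R) :
    Matrix (ZMod m × ZMod n) (ZMod m × ZMod n) R :=
  Matrix.of fun p q =>
    (if q = p then coeff W z w .a p else 0) +
    (if q = (p.1, p.2 + 1) then coeff W z w .b p else 0) +
    (if q = (p.1 - 1, p.2) then coeff W z w .c p else 0)

/-- The characteristic polynomial `P(z, w) = det K(z, w)`. -/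
def charPoly [NeZero m] [NeZero n] {R : Type*} [CommRing R] [Algebra ℝ R]
    (W : Weights m n) (z w : R) : R :=
  (kasteleyn W z w).det

/-- The comatrix `Q(z, w)` (rows: black vertices, columns: white vertices). -/
def comatrix [NeZero m] [NeZero n] {R : Type*} [CommRing R] [Algebra ℝ R]
    (W : Weights m n) (z w : R) : Matrix (ZMod m × ZMod n) (ZMod m × ZMod n) R :=
  (kasteleyn W z w).adjugate

/-- Entry of the Kasteleyn operator of the lattice in the magnetic field `(Bx, By)` on an edge. -/
def edgeWeight (W : Weights m n) (Bx By : ℝ) (e : Edge) : ℝ :=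
  coeff W (Real.exp Bx) (Real.exp By) e.kind (vertexClass m n e.white)

/-- The inverse Kasteleyn operator in the magnetic field `(Bx, By)`, between the black vertex `v`
and the white vertex `u`: with `(x, y)` the translation from the fundamental domain of `u` to that
of `v`, the integral over the unit torus of
`z ^ (-y) * w ^ x * Q / P (e ^ Bx z, e ^ By w)` against `dz / (2 i π z) * dw / (2 i π w)`. -/
def invKasteleyn [NeZero m] [NeZero n] (W : Weights m n) (Bx By : ℝ) (v u : ℤ × ℤ) : ℂ :=
  (2 * Real.pi * Complex.I)⁻¹ ^ 2 *
    circleIntegral (fun z => circleIntegral (fun w =>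
      z ^ (-(v.1 / (m : ℤ) - u.1 / (m : ℤ))) * w ^ (v.2 / (n : ℤ) - u.2 / (n : ℤ)) *
        (comatrix W (Real.exp Bx * z) (Real.exp By * w) (vertexClass m n v) (vertexClass m n u) /
          charPoly W (Real.exp Bx * z) (Real.exp By * w)) / (z * w)) 0 1) 0 1

/-- `μ` is the Gibbs measure on dimer configurations for the weights `W` and the magnetic field
`(Bx, By)`: the probability measure with determinantal local statistics given by the inverse
Kasteleyn operator. It is determined by this property. -/
structure IsDimerGibbsMeasure [NeZero m] [NeZero n] (W : Weights m n) (Bx By : ℝ)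
    (μ : Measure DimerConfig) : Prop where
  isProbabilityMeasure : IsProbabilityMeasure μ
  localStatistics : ∀ (k : ℕ) (e : Fin k → Edge), Function.Injective e →
    ((μ.real {ω | ∀ i, e i ∈ ω.1} : ℝ) : ℂ) =
      (∏ i, (edgeWeight W Bx By (e i) : ℂ)) *
        (Matrix.of fun i j => invKasteleyn W Bx By (e i).black (e j).white).det

/-- The ratio `∏ᵢ a i j / c i j` of the weights of the two fillings of column `j`. -/
def columnRatio [NeZero m] (W : Weights m n) (j : ZMod n) : ℝ :=
  ∏ i, W.a i j / W.c i j

/-- The root `(-1) ^ m * ∏ᵢ a i j / c i j` of `P(·, 0)` coming from column `j`; its modulus is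
`e ^ c`, where `c` is the abscissa of the corresponding vertical tentacle of the amoeba. -/
def columnRoot [NeZero m] (W : Weights m n) (j : ZMod n) : ℝ :=
  (-1) ^ m * columnRatio W j

/-- The asymptotic half-width coefficient `β = - ∂₂P / (X ∂₁P)` at `(X, 0)`, `X = columnRoot W j`,
of the tentacle attached to column `j`. -/
def tentacleBeta [NeZero m] [NeZero n] (W : Weights m n) (j : ZMod n) : ℝ :=
  - deriv (fun w : ℝ => charPoly W (columnRoot W j) w) 0 /
    (columnRoot W j * deriv (fun z : ℝ => charPoly W z (0 : ℝ)) (columnRoot W j))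

/-- Horizontal magnetic field `c + γ β t` on the curve of parameter `γ` inside the tentacle attached
to column `j`; the vertical field is `log t`. -/
def tentacleBx [NeZero m] [NeZero n] (W : Weights m n) (j : ZMod n) (γ t : ℝ) : ℝ :=
  Real.log (columnRatio W j) + γ * tentacleBeta W j * t

/-- `(z, w)` lies on the unit torus and `(e ^ Bx z, e ^ By w)` is a root of the characteristic
polynomial. -/
def IsTorusRoot [NeZero m] [NeZero n] (W : Weights m n) (Bx By : ℝ) (z w : ℂ) : Prop :=
  ‖z‖ = 1 ∧ ‖w‖ = 1 ∧ charPoly W (Real.exp Bx * z) (Real.exp By * w) = 0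

/-- Length of the edge dual to `e` in the mapping of the dual graph to the plane defined by the root
`(e ^ Bx z, e ^ By w)` of the characteristic polynomial: the image of the dual edge of `e` is the
vector given by the value `i K Q` on `e` of the divergence-free flow defining the mapping. -/
def dualLength [NeZero m] [NeZero n] (W : Weights m n) (Bx By : ℝ) (z w : ℂ) (e : Edge) : ℝ :=
  ‖Complex.I *
    coeff W (Real.exp Bx * z) (Real.exp By * w) e.kind (vertexClass m n e.white) *
    comatrix W (Real.exp Bx * z) (Real.exp By * w)
      (vertexClass m n e.black) (vertexClass m n e.white)‖

/-- The number of successive edges `f 1, f 2, …` that belong to the dimer configuration, before the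
first one that does not. -/
def runLength (f : ℕ → Edge) (ω : DimerConfig) : ℕ∞ :=
  ⨆ (N : ℕ) (_ : ∀ i ∈ Finset.Icc 1 N, f i ∈ ω.1), (N : ℕ∞)

/-- As `t → 0⁺`, under the laws `μ t` conditioned on `bead`:
* for every `N` the probability that `L ≥ N` is `∏_{i=1}^{N} ratio t i + O(t)`;
* `param t` tends to some `q ∈ (0, 1)`, and the number of blocks of `m` successive units covered by
  `L` converges in law to the geometric distribution with `ℙ(≥ p) = q ^ p`, that is, with
  success probability `1 - q`. -/
def HasGeometricLimit (m : ℕ) (μ : ℝ → Measure DimerConfig) (bead : Set DimerConfig)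
    (L : DimerConfig → ℕ∞) (ratio : ℝ → ℕ → ℝ) (param : ℝ → ℝ) : Prop :=
  (∀ N : ℕ,
    (fun t => (cond (μ t) bead).real {ω | (N : ℕ∞) ≤ L ω} - ∏ i ∈ Finset.Icc 1 N, ratio t i)
      =O[𝓝[>] 0] (fun t : ℝ => t)) ∧
  ∃ q : ℝ, 0 < q ∧ q < 1 ∧ Tendsto param (𝓝[>] 0) (𝓝 q) ∧
    (∀ p : ℕ, Tendsto (fun t => (cond (μ t) bead).real {ω | ((p * m : ℕ) : ℕ∞) ≤ L ω})
      (𝓝[>] 0) (𝓝 (q ^ p))) ∧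
    (∀ p : ℕ, Tendsto
      (fun t => (cond (μ t) bead).real
        {ω | ((p * m : ℕ) : ℕ∞) ≤ L ω ∧ L ω < (((p + 1) * m : ℕ) : ℕ∞)})
      (𝓝[>] 0) (𝓝 ((1 - q) * q ^ p)))

end

end HoneycombDimer

open HoneycombDimer

/-! As `t → 0` the field runs into the point `(X, 0)`, a simple zero of `P`. At `w = 0` the matrix
is block triangular by columns, so the zeros of `P(·, 0)` are the column roots, and genericity makes
`X` the only one on its circle. The implicit function theorem (`exists_localRoot`) writes the zero
set near `(X, 0)` as a graph `W = ω(Z)`. The residue theorem in `w`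
(`LocalRoot.eventually_innerMean`) then turns each entry of the inverse into a single integral over
`Z`: the value at `w = 0` plus, on the short arc of the `Z` with `|ω(Z)| < t`, the residue at the
root. The normalized length `M(t)` of the arc is positive and `O(t)`.

On the zero set the adjugate has rank one. Cutting the fundamental domain just before or just after
column `j₁` produces factors `F(b)` (`blackFactor`) and `G(u)` (`whiteFactor`) that do not vanish at
`(X, 0)`: they are kernel vectors of block triangular matrices, and their signs alternate along each
column. Between vertices of a column other than `j₁`, `Q` is `w F(b) G(u)` divided by a fixed
nonzero factor. For a `b`-edge leaving such a column `K_e Q` is a multiple of `w` already as a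
polynomial, so nothing comes from `w = 0`; the corresponding entries of the inverse, times the
weight of the bead, are `M(t)` times a quantity tending to a multiple of `G(u)`, up to a phase.

Inside a frozen column the relation `K K⁻¹ = 1` becomes a first order recursion with error `O(t)`.
It contracts over a period because of the strict inequality between the column ratios. Since the
entries are bounded, those on one side of the diagonal are `O(t)`, and the entry on a typical edge
is the inverse of its weight up to `O(t)` (`fieldGreen_isBigO_of_lt`, `fieldGreen_isBigO_of_le`).

In the determinant for the bead and `N` edges of the run, suitably scaled, only one cyclic
permutation survives (`linearRate_norm_det`). It selects the last entry of the bead row, so the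
probability divided by `M(t)` tends to a constant times a product of weight ratios times `|G(u_N)|`.
Division by the case `N = 0` removes the constant. In the ratio of two dual lengths at a common
black vertex `F` cancels, leaving the weight ratio times a ratio of values of `|G|`; the product
telescopes to the same limit with the same rate. Over a period `G` returns to its value, and `q` is
the quotient of the two column ratios. -/

namespace HoneycombDimer

noncomputable section

variable {m n : ℕ}

/-! ### Adjugates of singular matrices. -/

section Adjugate

variable {ι 𝕜 : Type*} [Fintype ι] [DecidableEq ι] [Field 𝕜]

/-- An adjugate entry is the determinant of such a modified matrix, so its vanishing can be tested
on kernel vectors through this formula. -/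
theorem updateRow_single_mulVec (M : Matrix ι ι 𝕜) (v : ι → 𝕜) (j i : ι) :
    (M.updateRow j (Pi.single i 1)).mulVec v = Function.update (M.mulVec v) j (v i) := by
  ext k
  by_cases hk : k = j
  · subst hk
    simp [Matrix.mulVec, dotProduct, Pi.single_apply]
  · simp [Matrix.mulVec, Matrix.updateRow_ne hk, Function.update_of_ne hk]

/-- A kernel vector vanishing at `i` is zero as soon as row `i` of the adjugate is nonzero. -/
theorem eq_zero_of_adjugate_ne_zero {M : Matrix ι ι 𝕜} {i j : ι} (h : M.adjugate i j ≠ 0)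
    {v : ι → 𝕜} (hv : M.mulVec v = 0) (hi : v i = 0) : v = 0 := by
  by_contra hne
  refine h ?_
  rw [Matrix.adjugate_apply, ← Matrix.exists_mulVec_eq_zero_iff]
  refine ⟨v, hne, ?_⟩
  rw [updateRow_single_mulVec, hv, hi]
  exact Function.update_eq_self j (0 : ι → 𝕜)

/-- If no nonzero kernel vector vanishes at `i` and a left kernel vector does not vanish at `j`,
then the `(i, j)` entry of the adjugate is nonzero. -/
theorem adjugate_ne_zero {M : Matrix ι ι 𝕜} {i j : ι}
    (hker : ∀ v, M.mulVec v = 0 → v i = 0 → v = 0) {g : ι → 𝕜} (hg : Matrix.vecMul g M = 0)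
    (hj : g j ≠ 0) : M.adjugate i j ≠ 0 := by
  rw [Matrix.adjugate_apply]
  intro h0
  obtain ⟨v, hv0, hv⟩ := Matrix.exists_mulVec_eq_zero_iff.2 h0
  rw [updateRow_single_mulVec] at hv
  have hvi : v i = 0 := by simpa using congrFun hv j
  have hne : ∀ k, k ≠ j → M.mulVec v k = 0 := fun k hk => by
    simpa [Function.update_of_ne hk] using congrFun hv k
  -- `M v` is supported at `j`; pairing it with the left kernel vector, which is nonzero at `j`,
  -- kills this last coordinate.
  have hsum : dotProduct g (M.mulVec v) = 0 := by
    rw [Matrix.dotProduct_mulVec, hg, zero_dotProduct]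
  have hjv : M.mulVec v j = 0 := by
    rw [dotProduct, Finset.sum_eq_single j (fun k _ hk => by rw [hne k hk, mul_zero])
      (fun h => absurd (Finset.mem_univ j) h)] at hsum
    exact (mul_eq_zero.1 hsum).resolve_left hj
  refine hv0 (hker v ?_ hvi)
  ext k
  by_cases hk : k = j
  · rw [hk, hjv, Pi.zero_apply]
  · rw [hne k hk, Pi.zero_apply]

theorem mulVec_adjugate_col {M : Matrix ι ι 𝕜} (h : M.det = 0) (j : ι) :
    M.mulVec (fun i => M.adjugate i j) = 0 := by
  ext k
  have := congrFun (congrFun M.mul_adjugate k) j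
  simpa [Matrix.mul_apply, Matrix.mulVec, dotProduct, h] using this

theorem vecMul_adjugate_row {M : Matrix ι ι 𝕜} (h : M.det = 0) (i : ι) :
    Matrix.vecMul (fun j => M.adjugate i j) M = 0 := by
  ext k
  have := congrFun (congrFun M.adjugate_mul i) k
  simpa [Matrix.mul_apply, Matrix.vecMul, dotProduct, h] using this

/-- The adjugate of a singular matrix has rank at most one. -/
theorem adjugate_mul_adjugate_of_det_eq_zero {M : Matrix ι ι 𝕜} (h : M.det = 0) (i j i' j' : ι) :
    M.adjugate i j * M.adjugate i' j' = M.adjugate i j' * M.adjugate i' j := by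
  by_cases hz : M.adjugate i j = 0 ∧ M.adjugate i j' = 0
  · rw [hz.1, hz.2, zero_mul, zero_mul]
  have hw : ∃ w, M.adjugate i w ≠ 0 := by
    by_contra hcon
    push Not at hcon
    exact hz ⟨hcon j, hcon j'⟩
  obtain ⟨w, hw⟩ := hw
  -- Two columns of the adjugate lie in the kernel; the combination of them that vanishes at `i`
  -- must be zero.
  have hv := eq_zero_of_adjugate_ne_zero hw
    (v := M.adjugate i j • (fun k => M.adjugate k j') - M.adjugate i j' • fun k => M.adjugate k j)
    (by rw [Matrix.mulVec_sub, Matrix.mulVec_smul, Matrix.mulVec_smul, mulVec_adjugate_col h,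
      mulVec_adjugate_col h, smul_zero, smul_zero, sub_zero])
    (by simp [mul_comm])
  have := congrFun hv i'
  simpa [sub_eq_zero] using this

end Adjugate

/-! ### Derivative of a determinant. -/

section Jacobi

variable {ι 𝕜 : Type*} [Fintype ι] [DecidableEq ι] [NontriviallyNormedField 𝕜]

/-- Jacobi's formula. -/
theorem hasDerivAt_det {A : 𝕜 → Matrix ι ι 𝕜} {A' : Matrix ι ι 𝕜} {x : 𝕜}
    (h : ∀ i j, HasDerivAt (fun y => A y i j) (A' i j) x) :
    HasDerivAt (fun y => (A y).det) (∑ i, ∑ j, A' i j * (A x).adjugate j i) x := by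
  have h1 : HasDerivAt (fun y => (A y).det)
      (∑ σ : Equiv.Perm ι, ((Equiv.Perm.sign σ : ℤ) : 𝕜) *
        ∑ i, (∏ k ∈ Finset.univ.erase i, A x (σ k) k) • A' (σ i) i) x := by
    simp_rw [Matrix.det_apply']
    refine HasDerivAt.fun_sum fun σ _ => HasDerivAt.const_mul _ ?_
    exact HasDerivAt.fun_finsetProd fun i _ => h (σ i) i
  convert h1 using 1
  simp_rw [Finset.mul_sum]
  rw [Finset.sum_comm (f := fun i j => A' i j * (A x).adjugate j i),
    Finset.sum_comm (s := (Finset.univ : Finset (Equiv.Perm ι)))]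
  refine Finset.sum_congr rfl fun j _ => ?_
  -- Cramer's rule: the sum over a column is the determinant with that column differentiated.
  have h2 : ∑ i, A' i j * (A x).adjugate j i = ((A x).updateCol j (fun i => A' i j)).det := by
    rw [← Matrix.cramer_apply, Matrix.cramer_eq_adjugate_mulVec]
    simp [Matrix.mulVec, dotProduct, mul_comm]
  rw [h2, Matrix.det_apply']
  refine Finset.sum_congr rfl fun σ _ => ?_
  congr 1
  rw [← Finset.prod_erase_mul _ _ (Finset.mem_univ j), smul_eq_mul]
  congr 1
  · refine Finset.prod_congr rfl fun k hk => ?_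
    rw [Matrix.updateCol_ne (Finset.ne_of_mem_erase hk)]
  · rw [Matrix.updateCol_self]

end Jacobi

/-! ### Moving the cut of the fundamental domain by a gauge transformation. -/

section Cut

variable {R : Type*} [CommRing R] [Algebra ℝ R]

/-- The Fourier transform of the Kasteleyn operator for the fundamental domain whose first column
is `s`: the factor `w` is carried by the `b`-edges from column `s - 1` to column `s`. -/
def cutKasteleyn (s : ZMod n) (W : Weights m n) (z w : R) :
    Matrix (ZMod m × ZMod n) (ZMod m × ZMod n) R :=
  Matrix.of fun p q =>
    (if q = p then algebraMap ℝ R (W.a p.1 p.2) else 0) +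
    (if q = (p.1, p.2 + 1) then algebraMap ℝ R (W.b p.1 p.2) * (if p.2 + 1 = s then w else 1)
      else 0) +
    (if q = (p.1 - 1, p.2) then algebraMap ℝ R (W.c p.1 p.2) * (if p.1 = 0 then z else 1) else 0)

theorem cutKasteleyn_zero (W : Weights m n) (z w : R) :
    cutKasteleyn 0 W z w = kasteleyn W z w := rfl

theorem cutKasteleyn_map {S : Type*} [CommRing S] [Algebra ℝ S] (f : R →ₐ[ℝ] S) (s : ZMod n)
    (W : Weights m n) (z w : R) :
    (cutKasteleyn s W z w).map f = cutKasteleyn s W (f z) (f w) := by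
  ext p q
  simp only [cutKasteleyn, Matrix.map_apply, Matrix.of_apply, map_add, apply_ite f, map_mul,
    AlgHom.commutes, map_zero, map_one]

/-- Exponent of the gauge transformation moving the cut of the fundamental domain. -/
def gaugeExp (s j : ZMod n) : ℕ := if s.val ≤ j.val then 1 else 0

theorem gaugeExp_self (s : ZMod n) : gaugeExp s s = 1 := by simp [gaugeExp]

variable [NeZero m] [NeZero n]

theorem cutKasteleyn_mulVec (s : ZMod n) (W : Weights m n) (z w : R)
    (v : ZMod m × ZMod n → R) (i : ZMod m) (j : ZMod n) :
    (cutKasteleyn s W z w).mulVec v (i, j) =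
      algebraMap ℝ R (W.a i j) * v (i, j) +
      algebraMap ℝ R (W.b i j) * (if j + 1 = s then w else 1) * v (i, j + 1) +
      algebraMap ℝ R (W.c i j) * (if i = 0 then z else 1) * v (i - 1, j) := by
  simp [cutKasteleyn, Matrix.mulVec, dotProduct, add_mul, Finset.sum_add_distrib, ite_mul]

theorem cutKasteleyn_vecMul (s : ZMod n) (W : Weights m n) (z w : R)
    (v : ZMod m × ZMod n → R) (i : ZMod m) (j : ZMod n) :
    Matrix.vecMul v (cutKasteleyn s W z w) (i, j) =
      algebraMap ℝ R (W.a i j) * v (i, j) +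
      algebraMap ℝ R (W.b i (j - 1)) * (if j = s then w else 1) * v (i, j - 1) +
      algebraMap ℝ R (W.c (i + 1) j) * (if i + 1 = 0 then z else 1) * v (i + 1, j) := by
  have e2 : ∀ p : ZMod m × ZMod n, ((i, j) = (p.1, p.2 + 1)) ↔ (p = (i, j - 1)) := by
    rintro ⟨p, q⟩
    simp only [Prod.mk.injEq]
    constructor
    · rintro ⟨rfl, rfl⟩; simp
    · rintro ⟨rfl, rfl⟩; simp
  have e3 : ∀ p : ZMod m × ZMod n, ((i, j) = (p.1 - 1, p.2)) ↔ (p = (i + 1, j)) := by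
    rintro ⟨p, q⟩
    simp only [Prod.mk.injEq]
    constructor
    · rintro ⟨rfl, rfl⟩; simp
    · rintro ⟨rfl, rfl⟩; simp
  simp only [cutKasteleyn, Matrix.vecMul, dotProduct, Matrix.of_apply, mul_add,
    Finset.sum_add_distrib, e2, e3, mul_ite, mul_zero, Finset.sum_ite_eq, Finset.sum_ite_eq', Finset.mem_univ,
    if_true, sub_add_cancel]
  split_ifs <;> ring

theorem val_add_one_cases (j : ZMod n) :
    (j + 1 = 0 ∧ j.val + 1 = n) ∨ (j + 1 ≠ 0 ∧ (j + 1).val = j.val + 1 ∧ j.val + 1 < n) := by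
  have hlt := ZMod.val_lt j
  by_cases h : j.val + 1 = n
  · left
    refine ⟨?_, h⟩
    have : ((j.val + 1 : ℕ) : ZMod n) = 0 := by rw [h]; simp
    simpa using this
  · right
    have h1 : (j + 1).val = j.val + 1 := by
      have := ZMod.val_cast_of_lt (show j.val + 1 < n by omega)
      simpa using this
    refine ⟨fun h0 => ?_, h1, by omega⟩
    rw [h0, ZMod.val_zero] at h1
    omega

/-- Compares the exponent of `w` on a `b`-edge for the cuts at `s` and at `0`: the two differ by a
coboundary, which is what makes the diagonal gauge possible. -/
theorem gaugeExp_step (s j : ZMod n) :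
    gaugeExp s j + (if j + 1 = s then 1 else 0) = gaugeExp s (j + 1) + if j + 1 = 0 then 1 else 0 := by
  rcases val_add_one_cases j with ⟨h0, h1⟩ | ⟨h0, h1, h2⟩
  · by_cases hs : s = 0
    · subst hs; simp [h0, gaugeExp]
    · have hs' : s.val ≠ 0 := by rwa [Ne, ZMod.val_eq_zero]
      have := ZMod.val_lt s
      simp [h0, gaugeExp, Ne.symm hs, hs]
      omega
  · have hval : (j + 1 = s) ↔ (j.val + 1 = s.val) := by
      rw [← h1]; exact ⟨fun h => by rw [h], fun h => ZMod.val_injective n h⟩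
    simp only [gaugeExp, h0, if_false, h1, hval]
    split_ifs <;> omega

/-- The gauge matrix. -/
def gauge (m : ℕ) (s : ZMod n) (w : R) : Matrix (ZMod m × ZMod n) (ZMod m × ZMod n) R :=
  Matrix.diagonal fun p => w ^ gaugeExp s p.2

theorem gauge_mul_cutKasteleyn (s : ZMod n) (W : Weights m n) (z w : R) :
    gauge m s w * cutKasteleyn s W z w = cutKasteleyn 0 W z w * gauge m s w := by
  ext ⟨i, j⟩ ⟨k, l⟩
  rw [gauge, Matrix.diagonal_mul, Matrix.mul_diagonal]
  simp only [cutKasteleyn, Matrix.of_apply, mul_add, add_mul]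
  congr 1
  · congr 1
    · by_cases h : (k, l) = (i, j)
      · simp only [Prod.mk.injEq] at h
        simp [h, mul_comm]
      · simp [h]
    · by_cases h : (k, l) = (i, j + 1)
      · simp only [Prod.mk.injEq] at h
        have := congrArg (fun e => w ^ e) (gaugeExp_step s j)
        simp only [pow_add, pow_ite, pow_one, pow_zero] at this
        simp only [h.1, h.2, if_true]
        linear_combination (algebraMap ℝ R (W.b i j)) * this
      · simp [h]
  · by_cases h : (k, l) = (i - 1, j)
    · simp only [Prod.mk.injEq] at h
      simp [h, mul_comm]
    · simp [h]

end Cut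

/-! ### Determinant and adjugate under a change of cut. -/

section CutField

variable {𝕜 : Type*} [RCLike 𝕜]

theorem continuous_cutKasteleyn (s : ZMod n) (W : Weights m n) :
    Continuous fun p : 𝕜 × 𝕜 => cutKasteleyn s W p.1 p.2 := by
  refine continuous_matrix fun p q => ?_
  simp only [cutKasteleyn, Matrix.of_apply]
  split_ifs <;> fun_prop

variable [NeZero m] [NeZero n]

/-- The gauge is invertible only for `w ≠ 0`; the value `w = 0`, the one that matters at `(X, 0)`,
follows by continuity. -/
theorem det_cutKasteleyn (s : ZMod n) (W : Weights m n) (z w : 𝕜) :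
    (cutKasteleyn s W z w).det = charPoly W z w := by
  have hcont : ∀ s : ZMod n, Continuous fun w : 𝕜 => (cutKasteleyn s W z w).det := fun s =>
    ((continuous_cutKasteleyn s W).comp (Continuous.prodMk_right z)).matrix_det
  have key := Continuous.ext_on (dense_compl_singleton (0 : 𝕜)) (hcont s) (hcont 0) (by
    intro w hw
    have hw : w ≠ 0 := hw
    have h := congrArg Matrix.det (gauge_mul_cutKasteleyn s W z w)
    rw [Matrix.det_mul, Matrix.det_mul, mul_comm] at h
    refine mul_right_cancel₀ ?_ h
    rw [gauge, Matrix.det_diagonal]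
    exact Finset.prod_ne_zero_iff.2 fun p _ => pow_ne_zero _ hw)
  exact congrFun key w

theorem gauge_mul_adjugate (s : ZMod n) (W : Weights m n) (z : 𝕜) {w : 𝕜} (hw : w ≠ 0)
    (b u : ZMod m × ZMod n) :
    w ^ gaugeExp s b.2 * (cutKasteleyn s W z w).adjugate b u =
      comatrix W z w b u * w ^ gaugeExp s u.2 := by
  have hdet : (gauge m s w).det ≠ 0 := by
    rw [gauge, Matrix.det_diagonal]
    exact Finset.prod_ne_zero_iff.2 fun p _ => pow_ne_zero _ hw
  have h := congrArg Matrix.adjugate (gauge_mul_cutKasteleyn s W z w)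
  rw [Matrix.adjugate_mul_distrib, Matrix.adjugate_mul_distrib] at h
  have h2 : gauge m s w * (cutKasteleyn s W z w).adjugate =
      (cutKasteleyn 0 W z w).adjugate * gauge m s w := by
    -- Taking adjugates reverses products; multiplying by the gauge on both sides turns each
    -- adjugate of the gauge into the scalar `det`, which is then cancelled.
    have h3 := congrArg (gauge m s w * · * gauge m s w) h
    beta_reduce at h3
    rw [Matrix.mul_assoc, Matrix.mul_assoc, Matrix.adjugate_mul, ← Matrix.mul_assoc (gauge m s w),
      ← Matrix.mul_assoc (gauge m s w) ((gauge m s w).adjugate), Matrix.mul_adjugate] at h3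
    simp only [Matrix.mul_smul, Matrix.smul_mul, Matrix.mul_one, Matrix.one_mul] at h3
    exact smul_right_injective _ hdet h3
  have := congrFun (congrFun h2 b) u
  rw [gauge, Matrix.diagonal_mul, Matrix.mul_diagonal] at this
  exact this

end CutField

variable {m n : ℕ}

/-! ### First order recursions around a cycle. -/

section Cyclic

theorem forall_zmod_of_add_one {k : ℕ} [NeZero k] {p : ZMod k → Prop} (h : ∀ i, p i → p (i + 1))
    {i₀ : ZMod k} (h₀ : p i₀) (i : ZMod k) : p i := by
  have key : ∀ l : ℕ, p (i₀ + l) := by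
    intro l
    induction l with
    | zero => simpa using h₀
    | succ l ih => simpa [add_assoc] using h _ ih
  simpa using key (i - i₀).val

theorem forall_zmod_of_sub_one {k : ℕ} [NeZero k] {p : ZMod k → Prop} (h : ∀ i, p i → p (i - 1))
    {i₀ : ZMod k} (h₀ : p i₀) (i : ZMod k) : p i := by
  have := forall_zmod_of_add_one (p := fun i => p (-i)) (fun i hi => by
    have := h _ hi
    rwa [show -i - 1 = -(i + 1) by ring] at this) (i₀ := -i₀) (by simpa using h₀) (-i)
  simpa using this

theorem prod_range_zmod {M : Type*} [CommMonoid M] {k : ℕ} [NeZero k] (f : ZMod k → M) :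
    ∏ l ∈ Finset.range k, f (l : ZMod k) = ∏ i, f i := by
  refine Finset.prod_bij (fun l _ => (l : ZMod k)) (fun _ _ => Finset.mem_univ _) ?_ ?_
    (fun _ _ => rfl)
  · intro a ha b hb hab
    have := congrArg ZMod.val hab
    rwa [ZMod.val_cast_of_lt (Finset.mem_range.1 ha), ZMod.val_cast_of_lt (Finset.mem_range.1 hb)]
      at this
  · exact fun b _ => ⟨b.val, Finset.mem_range.2 (ZMod.val_lt b), by simp⟩

variable {ι : Type*} [Fintype ι]

/-- All the values have the same strict sign. -/
def SignDefinite (x : ι → ℝ) : Prop := (∀ i, 0 < x i) ∨ ∀ i, x i < 0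

omit [Fintype ι] in
theorem SignDefinite.ne_zero {x : ι → ℝ} (h : SignDefinite x) (i : ι) : x i ≠ 0 := by
  rcases h with h | h
  · exact (h i).ne'
  · exact (h i).ne

omit [Fintype ι] in
theorem SignDefinite.mul_pos {x : ι → ℝ} (h : SignDefinite x) (i j : ι) : 0 < x i * x j := by
  rcases h with h | h
  · exact _root_.mul_pos (h i) (h j)
  · exact mul_pos_of_neg_of_neg (h i) (h j)

omit [Fintype ι] in
theorem SignDefinite.mul_of_pos {x y : ι → ℝ} (h : SignDefinite x) (hy : ∀ i, 0 < y i) :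
    SignDefinite fun i => y i * x i :=
  h.imp (fun h i => _root_.mul_pos (hy i) (h i)) fun h i => mul_neg_of_pos_of_neg (hy i) (h i)

omit [Fintype ι] in
theorem SignDefinite.neg {x : ι → ℝ} (h : SignDefinite x) : SignDefinite fun i => -x i :=
  h.symm.imp (fun h i => neg_pos.2 (h i)) fun h i => neg_neg_of_pos (h i)

/-- A permutation with a single orbit. -/
def IsTransitive (τ : Equiv.Perm ι) : Prop :=
  ∀ p : ι → Prop, (∀ i, p i → p (τ i)) → ∀ i, p i → ∀ j, p j

theorem isTransitive_addRight {k : ℕ} [NeZero k] :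
    IsTransitive (Equiv.addRight (1 : ZMod k)) :=
  fun _ h _ hi j => forall_zmod_of_add_one h hi j

theorem isTransitive_subRight {k : ℕ} [NeZero k] :
    IsTransitive (Equiv.subRight (1 : ZMod k)) :=
  fun _ h _ hi j => forall_zmod_of_sub_one h hi j

omit [Fintype ι] in
-- With a positive source, a nonpositive value at `i` forces a negative one at `τ i`, and a single
-- orbit spreads this to every index. If no value is nonpositive, all are positive.
theorem signDefinite_of_pos {τ : Equiv.Perm ι} (hτ : IsTransitive τ) {α κ x h : ι → ℝ}
    (hα : ∀ i, 0 < α i) (hκ : ∀ i, 0 < κ i) (hx : ∀ i, α i * x i = κ i * x (τ i) + h i)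
    (hh : ∀ i, 0 < h i) : SignDefinite x := by
  have hstep : ∀ i, x i ≤ 0 → x (τ i) < 0 := by
    intro i hi
    have h1 : α i * x i ≤ 0 := mul_nonpos_of_nonneg_of_nonpos (hα i).le hi
    have h2 : κ i * x (τ i) < 0 := by linarith [hx i, hh i]
    by_contra hcon
    push Not at hcon
    linarith [mul_nonneg (hκ i).le hcon]
  by_cases hex : ∃ i, x i ≤ 0
  · obtain ⟨i, hi⟩ := hex
    have hall := hτ (fun i => x i ≤ 0) (fun i hi => (hstep i hi).le) i hi
    refine Or.inr fun j => ?_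
    have := hstep (τ.symm j) (hall _)
    simpa using this
  · push Not at hex
    exact Or.inl hex

omit [Fintype ι] in
theorem SignDefinite.propagate {τ : Equiv.Perm ι} (hτ : IsTransitive τ) {α κ x h : ι → ℝ}
    (hα : ∀ i, 0 < α i) (hκ : ∀ i, 0 < κ i) (hx : ∀ i, α i * x i = κ i * x (τ i) + h i)
    (hh : SignDefinite h) : SignDefinite x := by
  rcases hh with hh | hh
  · exact signDefinite_of_pos hτ hα hκ hx hh
  · have := signDefinite_of_pos hτ (x := fun i => -x i) (h := fun i => -h i) hα hκ
      (fun i => by linarith [hx i]) fun i => neg_pos.2 (hh i)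
    simpa using this.neg

omit [Fintype ι] in
theorem signDefinite_or_zero {τ : Equiv.Perm ι} (hτ : IsTransitive τ) {α κ x : ι → ℝ}
    (hα : ∀ i, 0 < α i) (hκ : ∀ i, 0 < κ i) (hx : ∀ i, α i * x i = κ i * x (τ i)) :
    (∀ i, x i = 0) ∨ SignDefinite x := by
  have hpos : ∀ i, 0 < x i → 0 < x (τ i) := by
    intro i hi
    have := hx i ▸ mul_pos (hα i) hi
    exact (mul_pos_iff_of_pos_left (hκ i)).1 this
  have hneg : ∀ i, x i < 0 → x (τ i) < 0 := by
    intro i hi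
    have : κ i * x (τ i) < 0 := hx i ▸ mul_neg_of_pos_of_neg (hα i) hi
    by_contra hcon
    push Not at hcon
    linarith [mul_nonneg (hκ i).le hcon]
  by_cases h0 : ∀ i, x i = 0
  · exact Or.inl h0
  · push Not at h0
    obtain ⟨i, hi⟩ := h0
    rcases lt_or_gt_of_ne hi with hi | hi
    · exact Or.inr (Or.inr (hτ _ hneg i hi))
    · exact Or.inr (Or.inl (hτ _ hpos i hi))

/-- A zero propagates around the cycle; if there is none, multiplying all the equations lets the
values of `x` cancel. -/
theorem zero_or_prod_eq {𝕜 : Type*} [Field 𝕜] {τ : Equiv.Perm ι} (hτ : IsTransitive τ)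
    {α κ x : ι → 𝕜} (hκ : ∀ i, κ i ≠ 0) (hx : ∀ i, α i * x i + κ i * x (τ i) = 0) :
    (∀ i, x i = 0) ∨ ∏ i, α i = (-1) ^ Fintype.card ι * ∏ i, κ i := by
  by_cases hex : ∃ i, x i = 0
  · obtain ⟨i, hi⟩ := hex
    refine Or.inl (hτ (fun i => x i = 0) (fun i hi => ?_) i hi)
    have := hx i
    rw [hi, mul_zero, zero_add] at this
    exact (mul_eq_zero.1 this).resolve_left (hκ i)
  · push Not at hex
    right
    have h1 : ∏ i, (α i * x i) = ∏ i, (-1 * κ i * x (τ i)) :=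
      Finset.prod_congr rfl fun i _ => by linear_combination hx i
    rw [Finset.prod_mul_distrib, Finset.prod_mul_distrib, Finset.prod_mul_distrib,
      Equiv.prod_comp τ x, Finset.prod_const, Finset.card_univ] at h1
    exact mul_right_cancel₀ (Finset.prod_ne_zero_iff.2 fun i _ => hex i) h1

end Cyclic

/-! ### Roots attached to single columns. -/

section ColumnRatio

variable [NeZero m] (W : Weights m n)

theorem columnRatio_pos (j : ZMod n) : 0 < columnRatio W j :=
  Finset.prod_pos fun i _ => div_pos (W.a_pos i j) (W.c_pos i j)

theorem columnRoot_ne_zero (j : ZMod n) : columnRoot W j ≠ 0 :=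
  mul_ne_zero (pow_ne_zero _ (by norm_num)) (columnRatio_pos W j).ne'

theorem prod_c_pos (j : ZMod n) : 0 < ∏ i, W.c i j := Finset.prod_pos fun i _ => W.c_pos i j

theorem columnRatio_mul (j : ZMod n) : columnRatio W j * ∏ i, W.c i j = ∏ i, W.a i j := by
  rw [columnRatio, Finset.prod_div_distrib, div_mul_cancel₀ _ (prod_c_pos W j).ne']

theorem prod_ite_zero {𝕜 : Type*} [CommRing 𝕜] (f : ZMod m → 𝕜) (z : 𝕜) :
    ∏ i, (f i * if i = 0 then z else 1) = z * ∏ i, f i := by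
  rw [Finset.prod_mul_distrib, Finset.prod_ite_eq' Finset.univ (0 : ZMod m) (fun _ => z), mul_comm]
  simp

variable {𝕜 : Type*} [RCLike 𝕜]

theorem eq_columnRoot_of_prod {j : ZMod n} {z : 𝕜}
    (h : ∏ i, algebraMap ℝ 𝕜 (W.a i j) =
      (-1) ^ Fintype.card (ZMod m) * (z * ∏ i, algebraMap ℝ 𝕜 (W.c i j))) :
    z = algebraMap ℝ 𝕜 (columnRoot W j) := by
  have hc : (algebraMap ℝ 𝕜) (∏ i, W.c i j) ≠ 0 := by
    rw [Ne, FaithfulSMul.algebraMap_eq_zero_iff]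
    exact (prod_c_pos W j).ne'
  refine mul_right_cancel₀ hc ?_
  rw [← map_mul, columnRoot, mul_assoc, columnRatio_mul, map_mul, map_prod, map_prod, h, ZMod.card,
    map_pow, map_neg, map_one, ← mul_assoc, ← mul_assoc, ← mul_pow]
  simp

/-- The equations of an isolated column form one cycle, whose closing condition is exactly that `z`
be the root of the column. -/
theorem rightColumn_zero {j : ZMod n} {z : 𝕜} (hz0 : z ≠ 0)
    (hz : z ≠ algebraMap ℝ 𝕜 (columnRoot W j)) {v : ZMod m → 𝕜}
    (hv : ∀ i, algebraMap ℝ 𝕜 (W.a i j) * v i +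
      algebraMap ℝ 𝕜 (W.c i j) * (if i = 0 then z else 1) * v (i - 1) = 0) (i : ZMod m) :
    v i = 0 := by
  rcases zero_or_prod_eq isTransitive_subRight
    (κ := fun i => algebraMap ℝ 𝕜 (W.c i j) * (if i = 0 then z else 1)) (fun i => by
      have := (W.c_pos i j).ne'
      split_ifs <;> simp [hz0, this]) hv with h | h
  · exact h i
  · rw [prod_ite_zero] at h
    exact absurd (eq_columnRoot_of_prod W h) hz

theorem leftColumn_zero {j : ZMod n} {z : 𝕜} (hz0 : z ≠ 0)
    (hz : z ≠ algebraMap ℝ 𝕜 (columnRoot W j)) {v : ZMod m → 𝕜}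
    (hv : ∀ i, algebraMap ℝ 𝕜 (W.a i j) * v i +
      algebraMap ℝ 𝕜 (W.c (i + 1) j) * (if i + 1 = 0 then z else 1) * v (i + 1) = 0)
    (i : ZMod m) : v i = 0 := by
  rcases zero_or_prod_eq isTransitive_addRight
    (κ := fun i => algebraMap ℝ 𝕜 (W.c (i + 1) j) * (if i + 1 = 0 then z else 1)) (fun i => by
      have := (W.c_pos (i + 1) j).ne'
      split_ifs <;> simp [hz0, this]) hv with h | h
  · exact h i
  · have hshift := Equiv.prod_comp (Equiv.addRight (1 : ZMod m))
      (fun i => algebraMap ℝ 𝕜 (W.c i j) * (if i = 0 then z else 1))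
    have h' := h.trans (congrArg ((-1) ^ Fintype.card (ZMod m) * ·) hshift)
    beta_reduce at h'
    rw [prod_ite_zero] at h'
    exact absurd (eq_columnRoot_of_prod W h') hz

variable [NeZero n]

/-- At `w = 0` the last column of the domain is isolated, and each column is isolated once the next
one is known to vanish; so a kernel vector is killed column by column, from right to left. -/
theorem charPoly_ne_zero {z : 𝕜} (hz0 : z ≠ 0)
    (hz : ∀ j, z ≠ algebraMap ℝ 𝕜 (columnRoot W j)) : charPoly W z 0 ≠ 0 := by
  intro h
  rw [charPoly, ← cutKasteleyn_zero] at h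
  obtain ⟨v, hv0, hv⟩ := Matrix.exists_mulVec_eq_zero_iff.2 h
  have heq : ∀ i j, _ := fun i j => (cutKasteleyn_mulVec 0 W z 0 v i j).symm.trans (congrFun hv _)
  simp only [Pi.zero_apply] at heq
  refine hv0 (funext fun ⟨i, j⟩ => ?_)
  revert i
  have hstep : ∀ j : ZMod n, (j + 1 = 0 ∨ ∀ i, v (i, j + 1) = 0) → ∀ i, v (i, j) = 0 := by
    intro j hj
    refine rightColumn_zero W (j := j) hz0 (hz j) fun i => ?_
    have := heq i j
    rcases hj with hj | hj
    · simpa [hj] using this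
    · simpa [hj i] using this
  refine forall_zmod_of_sub_one (p := fun j => ∀ i, v (i, j) = 0) (fun j hj => ?_)
    (i₀ := -1) ?_ j
  · exact hstep _ (Or.inr (by simpa using hj))
  · exact hstep _ (Or.inl (by simp))

end ColumnRatio

/-! ### Kernels at `(X, 0)` for the two cuts adjacent to column `j₁`. -/

section Tentacle

variable [NeZero m] {W : Weights m n} {j₁ : ZMod n}

theorem columnRoot_ne (hgen : ∀ j, j ≠ j₁ → columnRatio W j ≠ columnRatio W j₁) {j : ZMod n}
    (hj : j ≠ j₁) : columnRoot W j₁ ≠ columnRoot W j := by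
  intro h
  exact hgen j hj (mul_left_cancel₀ (pow_ne_zero m (by norm_num)) h).symm

/-- The substitution `x i ↦ (-1) ^ i.val * x i` makes the column recursion at `X` one with positive
coefficients. The mismatch of parity at the wrap-around `i + 1 = 0` is absorbed by the sign `(-1) ^
m` in the column root. -/
theorem alternating_step (j : ZMod n) (i : ZMod m) :
    (-1 : ℝ) ^ i.val * (if i + 1 = 0 then columnRoot W j else 1) =
      -((-1) ^ (i + 1).val * if i + 1 = 0 then columnRatio W j else 1) := by
  rcases val_add_one_cases i with ⟨h0, h1⟩ | ⟨h0, h1, h2⟩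
  · simp only [h0, if_true, ZMod.val_zero, pow_zero, one_mul, columnRoot]
    have hodd : (-1 : ℝ) ^ (i.val + m) = -1 := Odd.neg_one_pow ⟨i.val, by omega⟩
    rw [← mul_assoc, ← pow_add, hodd]
    ring
  · simp only [h0, if_false, h1, pow_succ]
    ring

theorem alternating_step_sub (j : ZMod n) (i : ZMod m) :
    (-1 : ℝ) ^ i.val * (if i = 0 then columnRoot W j else 1) =
      -((-1) ^ (i - 1).val * if i = 0 then columnRatio W j else 1) := by
  have h2 := alternating_step (W := W) j (i - 1)
  rw [sub_add_cancel] at h2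
  by_cases hi : i = 0
  · simp only [hi, if_true, ZMod.val_zero, pow_zero, one_mul] at h2 ⊢
    have h4 : ((-1 : ℝ) ^ (0 - 1 : ZMod m).val) * ((-1 : ℝ) ^ (0 - 1 : ZMod m).val) = 1 := by
      rw [← mul_pow]; simp
    linear_combination (-1 : ℝ) ^ (0 - 1 : ZMod m).val * h2 - columnRoot W j * h4
  · simp only [hi, if_false, mul_one] at h2 ⊢
    linarith

theorem alternating_step_sub' (j : ZMod n) (i : ZMod m) :
    (-1 : ℝ) ^ (i - 1).val * (if i = 0 then columnRoot W j else 1) =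
      -((-1) ^ i.val * if i = 0 then columnRatio W j else 1) := by
  have h1 : ((-1 : ℝ) ^ i.val) * (-1) ^ i.val = 1 := by rw [← mul_pow]; simp
  have h2 : ((-1 : ℝ) ^ (i - 1).val) * (-1) ^ (i - 1).val = 1 := by rw [← mul_pow]; simp
  linear_combination (-1 : ℝ) ^ i.val * (-1) ^ (i - 1).val * alternating_step_sub (W := W) j i
    - (-1) ^ (i - 1).val * (if i = 0 then columnRoot W j else 1) * h1
    - (-1) ^ i.val * (if i = 0 then columnRatio W j else 1) * h2

theorem ite_pos_one {p : Prop} [Decidable p] {r : ℝ} (hr : 0 < r) : 0 < if p then r else 1 := by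
  split_ifs <;> simp [hr]

theorem left_alternating {h₀ : ℝ} {g : ZMod m × ZMod n → ℝ} {i : ZMod m} {j : ZMod n}
    (h : W.a i j * g (i, j) + h₀ +
      W.c (i + 1) j * (if i + 1 = 0 then columnRoot W j₁ else 1) * g (i + 1, j) = 0) :
    W.a i j * ((-1) ^ i.val * g (i, j)) =
      W.c (i + 1) j * (if i + 1 = 0 then columnRatio W j₁ else 1) *
        ((-1) ^ (i + 1).val * g (i + 1, j)) + -((-1) ^ i.val * h₀) := by
  linear_combination (-1 : ℝ) ^ i.val * h
    - W.c (i + 1) j * g (i + 1, j) * alternating_step (W := W) j₁ i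

theorem right_alternating {h₀ : ℝ} {v : ZMod m × ZMod n → ℝ} {i : ZMod m} {j : ZMod n}
    (h : W.a i j * v (i, j) + h₀ +
      W.c i j * (if i = 0 then columnRoot W j₁ else 1) * v (i - 1, j) = 0) :
    W.a i j * ((-1) ^ i.val * v (i, j)) =
      W.c i j * (if i = 0 then columnRatio W j₁ else 1) *
        ((-1) ^ (i - 1).val * v (i - 1, j)) + -((-1) ^ i.val * h₀) := by
  linear_combination (-1 : ℝ) ^ i.val * h
    - W.c i j * v (i - 1, j) * alternating_step_sub (W := W) j₁ i

variable [NeZero n]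

/-- Alternation of signs in the left kernel at `(X, 0)` for the domain starting at column `j₁`. -/
theorem leftKernel_signDefinite (hgen : ∀ j, j ≠ j₁ → columnRatio W j ≠ columnRatio W j₁)
    {g : ZMod m × ZMod n → ℝ}
    (hg : Matrix.vecMul g (cutKasteleyn j₁ W (columnRoot W j₁) 0) = 0) (hg0 : g ≠ 0) (j : ZMod n) :
    SignDefinite fun i => (-1) ^ i.val * g (i, j) := by
  have heq : ∀ i j, _ := fun i j =>
    (cutKasteleyn_vecMul j₁ W (columnRoot W j₁) 0 g i j).symm.trans (congrFun hg _)
  simp only [Pi.zero_apply, Algebra.algebraMap_self, RingHom.id_apply] at heq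
  have hα : ∀ j i, 0 < W.a i j := fun j i => W.a_pos i j
  have hκ : ∀ j (i : ZMod m), 0 < W.c (i + 1) j * (if i + 1 = 0 then columnRatio W j₁ else 1) :=
    fun j i => mul_pos (W.c_pos _ _) (ite_pos_one (columnRatio_pos W j₁))
  have h1 : SignDefinite fun i => (-1) ^ i.val * g (i, j₁) := by
    rcases signDefinite_or_zero isTransitive_addRight (x := fun i => (-1) ^ i.val * g (i, j₁))
      (hα j₁) (hκ j₁) (fun i => by
        have := left_alternating (heq i j₁)
        simpa using this) with h | h
    · exfalso
      have hz : ∀ j, ∀ i, g (i, j) = 0 := by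
        refine forall_zmod_of_add_one (i₀ := j₁) (fun j hj => ?_) fun i => by simpa using h i
        by_cases hj1 : j + 1 = j₁
        · rw [hj1]
          exact fun i => by simpa using h i
        · refine leftColumn_zero W (j := j + 1) (columnRoot_ne_zero W j₁)
            (columnRoot_ne hgen hj1) fun i => ?_
          have := heq i (j + 1)
          simpa [hj i] using this
      exact hg0 (funext fun ⟨i, j⟩ => hz j i)
    · exact h
  -- Column `j` is the source term of the recursion in column `j + 1`, so a definite sign travels to
  -- the right from `j₁` until it meets the cut.
  refine forall_zmod_of_add_one (p := fun j => SignDefinite fun i => (-1) ^ i.val * g (i, j))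
    (fun j hj => ?_) h1 j
  by_cases hj1 : j + 1 = j₁
  · rwa [hj1]
  · refine SignDefinite.propagate isTransitive_addRight (hα (j + 1)) (hκ (j + 1))
      (fun i => left_alternating (heq i (j + 1))) ?_
    have := (hj.mul_of_pos (y := fun i => W.b i j) fun i => W.b_pos i j).neg
    convert this using 3
    simp [hj1]
    ring

/-- Mirror image of the left kernel: with the cut after `j₁`, column `j₁` obeys a homogeneous
recursion and each column is the source for the one on its left. -/
theorem rightKernel_signDefinite (hgen : ∀ j, j ≠ j₁ → columnRatio W j ≠ columnRatio W j₁)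
    {v : ZMod m × ZMod n → ℝ}
    (hv : (cutKasteleyn (j₁ + 1) W (columnRoot W j₁) 0).mulVec v = 0) (hv0 : v ≠ 0) (j : ZMod n) :
    SignDefinite fun i => (-1) ^ i.val * v (i, j) := by
  have heq : ∀ i j, _ := fun i j =>
    (cutKasteleyn_mulVec (j₁ + 1) W (columnRoot W j₁) 0 v i j).symm.trans (congrFun hv _)
  simp only [Pi.zero_apply, Algebra.algebraMap_self, RingHom.id_apply, add_left_inj] at heq
  have hα : ∀ j i, 0 < W.a i j := fun j i => W.a_pos i j
  have hκ : ∀ j (i : ZMod m), 0 < W.c i j * (if i = 0 then columnRatio W j₁ else 1) :=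
    fun j i => mul_pos (W.c_pos _ _) (ite_pos_one (columnRatio_pos W j₁))
  have h1 : SignDefinite fun i => (-1) ^ i.val * v (i, j₁) := by
    rcases signDefinite_or_zero isTransitive_subRight (x := fun i => (-1) ^ i.val * v (i, j₁))
      (hα j₁) (hκ j₁) (fun i => by
        have := right_alternating (heq i j₁)
        simpa using this) with h | h
    · exfalso
      have hz : ∀ j, ∀ i, v (i, j) = 0 := by
        refine forall_zmod_of_sub_one (i₀ := j₁) (fun j hj => ?_) fun i => by simpa using h i
        by_cases hj1 : j - 1 = j₁
        · rw [hj1]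
          exact fun i => by simpa using h i
        · refine rightColumn_zero W (j := j - 1) (columnRoot_ne_zero W j₁)
            (columnRoot_ne hgen hj1) fun i => ?_
          have := heq i (j - 1)
          simpa [hj i] using this
      exact hv0 (funext fun ⟨i, j⟩ => hz j i)
    · exact h
  refine forall_zmod_of_sub_one (p := fun j => SignDefinite fun i => (-1) ^ i.val * v (i, j))
    (fun j hj => ?_) h1 j
  by_cases hj1 : j - 1 = j₁
  · rwa [hj1]
  · refine SignDefinite.propagate isTransitive_subRight (hα (j - 1)) (hκ (j - 1))
      (fun i => right_alternating (heq i (j - 1))) ?_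
    have := (hj.mul_of_pos (y := fun i => W.b i (j - 1)) fun i => W.b_pos i (j - 1)).neg
    convert this using 3
    simp [hj1]
    ring

/-- With the cut before `j₁`, column `j₁ - 1` sees no source, and going left from there each column
other than `j₁` is nonsingular at `X`; only `j₁` can carry a kernel vector. -/
theorem rightKernel_support (hgen : ∀ j, j ≠ j₁ → columnRatio W j ≠ columnRatio W j₁)
    {v : ZMod m × ZMod n → ℝ}
    (hv : (cutKasteleyn j₁ W (columnRoot W j₁) 0).mulVec v = 0) :
    (∀ i j, j ≠ j₁ → v (i, j) = 0) ∧
      ((∀ i, v (i, j₁) = 0) ∨ SignDefinite fun i => (-1) ^ i.val * v (i, j₁)) := by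
  have heq : ∀ i j, _ := fun i j =>
    (cutKasteleyn_mulVec j₁ W (columnRoot W j₁) 0 v i j).symm.trans (congrFun hv _)
  simp only [Pi.zero_apply, Algebra.algebraMap_self, RingHom.id_apply] at heq
  have hz : ∀ j, j ≠ j₁ → ∀ i, v (i, j) = 0 := by
    refine forall_zmod_of_sub_one (i₀ := j₁) (fun j hj hj1 => ?_) fun h => absurd rfl h
    refine rightColumn_zero W (j := j - 1) (columnRoot_ne_zero W j₁)
      (columnRoot_ne hgen hj1) fun i => ?_
    have := heq i (j - 1)
    rw [sub_add_cancel] at this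
    by_cases hjj : j = j₁
    · simpa [hjj] using this
    · simpa [hj hjj i] using this
  refine ⟨fun i j hj => hz j hj i, ?_⟩
  rcases signDefinite_or_zero isTransitive_subRight (x := fun i => (-1) ^ i.val * v (i, j₁))
    (fun i => W.a_pos i j₁)
    (fun i => mul_pos (W.c_pos i j₁) (ite_pos_one (p := i = 0) (columnRatio_pos W j₁))) (fun i => by
      have := right_alternating (heq i j₁)
      by_cases hjj : j₁ + 1 = j₁
      · simpa [hjj] using this
      · simpa [hz _ hjj i] using this) with h | h
  · exact Or.inl fun i => by simpa using h i
  · exact Or.inr h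

theorem leftKernel_support (hgen : ∀ j, j ≠ j₁ → columnRatio W j ≠ columnRatio W j₁)
    {g : ZMod m × ZMod n → ℝ}
    (hg : Matrix.vecMul g (cutKasteleyn (j₁ + 1) W (columnRoot W j₁) 0) = 0) :
    (∀ i j, j ≠ j₁ → g (i, j) = 0) ∧
      ((∀ i, g (i, j₁) = 0) ∨ SignDefinite fun i => (-1) ^ i.val * g (i, j₁)) := by
  have heq : ∀ i j, _ := fun i j =>
    (cutKasteleyn_vecMul (j₁ + 1) W (columnRoot W j₁) 0 g i j).symm.trans (congrFun hg _)
  simp only [Pi.zero_apply, Algebra.algebraMap_self, RingHom.id_apply] at heq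
  have hz : ∀ j, j ≠ j₁ → ∀ i, g (i, j) = 0 := by
    refine forall_zmod_of_add_one (i₀ := j₁) (fun j hj hj1 => ?_) fun h => absurd rfl h
    refine leftColumn_zero W (j := j + 1) (columnRoot_ne_zero W j₁)
      (columnRoot_ne hgen hj1) fun i => ?_
    have := heq i (j + 1)
    rw [add_sub_cancel_right] at this
    by_cases hjj : j = j₁
    · simpa [hjj] using this
    · simpa [hj hjj i] using this
  refine ⟨fun i j hj => hz j hj i, ?_⟩
  rcases signDefinite_or_zero isTransitive_addRight (x := fun i => (-1) ^ i.val * g (i, j₁))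
    (fun i => W.a_pos i j₁)
    (fun i => mul_pos (W.c_pos (i + 1) j₁)
      (ite_pos_one (p := i + 1 = 0) (columnRatio_pos W j₁))) (fun i => by
      have := left_alternating (heq i j₁)
      by_cases hjj : j₁ = j₁ + 1
      · simpa [← hjj] using this
      · have hjj' : j₁ - 1 ≠ j₁ := fun h => hjj (by rw [sub_eq_iff_eq_add] at h; exact h)
        simpa [hz _ hjj' i] using this) with h | h
  · exact Or.inl fun i => by simpa using h i
  · exact Or.inr h

end Tentacle

variable {m n : ℕ} [NeZero m] [NeZero n] {W : Weights m n} {j₁ : ZMod n}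

/-! ### `(X, 0)` is a zero, and entries of the adjugate there are nonzero. -/

section RootOfP

/-- The solution is the partial product of the ratios `κ / α`; equality of the full products is what
closes the cycle. -/
theorem exists_column_solution {α κ : ZMod m → ℝ} (hα : ∀ i, 0 < α i) (hκ : ∀ i, 0 < κ i)
    (h : ∏ i, α i = ∏ i, κ i) :
    ∃ y : ZMod m → ℝ, (∀ i, 0 < y i) ∧ ∀ i, α i * y i = κ i * y (i - 1) := by
  set q : ZMod m → ℝ := fun i => κ i / α i with hq
  have hq1 : ∏ i, q i = 1 := by
    rw [hq, Finset.prod_div_distrib, h, div_self]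
    exact (Finset.prod_pos fun i _ => hκ i).ne'
  have hqpos : ∀ i, 0 < q i := fun i => div_pos (hκ i) (hα i)
  have hαq : ∀ i, κ i = α i * q i := fun i => by rw [hq]; field_simp [(hα i).ne']
  refine ⟨fun i => ∏ k ∈ Finset.range i.val, q ((k : ZMod m) + 1),
    fun i => Finset.prod_pos fun _ _ => hqpos _, fun i => ?_⟩
  obtain ⟨i, rfl⟩ : ∃ l, i = l + 1 := ⟨i - 1, by simp⟩
  simp only [add_sub_cancel_right]
  rw [hαq (i + 1), mul_assoc]
  congr 1
  have hlast : q (i + 1) * ∏ k ∈ Finset.range i.val, q ((k : ZMod m) + 1) =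
      ∏ k ∈ Finset.range (i.val + 1), q ((k : ZMod m) + 1) := by
    rw [Finset.prod_range_succ, mul_comm]
    simp
  rw [hlast]
  rcases val_add_one_cases i with ⟨h0, h1⟩ | ⟨h0, h1, h2⟩
  · rw [h0, ZMod.val_zero, Finset.prod_range_zero, h1,
      prod_range_zmod (fun k : ZMod m => q (k + 1))]
    exact (hq1.symm.trans (Equiv.prod_comp (Equiv.addRight (1 : ZMod m)) q).symm)
  · rw [h1]

theorem det_cutKasteleyn_columnRoot (W : Weights m n) (j₁ s : ZMod n) :
    (cutKasteleyn s W (columnRoot W j₁) 0).det = 0 := by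
  rw [det_cutKasteleyn, ← det_cutKasteleyn j₁, ← Matrix.exists_mulVec_eq_zero_iff]
  obtain ⟨y, hy, hrec⟩ := exists_column_solution (α := fun i => W.a i j₁)
    (κ := fun i => W.c i j₁ * if i = 0 then columnRatio W j₁ else 1) (fun i => W.a_pos i j₁)
    (fun i => mul_pos (W.c_pos i j₁) (ite_pos_one (columnRatio_pos W j₁)))
    (by rw [prod_ite_zero, columnRatio_mul])
  -- With the cut at `j₁` an alternating vector supported in this column is already in the kernel;
  -- the determinant does not depend on the cut.
  refine ⟨fun p => if p.2 = j₁ then (-1) ^ p.1.val * y p.1 else 0, fun h => ?_, ?_⟩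
  · have := congrFun h (0, j₁)
    simp [(hy 0).ne'] at this
  · ext ⟨i, j⟩
    rw [cutKasteleyn_mulVec]
    simp only [Pi.zero_apply, Algebra.algebraMap_self, RingHom.id_apply]
    by_cases hj : j = j₁
    · have hb : W.b i j * (if j + 1 = j₁ then (0 : ℝ) else 1) *
          (if j + 1 = j₁ then (-1) ^ i.val * y i else 0) = 0 := by split_ifs <;> simp
      rw [hb]
      simp only [hj, if_true]
      linear_combination (-1 : ℝ) ^ i.val * hrec i
        + W.c i j₁ * y (i - 1) * alternating_step_sub' (W := W) j₁ i
    · have hb : W.b i j * (if j + 1 = j₁ then (0 : ℝ) else 1) *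
          (if j + 1 = j₁ then (-1) ^ i.val * y i else 0) = 0 := by split_ifs <;> simp
      rw [hb]
      simp [hj]

/-- A right kernel vector lives in column `j₁` and vanishes nowhere there unless it is zero, while a
nonzero left kernel vector vanishes nowhere at all; these are the two conditions of
`adjugate_ne_zero`. -/
theorem cut_adjugate_left_ne_zero
    (hgen : ∀ j, j ≠ j₁ → columnRatio W j ≠ columnRatio W j₁) (i : ZMod m)
    (p : ZMod m × ZMod n) : (cutKasteleyn j₁ W (columnRoot W j₁) 0).adjugate (i, j₁) p ≠ 0 := by
  obtain ⟨g, hg0, hg⟩ :=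
    Matrix.exists_vecMul_eq_zero_iff.2 (det_cutKasteleyn_columnRoot W j₁ j₁)
  refine adjugate_ne_zero (fun v hv hvi => ?_) hg (fun h => ?_)
  · obtain ⟨h1, h2⟩ := rightKernel_support hgen hv
    rcases h2 with h2 | h2
    · ext ⟨k, l⟩
      by_cases hl : l = j₁
      · rw [hl, h2]; rfl
      · exact h1 k l hl
    · exact absurd (by rw [hvi, mul_zero]) (h2.ne_zero i)
  · exact (leftKernel_signDefinite hgen hg hg0 p.2).ne_zero p.1 (by rw [h, mul_zero])

theorem cut_adjugate_right_ne_zero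
    (hgen : ∀ j, j ≠ j₁ → columnRatio W j ≠ columnRatio W j₁) (p : ZMod m × ZMod n)
    (i : ZMod m) :
    (cutKasteleyn (j₁ + 1) W (columnRoot W j₁) 0).adjugate p (i, j₁) ≠ 0 := by
  obtain ⟨g, hg0, hg⟩ :=
    Matrix.exists_vecMul_eq_zero_iff.2 (det_cutKasteleyn_columnRoot W j₁ (j₁ + 1))
  refine adjugate_ne_zero (fun v hv hvi => ?_) hg (fun h => ?_)
  · by_contra hv0
    exact (rightKernel_signDefinite hgen hv hv0 p.2).ne_zero p.1 (by rw [hvi, mul_zero])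
  · obtain ⟨h1, h2⟩ := leftKernel_support hgen hg
    rcases h2 with h2 | h2
    · refine hg0 (funext fun ⟨k, l⟩ => ?_)
      by_cases hl : l = j₁
      · rw [hl, h2]; rfl
      · exact h1 k l hl
    · exact h2.ne_zero i (by rw [h, mul_zero])

end RootOfP

/-! ### Partial derivatives of `P` at `(X, 0)`. -/

section Derivatives

theorem cut_adjugate_ofReal (s : ZMod n) (W : Weights m n) (x y : ℝ) (p q : ZMod m × ZMod n) :
    (cutKasteleyn s W (x : ℂ) (y : ℂ)).adjugate p q =
      (((cutKasteleyn s W x y).adjugate p q : ℝ) : ℂ) := by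
  have h2 := Complex.ofRealHom.map_adjugate (cutKasteleyn s W x y)
  have h3 : Complex.ofRealHom.mapMatrix (cutKasteleyn s W x y) =
      cutKasteleyn s W (x : ℂ) (y : ℂ) := by
    ext p q
    exact congrFun (congrFun (cutKasteleyn_map Complex.ofRealAm s W x y) p) q
  rw [h3] at h2
  rw [← h2]
  rfl

variable {𝕜 : Type*} [RCLike 𝕜]

/-- Jacobi's formula for the cut at `s`, where `w` occurs only on the `b`-edges from column `s - 1`
to column `s`. The freedom in `s` allows the cut whose adjugate has known signs. -/
theorem hasDerivAt_charPoly_snd (s : ZMod n) (W : Weights m n) (z w : 𝕜) :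
    HasDerivAt (fun w => charPoly W z w) (∑ i, algebraMap ℝ 𝕜 (W.b i (s - 1)) *
      (cutKasteleyn s W z w).adjugate (i, s) (i, s - 1)) w := by
  have h := hasDerivAt_det (A := fun w => cutKasteleyn s W z w)
    (A' := Matrix.of fun p q => if q = (p.1, p.2 + 1) then
      algebraMap ℝ 𝕜 (W.b p.1 p.2) * (if p.2 + 1 = s then 1 else 0) else 0) (x := w)
    (fun p q => by
      simp only [cutKasteleyn, Matrix.of_apply]
      have h2 : HasDerivAt (fun y : 𝕜 => if q = (p.1, p.2 + 1) then
          algebraMap ℝ 𝕜 (W.b p.1 p.2) * (if p.2 + 1 = s then y else 1) else 0)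
          (if q = (p.1, p.2 + 1) then
            algebraMap ℝ 𝕜 (W.b p.1 p.2) * (if p.2 + 1 = s then 1 else 0) else 0) w := by
        split_ifs
        · exact (hasDerivAt_id w).const_mul _
        · rw [mul_zero]; exact hasDerivAt_const _ _
        · exact hasDerivAt_const _ _
      exact (h2.const_add _).add_const _)
  simp only [det_cutKasteleyn] at h
  convert h using 1
  simp only [Matrix.of_apply, ite_mul, zero_mul, Finset.sum_ite_eq', Finset.mem_univ, if_true,
    Fintype.sum_prod_type, mul_ite, mul_one, mul_zero]
  refine Finset.sum_congr rfl fun i _ => ?_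
  rw [Finset.sum_eq_single (s - 1)]
  · simp
  · intro j _ hj
    rw [if_neg fun h => hj (eq_sub_of_add_eq h)]
  · simp

theorem hasDerivAt_charPoly_fst (s : ZMod n) (W : Weights m n) (z w : 𝕜) :
    HasDerivAt (fun z => charPoly W z w) (∑ j, algebraMap ℝ 𝕜 (W.c 0 j) *
      (cutKasteleyn s W z w).adjugate (-1, j) (0, j)) z := by
  have h := hasDerivAt_det (A := fun z => cutKasteleyn s W z w)
    (A' := Matrix.of fun p q => if q = (p.1 - 1, p.2) then
      algebraMap ℝ 𝕜 (W.c p.1 p.2) * (if p.1 = 0 then 1 else 0) else 0) (x := z)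
    (fun p q => by
      simp only [cutKasteleyn, Matrix.of_apply]
      have h2 : HasDerivAt (fun y : 𝕜 => if q = (p.1 - 1, p.2) then
          algebraMap ℝ 𝕜 (W.c p.1 p.2) * (if p.1 = 0 then y else 1) else 0)
          (if q = (p.1 - 1, p.2) then
            algebraMap ℝ 𝕜 (W.c p.1 p.2) * (if p.1 = 0 then 1 else 0) else 0) z := by
        split_ifs
        · exact (hasDerivAt_id z).const_mul _
        · rw [mul_zero]; exact hasDerivAt_const _ _
        · exact hasDerivAt_const _ _
      exact h2.const_add _)
  simp only [det_cutKasteleyn] at h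
  convert h using 1
  simp only [Matrix.of_apply, ite_mul, zero_mul, Finset.sum_ite_eq', Finset.mem_univ, if_true,
    Fintype.sum_prod_type_right, mul_ite, mul_one, mul_zero]
  refine Finset.sum_congr rfl fun j _ => ?_
  simp

/-- The characteristic polynomial has non-vanishing partial derivatives at `(X, 0)`, and these are
real. -/
theorem exists_partial_derivatives
    (hgen : ∀ j, j ≠ j₁ → columnRatio W j ≠ columnRatio W j₁) :
    ∃ p₁ p₂ : ℝ, p₁ ≠ 0 ∧ p₂ ≠ 0 ∧
      tentacleBeta W j₁ = -p₂ / (columnRoot W j₁ * p₁) ∧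
      HasDerivAt (fun z : ℂ => charPoly W z 0) p₁ (columnRoot W j₁ : ℝ) ∧
      HasDerivAt (fun w : ℂ => charPoly W ((columnRoot W j₁ : ℝ) : ℂ) w) p₂ 0 := by
  set X := columnRoot W j₁ with hX
  set Q := (cutKasteleyn j₁ W X 0).adjugate with hQ
  have hmap : ∀ p q, (cutKasteleyn j₁ W (X : ℂ) 0).adjugate p q = ((Q p q : ℝ) : ℂ) := by
    intro p q
    have h := cut_adjugate_ofReal j₁ W X 0 p q
    rwa [Complex.ofReal_zero] at h
  have hdet := det_cutKasteleyn_columnRoot W j₁ j₁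
  refine ⟨∑ j, W.c 0 j * Q (-1, j) (0, j), ∑ i, W.b i (j₁ - 1) * Q (i, j₁) (i, j₁ - 1), ?_, ?_,
    ?_, ?_, ?_⟩
  -- The columns of the adjugate are right kernel vectors, hence supported in column `j₁`: a single
  -- nonzero term remains.
  · rw [Finset.sum_eq_single j₁]
    · exact mul_ne_zero (W.c_pos _ _).ne' (cut_adjugate_left_ne_zero hgen _ _)
    · intro j _ hj
      exact mul_eq_zero_of_right _
        ((rightKernel_support hgen (mulVec_adjugate_col hdet (0, j))).1 (-1) j hj)
    · simp
  · have hcol : ∀ i', SignDefinite fun i : ZMod m => (-1) ^ i.val * Q (i, j₁) (i', j₁ - 1) := by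
      intro i'
      rcases (rightKernel_support hgen (mulVec_adjugate_col hdet (i', j₁ - 1))).2 with h | h
      · exact absurd (h 0) (cut_adjugate_left_ne_zero hgen _ _)
      · exact h
    have hrow : ∀ i, SignDefinite fun i' : ZMod m => (-1) ^ i'.val * Q (i, j₁) (i', j₁ - 1) := by
      intro i
      refine leftKernel_signDefinite hgen (vecMul_adjugate_row hdet (i, j₁)) (fun h => ?_) _
      exact cut_adjugate_left_ne_zero hgen i (0, 0) (congrFun h (0, 0))
    -- All terms of `∂₂P` have the same sign: going from the entry of index `0` to that of index `i`
    -- through `Q (0, j₁) (i, j₁ - 1)` picks up `(-1) ^ i.val` once along a row and once along a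
    -- column.
    have hprod : ∀ i, 0 < Q (0, j₁) (0, j₁ - 1) * Q (i, j₁) (i, j₁ - 1) := by
      intro i
      have h1 := (hrow 0).mul_pos 0 i
      have h2 := (hcol i).mul_pos 0 i
      have h3 : ((-1 : ℝ) ^ i.val) * ((-1 : ℝ) ^ i.val) = 1 := by rw [← mul_pow]; simp
      simp only [ZMod.val_zero, pow_zero, one_mul] at h1 h2
      have h4 := mul_pos h1 h2
      have h5 : Q (0, j₁) (0, j₁ - 1) * ((-1) ^ i.val * Q (0, j₁) (i, j₁ - 1)) *
          (Q (0, j₁) (i, j₁ - 1) * ((-1) ^ i.val * Q (i, j₁) (i, j₁ - 1))) =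
          Q (0, j₁) (0, j₁ - 1) * Q (i, j₁) (i, j₁ - 1) * (Q (0, j₁) (i, j₁ - 1)) ^ 2 := by
        linear_combination Q (0, j₁) (0, j₁ - 1) * Q (i, j₁) (i, j₁ - 1) *
          (Q (0, j₁) (i, j₁ - 1)) ^ 2 * h3
      rw [h5] at h4
      exact (mul_pos_iff_of_pos_right (pow_two_pos_of_ne_zero (cut_adjugate_left_ne_zero hgen _ _))).1 h4
    intro h0
    have hpos : 0 < Q (0, j₁) (0, j₁ - 1) * ∑ i, W.b i (j₁ - 1) * Q (i, j₁) (i, j₁ - 1) := by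
      rw [Finset.mul_sum]
      refine Finset.sum_pos (fun i _ => ?_) Finset.univ_nonempty
      have := mul_pos (W.b_pos i (j₁ - 1)) (hprod i)
      linarith
    rw [h0, mul_zero] at hpos
    exact lt_irrefl _ hpos
  · have h1 := (hasDerivAt_charPoly_fst j₁ W X (0 : ℝ)).deriv
    have h2 := (hasDerivAt_charPoly_snd j₁ W X (0 : ℝ)).deriv
    rw [tentacleBeta, ← hX, h1, h2]
    simp [hQ]
  · have key : ((∑ j, W.c 0 j * Q (-1, j) (0, j) : ℝ) : ℂ) =
        ∑ j, algebraMap ℝ ℂ (W.c 0 j) * (cutKasteleyn j₁ W (X : ℂ) 0).adjugate (-1, j) (0, j) := by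
      simp only [hmap]
      push_cast
      rfl
    rw [key]
    exact hasDerivAt_charPoly_fst j₁ W (X : ℂ) (0 : ℂ)
  · have key : ((∑ i, W.b i (j₁ - 1) * Q (i, j₁) (i, j₁ - 1) : ℝ) : ℂ) =
        ∑ i, algebraMap ℝ ℂ (W.b i (j₁ - 1)) *
          (cutKasteleyn j₁ W (X : ℂ) 0).adjugate (i, j₁) (i, j₁ - 1) := by
      simp only [hmap]
      push_cast
      rfl
    rw [key]
    exact hasDerivAt_charPoly_snd j₁ W (X : ℂ) (0 : ℂ)

end Derivatives

/-! ### Smoothness in `(z, w)`. -/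

section Complex

omit [NeZero m] [NeZero n] in
theorem contDiff_cutKasteleyn (s : ZMod n) (W : Weights m n) (p q : ZMod m × ZMod n) :
    ContDiff ℂ ⊤ fun x : ℂ × ℂ => cutKasteleyn s W x.1 x.2 p q := by
  simp only [cutKasteleyn, Matrix.of_apply]
  split_ifs <;> fun_prop

theorem contDiff_det {ι : Type*} [Fintype ι] [DecidableEq ι] {M : ℂ × ℂ → Matrix ι ι ℂ}
    (h : ∀ i j, ContDiff ℂ ⊤ fun x => M x i j) : ContDiff ℂ ⊤ fun x => (M x).det := by
  simp_rw [Matrix.det_apply']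
  exact ContDiff.sum fun σ _ => contDiff_const.mul (contDiff_prod fun i _ => h _ _)

theorem contDiff_charPoly (W : Weights m n) :
    ContDiff ℂ ⊤ fun x : ℂ × ℂ => charPoly W x.1 x.2 :=
  contDiff_det fun p q => contDiff_cutKasteleyn 0 W p q

theorem contDiff_cut_adjugate (s : ZMod n) (W : Weights m n) (p q : ZMod m × ZMod n) :
    ContDiff ℂ ⊤ fun x : ℂ × ℂ => (cutKasteleyn s W x.1 x.2).adjugate p q := by
  simp_rw [Matrix.adjugate_apply]
  refine contDiff_det fun i j => ?_
  by_cases hi : i = q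
  · subst hi
    simp only [Matrix.updateRow_self]
    exact contDiff_const
  · simp only [Matrix.updateRow_ne hi]
    exact contDiff_cutKasteleyn s W i j

end Complex

/-! ### Factorization of the adjugate on the zero set. -/

section RankOne

theorem gaugeExp_transfer (j₁ j : ZMod n) :
    1 + gaugeExp (j₁ + 1) j =
      gaugeExp j₁ j + gaugeExp (j₁ + 1) j₁ + if j = j₁ then 0 else 1 := by
  have hval : j = j₁ ↔ j.val = j₁.val := ⟨fun h => by rw [h], fun h => ZMod.val_injective n h⟩
  have hj := ZMod.val_lt j
  rcases val_add_one_cases j₁ with ⟨h0, h1⟩ | ⟨h0, h1, h2⟩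
  · simp only [gaugeExp, h0, ZMod.val_zero, hval]
    split_ifs <;> omega
  · simp only [gaugeExp, h1, hval]
    split_ifs <;> omega

theorem gaugeExp_cross {j₁ j : ZMod n} (hj : j ≠ j₁) :
    gaugeExp j₁ j + gaugeExp (j₁ + 1) j₁ = gaugeExp (j + 1) j + gaugeExp (j₁ + 1) (j + 1) := by
  have hval : j.val ≠ j₁.val := fun h => hj (ZMod.val_injective n h)
  have hjl := ZMod.val_lt j
  rcases val_add_one_cases j₁ with ⟨h0, h1⟩ | ⟨h0, h1, h2⟩ <;>
  rcases val_add_one_cases j with ⟨h0', h1'⟩ | ⟨h0', h1', h2'⟩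
  · omega
  · simp only [gaugeExp, h0, h1', ZMod.val_zero]
    split_ifs <;> omega
  · simp only [gaugeExp, h1, h0', ZMod.val_zero]
    split_ifs <;> omega
  · simp only [gaugeExp, h1, h1']
    split_ifs <;> omega

theorem gaugeExp_add_one_self (j : ZMod n) :
    gaugeExp (j + 1) j = if j + 1 = 0 then 1 else 0 := by
  rcases val_add_one_cases j with ⟨h0, h1⟩ | ⟨h0, h1, h2⟩
  · simp [gaugeExp, h0]
  · simp [gaugeExp, h0, h1]

variable {z w : ℂ}

theorem cut_adjugate_mul_of_root {s : ZMod n} (h : charPoly W z w = 0)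
    (b u b' u' : ZMod m × ZMod n) :
    (cutKasteleyn s W z w).adjugate b u * (cutKasteleyn s W z w).adjugate b' u' =
      (cutKasteleyn s W z w).adjugate b u' * (cutKasteleyn s W z w).adjugate b' u :=
  adjugate_mul_adjugate_of_det_eq_zero (by rw [det_cutKasteleyn, h]) b u b' u'

theorem cut_adjugate_same_column (s : ZMod n) (W : Weights m n) (z : ℂ) {w : ℂ} (hw : w ≠ 0)
    {b u : ZMod m × ZMod n} (h : b.2 = u.2) :
    (cutKasteleyn s W z w).adjugate b u = comatrix W z w b u := by
  have := gauge_mul_adjugate s W z hw b u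
  rw [h, mul_comm] at this
  exact mul_right_cancel₀ (pow_ne_zero _ hw) this

/-- The cuts before and after `j₁` differ by a gauge supported on column `j₁`. The factor `w` it
leaves between `j₁` and any other column is the one that cancels the root in the residue. -/
theorem cut_adjugate_transfer (W : Weights m n) (z : ℂ) {w : ℂ} (hw : w ≠ 0) (j₁ : ZMod n)
    (b : ZMod m × ZMod n) (i : ZMod m) :
    (cutKasteleyn j₁ W z w).adjugate b (i, j₁) =
      w ^ (if b.2 = j₁ then 0 else 1) * (cutKasteleyn (j₁ + 1) W z w).adjugate b (i, j₁) := by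
  have h1 := gauge_mul_adjugate j₁ W z hw b (i, j₁)
  have h2 := gauge_mul_adjugate (j₁ + 1) W z hw b (i, j₁)
  simp only [gaugeExp_self, pow_one] at h1 h2
  have h3 := gaugeExp_transfer j₁ b.2
  have h4 := congrArg (fun e => w ^ e) h3
  simp only [pow_add, pow_one] at h4
  refine mul_left_cancel₀ (mul_ne_zero (pow_ne_zero (gaugeExp j₁ b.2) hw)
    (pow_ne_zero (gaugeExp (j₁ + 1) j₁) hw)) ?_
  linear_combination w ^ gaugeExp (j₁ + 1) j₁ * h1 - w * h2
    + (cutKasteleyn (j₁ + 1) W z w).adjugate b (i, j₁) * h4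

/-- Factorization of the comatrix at a root, inside a column other than `j₁`. -/
theorem comatrix_of_root_same_column (h : charPoly W z w = 0) (hw : w ≠ 0)
    {b u : ZMod m × ZMod n} (hb : b.2 = u.2) (hj : b.2 ≠ j₁) :
    (cutKasteleyn j₁ W z w).adjugate (0, j₁) (0, j₁) * comatrix W z w b u =
      w * ((cutKasteleyn (j₁ + 1) W z w).adjugate b (0, j₁) *
        (cutKasteleyn j₁ W z w).adjugate (0, j₁) u) := by
  rw [← cut_adjugate_same_column j₁ W z hw hb, mul_comm, cut_adjugate_mul_of_root h,
    cut_adjugate_transfer W z hw, if_neg hj]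
  ring

/-- Factorization of the comatrix at a root, between neighbouring columns. -/
theorem cut_adjugate_of_root_next_column (h : charPoly W z w = 0) (hw : w ≠ 0)
    {b u : ZMod m × ZMod n} (hb : b.2 = u.2 + 1) (hj : u.2 ≠ j₁) :
    (cutKasteleyn j₁ W z w).adjugate (0, j₁) (0, j₁) *
        (cutKasteleyn (u.2 + 1) W z w).adjugate b u =
      (cutKasteleyn (j₁ + 1) W z w).adjugate b (0, j₁) *
        (cutKasteleyn j₁ W z w).adjugate (0, j₁) u := by
  have h1 := gauge_mul_adjugate (u.2 + 1) W z hw b u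
  have h2 := gauge_mul_adjugate (j₁ + 1) W z hw b (0, j₁)
  have h3 := gauge_mul_adjugate j₁ W z hw (0, j₁) u
  have h4 := cut_adjugate_same_column j₁ W z hw (b := (0, j₁)) (u := (0, j₁)) rfl
  have h5 : comatrix W z w b u * comatrix W z w (0, j₁) (0, j₁) =
      comatrix W z w b (0, j₁) * comatrix W z w (0, j₁) u :=
    adjugate_mul_adjugate_of_det_eq_zero h _ _ _ _
  have h6 := congrArg (fun e => w ^ e) (gaugeExp_cross hj)
  rw [hb] at h1 h2
  simp only [gaugeExp_self, pow_one, pow_add] at h1 h2 h3 h6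
  rw [h4]
  set c := comatrix W z w (0, j₁) (0, j₁)
  refine mul_left_cancel₀ (mul_ne_zero hw (mul_ne_zero (pow_ne_zero (gaugeExp j₁ u.2) hw)
    (pow_ne_zero (gaugeExp (j₁ + 1) j₁) hw))) ?_
  set A := (cutKasteleyn (u.2 + 1) W z w).adjugate b u
  set F := (cutKasteleyn (j₁ + 1) W z w).adjugate b (0, j₁)
  set G := (cutKasteleyn j₁ W z w).adjugate (0, j₁) u
  set e1 := w ^ gaugeExp j₁ u.2
  set e2 := w ^ gaugeExp (j₁ + 1) j₁
  set e3 := w ^ gaugeExp (u.2 + 1) u.2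
  set e4 := w ^ gaugeExp (j₁ + 1) (u.2 + 1)
  linear_combination e1 * e2 * c * h1 + e1 * e2 * e3 * h5
    - e3 * e2 * comatrix W z w b (0, j₁) * h3 - e3 * w * G * h2 - w * F * G * h6

/-- Moving the cut to the column of the black end makes every `b`-edge carry a visible factor `w`,
whether or not it leaves the original domain. -/
theorem coeff_b_mul_comatrix (W : Weights m n) (z : ℂ) (hw : w ≠ 0) {b u : ZMod m × ZMod n}
    (hb : b.2 = u.2 + 1) (i : ZMod m) :
    coeff W z w .b (i, u.2) * comatrix W z w b u =
      W.b i u.2 * w * (cutKasteleyn (u.2 + 1) W z w).adjugate b u := by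
  have h1 := gauge_mul_adjugate (u.2 + 1) W z hw b u
  rw [hb, gaugeExp_self, pow_one, gaugeExp_add_one_self] at h1
  rw [mul_assoc, h1, coeff]
  simp only [Complex.coe_algebraMap]
  split_ifs <;> ring

end RankOne

/-! ### The zero set near `(X, 0)` as a graph. -/

section LocalRoot

/-- Local parametrization `W = ω Z` of the zero set of `P` near a simple point `(X, 0)`, with
uniform control on the disc of radius `ε` around `X`. -/
structure LocalRoot (P : ℂ → ℂ → ℂ) (X β : ℝ) (ω : ℂ → ℂ) (ε c : ℝ) : Prop where
  contDiff : ContDiff ℂ ⊤ fun x : ℂ × ℂ => P x.1 x.2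
  X_ne : X ≠ 0
  β_ne : β ≠ 0
  ne_zero : ∀ Z : ℂ, ‖Z‖ = |X| → Z ≠ X → P Z 0 ≠ 0
  apply_self : P X 0 = 0
  deriv_fst_ne : deriv (fun Z => P Z 0) X ≠ 0
  ε_pos : 0 < ε
  c_pos : 0 < c
  root_iff : ∀ Z W : ℂ, ‖Z - X‖ < ε → ‖W‖ < ε → (P Z W = 0 ↔ ω Z = W)
  differentiableAt : ∀ Z : ℂ, ‖Z - X‖ < ε → DifferentiableAt ℂ ω Z
  lower : ∀ Z : ℂ, ‖Z - X‖ < ε → c * ‖Z - X‖ ≤ ‖ω Z‖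
  deriv_snd_ne : ∀ Z : ℂ, ‖Z - X‖ < ε → deriv (P Z) (ω Z) ≠ 0
  root_self : ω X = 0
  hasDerivAt : HasDerivAt ω (1 / (X * β)) X
  continuousAt_deriv : ContinuousAt (deriv ω) X
  differentiableAt_deriv_snd : DifferentiableAt ℂ (fun Z => deriv (P Z) (ω Z)) X

/-- The implicit function theorem applies since `∂₂P ≠ 0`. The definition of `β` is such that the
slope `-∂₁P / ∂₂P` of the graph is `1 / (X β)`; it is nonzero, whence the linear lower bound on
`|ω|`. -/
theorem exists_localRoot {P : ℂ → ℂ → ℂ} {X β : ℝ} {p₁ p₂ : ℂ}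
    (hP : ContDiff ℂ ⊤ fun x : ℂ × ℂ => P x.1 x.2) (hX : X ≠ 0)
    (hne : ∀ Z : ℂ, ‖Z‖ = |X| → Z ≠ X → P Z 0 ≠ 0) (h0 : P X 0 = 0)
    (h₁ : HasDerivAt (fun Z => P Z 0) p₁ X) (h₂ : HasDerivAt (P X) p₂ 0) (hp₁ : p₁ ≠ 0)
    (hp₂ : p₂ ≠ 0) (hβ : (β : ℂ) = -p₂ / (X * p₁)) :
    ∃ ω ε c, LocalRoot P X β ω ε c := by
  have hXc : (X : ℂ) ≠ 0 := Complex.ofReal_ne_zero.2 hX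
  have hβ0 : (β : ℂ) ≠ 0 := by
    rw [hβ]
    exact div_ne_zero (neg_ne_zero.2 hp₂) (mul_ne_zero hXc hp₁)
  set f : ℂ × ℂ → ℂ := fun x => P x.1 x.2 with hf
  set u : ℂ × ℂ := ((X : ℂ), 0) with hu
  have cdf : ContDiffAt ℂ ⊤ f u := hP.contDiffAt
  have hfd : HasFDerivAt f (fderiv ℂ f u) u := (hP.differentiable (by simp) u).hasFDerivAt
  have hsnd : ∀ Z W : ℂ, HasDerivAt (P Z) (fderiv ℂ f (Z, W) (0, 1)) W := by
    intro Z W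
    have h1 : HasFDerivAt f (fderiv ℂ f (Z, W)) (Z, W) :=
      (hP.differentiable (by simp) _).hasFDerivAt
    exact h1.comp_hasDerivAt (f := fun W => (Z, W)) W
      ((hasDerivAt_const W Z).prodMk (hasDerivAt_id W))
  have hf1 : fderiv ℂ f u (1, 0) = p₁ := by
    have h1 : HasDerivAt (fun Z => P Z 0) (fderiv ℂ f u (1, 0)) X :=
      hfd.comp_hasDerivAt (f := fun Z : ℂ => (Z, (0 : ℂ))) (X : ℂ)
        ((hasDerivAt_id (X : ℂ)).prodMk (hasDerivAt_const (X : ℂ) (0 : ℂ)))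
    exact h1.unique h₁
  have hf2 : fderiv ℂ f u (0, 1) = p₂ := (hsnd X 0).unique h₂
  have hinv : (fderiv ℂ f u ∘L ContinuousLinearMap.inr ℂ ℂ ℂ).IsInvertible := by
    refine ⟨ContinuousLinearEquiv.unitsEquivAut ℂ (Units.mk0 p₂ hp₂), ?_⟩
    ext
    simp [ContinuousLinearEquiv.unitsEquivAut, hf2]
  set ω := cdf.implicitFunction (by simp) hinv with hω
  have hωX : ω X = 0 := cdf.implicitFunction_apply_self (by simp) hinv
  have hcd : ContDiffAt ℂ ⊤ ω X := cdf.contDiffAt_implicitFunction (by simp) hinv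
  have hev : ∀ᶠ Z in 𝓝 (X : ℂ), f (Z, ω Z) = f u :=
    cdf.eventually_apply_implicitFunction (by simp) hinv
  have hiff : ∀ᶠ v in 𝓝 u, f v = f u ↔ ω v.1 = v.2 :=
    cdf.eventually_apply_eq_iff_implicitFunction (by simp) hinv
  have hfu : f u = 0 := h0
  have hder : HasDerivAt ω (1 / (X * β)) X := by
    have h1 : HasDerivAt ω (deriv ω X) X := (hcd.differentiableAt (by simp)).hasDerivAt
    have h2 : HasDerivAt (fun Z => f (Z, ω Z)) (fderiv ℂ f u (1, deriv ω X)) X := by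
      have h3 : HasFDerivAt f (fderiv ℂ f u) ((X : ℂ), ω X) := by rw [hωX]; exact hfd
      exact h3.comp_hasDerivAt (f := fun Z : ℂ => (Z, ω Z)) (X : ℂ)
        ((hasDerivAt_id (X : ℂ)).prodMk h1)
    have h4 : HasDerivAt (fun Z => f (Z, ω Z)) 0 X :=
      (hasDerivAt_const (X : ℂ) (f u)).congr_of_eventuallyEq hev
    have h5 := h2.unique h4
    have h6 : ((1 : ℂ), deriv ω X) = (1, 0) + deriv ω X • (0, 1) := by simp
    rw [h6, map_add, map_smul, hf1, hf2, smul_eq_mul] at h5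
    have h7 : deriv ω X = 1 / (X * β) := by
      rw [hβ]
      field_simp
      linear_combination h5
    rwa [h7] at h1
  have hd2 : (fun Z => deriv (P Z) (ω Z)) = fun Z => fderiv ℂ f (Z, ω Z) (0, 1) :=
    funext fun Z => (hsnd Z (ω Z)).deriv
  have hd2diff : DifferentiableAt ℂ (fun Z => deriv (P Z) (ω Z)) X := by
    rw [hd2]
    have h1 : ContDiff ℂ 1 (fderiv ℂ f) := hP.fderiv_right (m := 1) le_top
    have h2 : DifferentiableAt ℂ (fun Z : ℂ => fderiv ℂ f (Z, ω Z)) X :=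
      DifferentiableAt.comp (X : ℂ) (h1.differentiable (by simp) _)
        (differentiableAt_id.prodMk (hcd.differentiableAt (by simp)))
    exact h2.clm_apply (differentiableAt_const _)
  have hcd1 : ∀ᶠ Z in 𝓝 (X : ℂ), ContDiffAt ℂ 1 ω Z :=
    (hcd.of_le (m := 1) le_top).eventually (by simp)
  have hdiff : ∀ᶠ Z in 𝓝 (X : ℂ), DifferentiableAt ℂ ω Z :=
    hcd1.mono fun Z h => h.differentiableAt (by simp)
  have hdcont : ContinuousAt (deriv ω) X := by
    have h1 : ContDiffAt ℂ 0 (fderiv ℂ ω) X := hcd.fderiv_right (m := 0) le_top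
    have h2 : deriv ω = fun Z => fderiv ℂ ω Z 1 := funext fun Z => (fderiv_apply_one_eq_deriv).symm
    rw [h2]
    exact h1.continuousAt.clm_apply continuousAt_const
  have hωne : (1 / (X * β) : ℂ) ≠ 0 := one_div_ne_zero (mul_ne_zero hXc hβ0)
  obtain ⟨c, hc, hlow⟩ : ∃ c : ℝ, 0 < c ∧ ∀ᶠ Z : ℂ in 𝓝 (X : ℂ), c * ‖Z - (X : ℂ)‖ ≤ ‖ω Z‖ := by
    have h1 := hder.isLittleO
    simp only [hωX, sub_zero] at h1
    have hn := norm_pos_iff.2 hωne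
    -- Half the modulus of the slope: the other half pays for the error of the linear approximation.
    refine ⟨‖(1 / (X * β) : ℂ)‖ / 2, by positivity, ?_⟩
    filter_upwards [h1.def (half_pos hn)] with Z hZ
    have h2 := norm_sub_norm_le ((Z - X) • (1 / (X * β) : ℂ)) (ω Z)
    rw [norm_smul, norm_sub_rev (_ • _) (ω Z)] at h2
    linarith
  have hd2ne : ∀ᶠ Z in 𝓝 (X : ℂ), deriv (P Z) (ω Z) ≠ 0 := by
    refine hd2diff.continuousAt.eventually_ne ?_
    rw [hωX, h₂.deriv]
    exact hp₂
  obtain ⟨ε₁, hε₁, hball⟩ := Metric.eventually_nhds_iff.1 (hdiff.and (hlow.and hd2ne))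
  obtain ⟨ε₂, hε₂, hball₂⟩ := Metric.eventually_nhds_iff.1 hiff
  refine ⟨ω, min ε₁ ε₂, c, hP, hX, Complex.ofReal_ne_zero.1 hβ0, hne, h0, by rwa [h₁.deriv],
    lt_min hε₁ hε₂, hc, ?_, ?_, ?_, ?_, hωX, hder, hdcont, hd2diff⟩
  · intro Z W hZ hW
    have h1 := hball₂ (y := (Z, W)) (by
      rw [hu, Prod.dist_eq, dist_eq_norm, dist_eq_norm, sub_zero]
      exact max_lt (hZ.trans_le (min_le_right _ _)) (hW.trans_le (min_le_right _ _)))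
    rwa [hfu] at h1
  · exact fun Z hZ => (hball (by rw [dist_eq_norm]; exact hZ.trans_le (min_le_left _ _))).1
  · exact fun Z hZ => (hball (by rw [dist_eq_norm]; exact hZ.trans_le (min_le_left _ _))).2.1
  · exact fun Z hZ => (hball (by rw [dist_eq_norm]; exact hZ.trans_le (min_le_left _ _))).2.2

end LocalRoot

/-! ### Torus roots concentrate at `(X, 0)` and cross the circle transversally. -/

section Arc

/-- The modulus `|X| e ^ (γ β t)` of `Z` along the curve of parameter `γ`. -/
def fieldRadius (X β γ t : ℝ) : ℝ := |X| * Real.exp (γ * β * t)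

theorem continuous_fieldRadius (X β γ : ℝ) : Continuous (fieldRadius X β γ) := by
  unfold fieldRadius
  fun_prop

theorem fieldRadius_zero (X β γ : ℝ) : fieldRadius X β γ 0 = |X| := by simp [fieldRadius]

theorem fieldRadius_pos {X : ℝ} (hX : X ≠ 0) (β γ t : ℝ) : 0 < fieldRadius X β γ t :=
  mul_pos (abs_pos.2 hX) (Real.exp_pos _)

variable {P : ℂ → ℂ → ℂ} {X β : ℝ} {ω : ℂ → ℂ} {ε c γ : ℝ}

/-- Zeros of `P` with `|Z| = fieldRadius t`, `|W| ≤ t` concentrate at `(X, 0)`. -/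
theorem LocalRoot.eventually_zero_mem (h : LocalRoot P X β ω ε c) (γ : ℝ) {U : Set (ℂ × ℂ)}
    (hU : U ∈ 𝓝 ((X : ℂ), (0 : ℂ))) :
    ∀ᶠ t in 𝓝 (0 : ℝ), ∀ z w : ℂ, ‖z‖ = 1 → ‖w‖ ≤ 1 →
      P (fieldRadius X β γ t * z) (t * w) = 0 → ((fieldRadius X β γ t * z : ℂ), (t * w : ℂ)) ∈ U := by
  have hK : IsCompact (Metric.sphere (0 : ℂ) 1 ×ˢ Metric.closedBall (0 : ℂ) 1) :=
    (isCompact_sphere _ _).prod (isCompact_closedBall _ _)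
  have hρ := continuous_fieldRadius X β γ
  have hcont : Continuous fun q : ℝ × (ℂ × ℂ) =>
      ((fieldRadius X β γ q.1 * q.2.1 : ℂ), (q.1 * q.2.2 : ℂ)) := by fun_prop
  -- Compactness in `(z, w)`: at `t = 0` either the point is `(X, 0)`, and continuity puts nearby
  -- points in `U`, or `P ≠ 0` there, and this persists.
  have key := hK.eventually_forall_of_forall_eventually (x₀ := (0 : ℝ))
    (P := fun t y => P (fieldRadius X β γ t * y.1) (t * y.2) = 0 →
      ((fieldRadius X β γ t * y.1 : ℂ), (t * y.2 : ℂ)) ∈ U) (by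
    rintro ⟨z, w⟩ ⟨hz, hw⟩
    have hz1 : ‖z‖ = 1 := by simpa using hz
    have hval : ((fieldRadius X β γ 0 * z : ℂ), ((0 : ℝ) * w : ℂ)) = ((|X| : ℝ) * z, 0) := by
      simp [fieldRadius_zero]
    by_cases hX : ((|X| : ℝ) : ℂ) * z = X
    · have h1 := hcont.continuousAt (x := ((0 : ℝ), (z, w)))
      have h2 : U ∈ 𝓝 ((fieldRadius X β γ 0 * z : ℂ), ((0 : ℝ) * w : ℂ)) := by
        rw [hval, hX]; exact hU
      filter_upwards [h1.eventually h2] with q hq _ using hq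
    · have h1 : Continuous fun q : ℝ × (ℂ × ℂ) =>
          P (fieldRadius X β γ q.1 * q.2.1) (q.1 * q.2.2) := h.contDiff.continuous.comp hcont
      have h2 : P (fieldRadius X β γ 0 * z) ((0 : ℝ) * w) ≠ 0 := by
        have h3 := h.ne_zero (((|X| : ℝ) : ℂ) * z) (by simp [hz1]) hX
        simpa [fieldRadius_zero] using h3
      filter_upwards [h1.continuousAt.eventually_ne (x := ((0 : ℝ), (z, w))) h2] with q hq hq0
      exact absurd hq0 hq)
  filter_upwards [key] with t ht z w hz hw hP
  exact ht (z, w) ⟨by simpa using hz, by simpa using hw⟩ hP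

theorem LocalRoot.eventually_root (h : LocalRoot P X β ω ε c) (γ : ℝ) {V : Set ℂ}
    (hV : V ∈ 𝓝 (X : ℂ)) :
    ∀ᶠ t in 𝓝 (0 : ℝ), ∀ z w : ℂ, ‖z‖ = 1 → ‖w‖ ≤ 1 →
      P (fieldRadius X β γ t * z) (t * w) = 0 →
      (fieldRadius X β γ t * z : ℂ) ∈ V ∧ ‖(fieldRadius X β γ t * z : ℂ) - X‖ < ε ∧
        ω (fieldRadius X β γ t * z) = t * w := by
  have hU : (V ∩ Metric.ball (X : ℂ) ε) ×ˢ Metric.ball (0 : ℂ) ε ∈ 𝓝 ((X : ℂ), (0 : ℂ)) :=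
    prod_mem_nhds (inter_mem hV (Metric.ball_mem_nhds _ h.ε_pos)) (Metric.ball_mem_nhds _ h.ε_pos)
  filter_upwards [h.eventually_zero_mem γ hU] with t ht z w hz hw hP
  obtain ⟨⟨h1, h2⟩, h3⟩ := ht z w hz hw hP
  rw [mem_ball_iff_norm] at h2
  rw [mem_ball_zero_iff] at h3
  exact ⟨h1, h2, (h.root_iff _ _ h2 h3).1 hP⟩

/-- First order approximation of `ω` and of its logarithmic derivative. -/
theorem LocalRoot.eventually_approx (h : LocalRoot P X β ω ε c) {δ : ℝ} (hδ : 0 < δ) :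
    ∀ᶠ Z : ℂ in 𝓝 (X : ℂ), ‖ω Z - (Z / X - 1) / β‖ ≤ δ * ‖Z / X - 1‖ ∧
      ‖Z * deriv ω Z - 1 / β‖ ≤ δ := by
  have hX : (X : ℂ) ≠ 0 := Complex.ofReal_ne_zero.2 h.X_ne
  have hβ : (β : ℂ) ≠ 0 := Complex.ofReal_ne_zero.2 h.β_ne
  have hXn : 0 < ‖(X : ℂ)‖ := norm_pos_iff.2 hX
  have h1 := h.hasDerivAt.isLittleO.def (div_pos hδ hXn)
  have h2 : Tendsto (fun Z => Z * deriv ω Z - 1 / β) (𝓝 (X : ℂ)) (𝓝 0) := by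
    have h3 := ((continuousAt_id (x := (X : ℂ))).mul h.continuousAt_deriv).sub
      (continuousAt_const (y := (1 / β : ℂ)))
    have h4 : (X : ℂ) * deriv ω X - 1 / β = 0 := by
      rw [h.hasDerivAt.deriv]
      field_simp
      ring
    have h5 : Tendsto (fun Z => Z * deriv ω Z - 1 / β) (𝓝 (X : ℂ)) (𝓝 (X * deriv ω X - 1 / β)) := h3
    rwa [h4] at h5
  filter_upwards [h1, h2.eventually (Metric.ball_mem_nhds 0 hδ)] with Z hZ1 hZ2
  refine ⟨?_, by simpa using (mem_ball_zero_iff.1 hZ2).le⟩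
  rw [h.root_self, sub_zero, smul_eq_mul] at hZ1
  have h5 : (Z - X) * (1 / (X * β)) = (Z / X - 1) / β := by field_simp
  have h6 : ‖Z - X‖ = ‖(X : ℂ)‖ * ‖Z / X - 1‖ := by
    rw [← norm_mul]
    congr 1
    field_simp
  rw [h5, h6] at hZ1
  refine hZ1.trans (le_of_eq ?_)
  field_simp

/-- If `|1 + u| = e ^ x` with `|x| ≤ |γ| s`, `|u|` about `s` and `s` small, then `Im u` is not
small. -/
theorem im_lower_bound {γ s x δ : ℝ} {u : ℂ} (hδ : 0 < δ) (hδ1 : 4 * δ ≤ 1 - |γ|)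
    (hs0 : 0 < s) (hs : 4 * s ≤ δ) (hx : |x| ≤ |γ| * s) (hu : ‖1 + u‖ = Real.exp x)
    (hu1 : (1 - δ) * s ≤ ‖u‖) (hu2 : ‖u‖ ≤ 2 * s) : (1 - |γ|) / 2 * s ≤ |u.im| := by
  have hγ0 := abs_nonneg γ
  have hxs : |x| ≤ s := hx.trans (by linarith [mul_le_mul_of_nonneg_right (show |γ| ≤ 1 by linarith) hs0.le])
  -- The modulus of `1 + u` determines `Re u`, which is `x` up to order `s ^ 2`, so at most about
  -- `|γ| s`. As `|u|` is about `s`, the imaginary part has to supply the rest.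
  have h1 : 2 * u.re = Real.exp (2 * x) - 1 - ‖u‖ ^ 2 := by
    have h2 : ‖1 + u‖ ^ 2 = Real.exp (2 * x) := by rw [hu, ← Real.exp_nat_mul]; norm_num
    rw [Complex.sq_norm, Complex.normSq_apply] at h2 ⊢
    simp only [Complex.add_re, Complex.one_re, Complex.add_im, Complex.one_im, zero_add] at h2
    linarith
  have h3 : |Real.exp (2 * x) - 1 - 2 * x| ≤ (2 * x) ^ 2 :=
    Real.abs_exp_sub_one_sub_id_le (by rw [abs_mul, abs_two]; linarith)
  have hx2 : x ^ 2 ≤ s ^ 2 := sq_le_sq' (by linarith [neg_abs_le x]) ((le_abs_self x).trans hxs)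
  have hun : ‖u‖ ^ 2 ≤ 4 * s ^ 2 := by
    linarith [pow_le_pow_left₀ (norm_nonneg u) hu2 2, mul_pow 2 s 2]
  have h4 : |u.re| ≤ (|γ| + δ) * s := by
    rw [abs_le] at h3 hx ⊢
    have hss := mul_le_mul_of_nonneg_right hs hs0.le
    constructor <;> linarith [sq_nonneg ‖u‖]
  have h5 : ‖u‖ ^ 2 = u.re ^ 2 + u.im ^ 2 := by
    rw [Complex.sq_norm, Complex.normSq_apply]; ring
  have h6 : u.re ^ 2 ≤ ((|γ| + δ) * s) ^ 2 := by
    rw [← sq_abs]; exact pow_le_pow_left₀ (abs_nonneg _) h4 2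
  have h7 : ((1 - δ) * s) ^ 2 ≤ ‖u‖ ^ 2 :=
    pow_le_pow_left₀ (mul_nonneg (by linarith) hs0.le) hu1 2
  have h8 : ((1 - |γ|) / 2 * s) ^ 2 ≤ |u.im| ^ 2 := by
    rw [sq_abs]
    -- The right side is `(1 + |γ|) (1 - |γ| - 2 δ)`, and `2 δ` is at most half of `1 - |γ|`.
    have h9 : ((1 - |γ|) / 2) ^ 2 ≤ (1 - δ) ^ 2 - (|γ| + δ) ^ 2 := by nlinarith
    have h10 := mul_le_mul_of_nonneg_right h9 (sq_nonneg s)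
    nlinarith
  exact (abs_le_of_sq_le_sq' h8 (abs_nonneg _)).2

/-- Transversality of the level set `|ω| = t` on the circle. -/
theorem LocalRoot.eventually_transversal (h : LocalRoot P X β ω ε c)
    (hγ : γ ∈ Set.Ioo (-1 : ℝ) 1) :
    ∃ V ∈ 𝓝 (X : ℂ), ∀ᶠ t in 𝓝[>] (0 : ℝ), ∀ Z ∈ V, ‖Z‖ = fieldRadius X β γ t → ‖ω Z‖ = t →
      inner ℝ (ω Z) (Complex.I * Z * deriv ω Z) ≠ 0 := by
  have hX : (X : ℂ) ≠ 0 := Complex.ofReal_ne_zero.2 h.X_ne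
  have hγ1 : |γ| < 1 := abs_lt.2 hγ
  have hβ := abs_pos.2 h.β_ne
  set δ : ℝ := (1 - |γ|) / 4 with hδ
  have hδ0 : 0 < δ := by rw [hδ]; linarith
  have hδ4 : δ ≤ 1 / 4 := by rw [hδ]; linarith [abs_nonneg γ]
  -- The tolerance on `ω` and `Z ω'`: the second bound pins `|u|` between `(1 - δ) s` and `2 s`, the
  -- third keeps the error in the inner product, times `β ^ 2`, below `δ s`, against a main term of
  -- at least `2 δ s`.
  set D : ℝ := min 1 (min (δ / (2 * |β|)) (δ / (β ^ 2 * (2 / |β| + 1) * 2))) with hD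
  have hβ2 : 0 < β ^ 2 := by rw [← sq_abs]; positivity
  have hD0 : 0 < D := by
    rw [hD]
    refine lt_min one_pos (lt_min (by positivity) (by positivity))
  have hD1 : D ≤ 1 := min_le_left _ _
  have hD2 : D * |β| ≤ δ / 2 := by
    have : D ≤ δ / (2 * |β|) := (min_le_right _ _).trans (min_le_left _ _)
    rw [le_div_iff₀ (by positivity)] at this
    linarith
  have hD3 : D * (β ^ 2 * (2 / |β| + 1) * 2) ≤ δ := by
    have : D ≤ δ / (β ^ 2 * (2 / |β| + 1) * 2) := (min_le_right _ _).trans (min_le_right _ _)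
    rwa [le_div_iff₀ (by positivity)] at this
  refine ⟨_, h.eventually_approx hD0, ?_⟩
  have hsmall : ∀ᶠ t in 𝓝[>] (0 : ℝ), t < δ / (4 * |β|) :=
    (eventually_lt_nhds (by positivity)).filter_mono nhdsWithin_le_nhds
  filter_upwards [hsmall, self_mem_nhdsWithin] with t ht ht0 Z hZ hZn hωt
  have ht0 : 0 < t := ht0
  obtain ⟨h1, h2⟩ := hZ
  rw [lt_div_iff₀ (by positivity)] at ht
  set u : ℂ := Z / X - 1 with hu
  set s : ℝ := |β| * t with hs
  have hs0 : 0 < s := by positivity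
  have hud : ‖u / β‖ = ‖u‖ / |β| := by rw [norm_div, Complex.norm_real, Real.norm_eq_abs]
  have hup : ‖u‖ / |β| ≤ t + D * ‖u‖ := by
    have := norm_sub_norm_le (u / β : ℂ) (ω Z)
    rw [norm_sub_rev, hud, hωt] at this
    linarith
  have hlo : t ≤ ‖u‖ / |β| + D * ‖u‖ := by
    have := norm_sub_norm_le (ω Z) (u / β : ℂ)
    rw [hud, hωt] at this
    linarith
  have hun := norm_nonneg u
  have hup' : ‖u‖ ≤ s + (D * |β|) * ‖u‖ := by
    rw [div_le_iff₀ hβ] at hup; rw [hs]; linarith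
  have hlo' : s ≤ ‖u‖ + (D * |β|) * ‖u‖ := by
    have := mul_le_mul_of_nonneg_right hlo hβ.le
    rw [add_mul, div_mul_cancel₀ _ hβ.ne'] at this
    rw [hs]; linarith
  have hDu := mul_le_mul_of_nonneg_right hD2 hun
  have hδu := mul_le_mul_of_nonneg_right hδ4 hun
  have hu2 : ‖u‖ ≤ 2 * s := by linarith
  have hu1 : (1 - δ) * s ≤ ‖u‖ := by linarith [mul_le_mul_of_nonneg_left hu2 hδ0.le]
  have hnorm : ‖1 + u‖ = Real.exp (γ * β * t) := by
    rw [hu, add_sub_cancel, norm_div, hZn, fieldRadius, Complex.norm_real, Real.norm_eq_abs]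
    field_simp [(abs_pos.2 h.X_ne).ne']
  have him := im_lower_bound (γ := γ) (s := s) (x := γ * β * t) (δ := δ) hδ0 (by rw [hδ]; linarith)
    hs0 (by rw [hs]; linarith) (by rw [abs_mul, abs_mul, abs_of_pos ht0, hs, mul_assoc]) hnorm hu1 hu2
  intro h0
  rw [Complex.inner] at h0
  -- Main term: replacing `ω` by `u / β` and `Z ω'` by `1 / β` gives `Im u / β ^ 2`.
  have hmain : ((starRingEnd ℂ) (u / β) * (Complex.I * (1 / β))).re = u.im / β ^ 2 := by
    have : (starRingEnd ℂ) (u / β) * (Complex.I * (1 / β)) =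
        (starRingEnd ℂ) u * Complex.I * (((1 / β ^ 2 : ℝ)) : ℂ) := by
      rw [map_div₀, Complex.conj_ofReal]
      push_cast
      ring
    rw [this, Complex.re_mul_ofReal]
    simp
    ring
  have hdiff : (starRingEnd ℂ) (u / β) * (Complex.I * (1 / β)) -
      (Complex.I * Z * deriv ω Z) * (starRingEnd ℂ) (ω Z) =
      -((starRingEnd ℂ) (ω Z - u / β) * (Complex.I * (Z * deriv ω Z))) -
        (starRingEnd ℂ) (u / β) * (Complex.I * (Z * deriv ω Z - 1 / β)) := by
    rw [map_sub]
    ring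
  have hZd : ‖Z * deriv ω Z‖ ≤ 1 / |β| + D := by
    have h3 := norm_add_le (1 / β : ℂ) (Z * deriv ω Z - 1 / β)
    rw [add_sub_cancel, norm_div, norm_one, Complex.norm_real, Real.norm_eq_abs] at h3
    linarith
  have hbound : |u.im / β ^ 2| ≤ ‖u‖ * D * (2 / |β| + 1) := by
    have h3 : u.im / β ^ 2 = ((starRingEnd ℂ) (u / β) * (Complex.I * (1 / β)) -
      (Complex.I * Z * deriv ω Z) * (starRingEnd ℂ) (ω Z)).re := by
      rw [Complex.sub_re, hmain, h0, sub_zero]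
    rw [h3, hdiff]
    refine (Complex.abs_re_le_norm _).trans ((norm_sub_le _ _).trans ?_)
    have hn : ∀ a b : ℂ, ‖(starRingEnd ℂ) a * (Complex.I * b)‖ = ‖a‖ * ‖b‖ := fun a b => by simp
    rw [norm_neg, hn, hn, hud]
    have h4 : ‖ω Z - u / β‖ * ‖Z * deriv ω Z‖ ≤ (D * ‖u‖) * (1 / |β| + 1) :=
      mul_le_mul h1 (hZd.trans (by linarith)) (norm_nonneg _) (by positivity)
    have h5 : ‖u‖ / |β| * ‖Z * deriv ω Z - 1 / β‖ ≤ ‖u‖ / |β| * D :=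
      mul_le_mul_of_nonneg_left h2 (by positivity)
    have h6 : ‖u‖ * D * (2 / |β| + 1) = (D * ‖u‖) * (1 / |β| + 1) + ‖u‖ / |β| * D := by ring
    linarith
  rw [abs_div, abs_of_pos hβ2, div_le_iff₀ hβ2] at hbound
  have h7 : ‖u‖ * D * (2 / |β| + 1) * β ^ 2 ≤ s * δ := by
    have h8 : ‖u‖ * D * (2 / |β| + 1) * β ^ 2 = ‖u‖ / 2 * (D * (β ^ 2 * (2 / |β| + 1) * 2)) := by
      ring
    rw [h8]
    exact mul_le_mul (by linarith) hD3 (by positivity) hs0.le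
  have h9 : (1 - |γ|) / 2 = 2 * δ := by rw [hδ]; ring
  rw [h9] at him
  linarith [mul_pos hδ0 hs0]

end Arc

/-! ### The root arc: exceptional angles, existence of roots, length. -/

section ArcMeasure

variable {P : ℂ → ℂ → ℂ} {X β : ℝ} {ω : ℂ → ℂ} {ε c γ : ℝ}

/-- At such an angle `|ω| = t`, and by transversality `|ω| ^ 2` has nonzero derivative in the angle.
The angles are therefore isolated, and a discrete subset of the line is countable. -/
theorem LocalRoot.eventually_countable_level (h : LocalRoot P X β ω ε c)
    (hγ : γ ∈ Set.Ioo (-1 : ℝ) 1) :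
    ∀ᶠ t in 𝓝[>] (0 : ℝ), {θ : ℝ | ∃ w : ℂ, ‖w‖ = 1 ∧
      P (fieldRadius X β γ t * circleMap 0 1 θ) (t * w) = 0}.Countable := by
  obtain ⟨V, hV, hev⟩ := h.eventually_transversal hγ
  filter_upwards [hev, (h.eventually_root γ hV).filter_mono nhdsWithin_le_nhds,
    self_mem_nhdsWithin] with t ht hroot ht0
  have ht0 : 0 < t := ht0
  set ρ := fieldRadius X β γ t with hρ
  have hρ0 : 0 < ρ := fieldRadius_pos h.X_ne β γ t
  set B := {θ : ℝ | ∃ w : ℂ, ‖w‖ = 1 ∧ P (ρ * circleMap 0 1 θ) (t * w) = 0} with hB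
  have hlevel : ∀ θ ∈ B, (ρ * circleMap 0 1 θ : ℂ) ∈ V ∧ ‖(ρ * circleMap 0 1 θ : ℂ) - X‖ < ε ∧
      ‖ω (ρ * circleMap 0 1 θ)‖ = t := by
    rintro θ ⟨w, hw, hP⟩
    obtain ⟨h1, h2, h3⟩ := hroot (circleMap 0 1 θ) w (by simp) hw.le hP
    refine ⟨h1, h2, ?_⟩
    rw [h3, norm_mul, hw, mul_one, Complex.norm_real, Real.norm_eq_abs, abs_of_pos ht0]
  have hdisc : DiscreteTopology B := by
    rw [discreteTopology_subtype_iff]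
    intro θ hθ
    obtain ⟨h1, h2, h3⟩ := hlevel θ hθ
    have hc : HasDerivAt (fun θ : ℝ => (ρ * circleMap 0 1 θ : ℂ))
        (ρ * (circleMap 0 1 θ * Complex.I)) θ := (hasDerivAt_circleMap 0 1 θ).const_mul _
    have hd : HasDerivAt (fun θ : ℝ => ω (ρ * circleMap 0 1 θ))
        (Complex.I * (ρ * circleMap 0 1 θ) * deriv ω (ρ * circleMap 0 1 θ)) θ := by
      refine (((h.differentiableAt _ h2).hasDerivAt).scomp θ hc).congr_deriv ?_
      rw [smul_eq_mul]
      ring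
    have hne := hd.norm_sq.eventually_ne (c := t ^ 2) (mul_ne_zero two_ne_zero
      (ht _ h1 (by simp [abs_of_pos hρ0]) h3))
    rw [← disjoint_iff, disjoint_principal_right]
    filter_upwards [hne] with θ' hθ' hmem
    exact hθ' (by simp [(hlevel θ' hmem).2.2])
  have hc : Countable B := countable_of_Lindelof_of_discrete
  exact hc

theorem LocalRoot.eventually_countable_zero (h : LocalRoot P X β ω ε c) (γ : ℝ) :
    ∀ᶠ t in 𝓝 (0 : ℝ), {θ : ℝ | P (fieldRadius X β γ t * circleMap 0 1 θ) 0 = 0}.Countable := by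
  filter_upwards [h.eventually_root γ univ_mem] with t hroot
  have hρ0 : 0 < fieldRadius X β γ t := fieldRadius_pos h.X_ne β γ t
  refine ((Set.countable_singleton ((X : ℂ) / fieldRadius X β γ t)).preimage_circleMap 0
    one_ne_zero).mono fun θ hθ => ?_
  have hθ : P (fieldRadius X β γ t * circleMap 0 1 θ) 0 = 0 := hθ
  obtain ⟨-, h1, h2⟩ := hroot (circleMap 0 1 θ) 0 (by simp) (by simp) (by rwa [mul_zero])
  have h3 := h.lower _ h1
  rw [h2, mul_zero, norm_zero] at h3
  have h4 : ‖(fieldRadius X β γ t * circleMap 0 1 θ : ℂ) - X‖ = 0 :=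
    le_antisymm (nonpos_of_mul_nonpos_right h3 h.c_pos) (norm_nonneg _)
  rw [norm_eq_zero, sub_eq_zero] at h4
  have hρc : (fieldRadius X β γ t : ℂ) ≠ 0 := Complex.ofReal_ne_zero.2 hρ0.ne'
  show circleMap 0 1 θ = _
  rw [eq_div_iff hρc, mul_comm, h4]

/-- Angles of the points of the circle of radius `ρ` where the small root has modulus less than
`t`. -/
def rootArc (ω : ℂ → ℂ) (X ε ρ t : ℝ) : Set ℝ :=
  {θ | ‖(ρ * circleMap 0 1 θ : ℂ) - X‖ < ε ∧ ‖ω (ρ * circleMap 0 1 θ)‖ < t}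

theorem LocalRoot.isOpen_rootArc (h : LocalRoot P X β ω ε c) (ρ t : ℝ) :
    IsOpen (rootArc ω X ε ρ t) := by
  have h1 : ContinuousOn (fun Z => ‖ω Z‖) (Metric.ball (X : ℂ) ε) := fun Z hZ =>
    (h.differentiableAt Z (mem_ball_iff_norm.1 hZ)).continuousAt.norm.continuousWithinAt
  have h2 := h1.isOpen_inter_preimage Metric.isOpen_ball (isOpen_Iio (a := t))
  have h3 : Continuous fun θ : ℝ => (ρ * circleMap 0 1 θ : ℂ) :=
    continuous_const.mul (continuous_circleMap 0 1)
  have h4 := h2.preimage h3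
  convert h4 using 1
  ext θ
  simp [rootArc, dist_eq_norm]

/-- The argument of the real number `X`. -/
def realArg (X : ℝ) : ℝ := if 0 < X then 0 else Real.pi

theorem abs_mul_circleMap_realArg (X φ : ℝ) :
    ((|X| : ℝ) : ℂ) * circleMap 0 1 (realArg X + φ) = X * Complex.exp (φ * Complex.I) := by
  unfold realArg
  split_ifs with hX
  · rw [abs_of_pos hX]
    simp [circleMap]
  · rw [abs_of_nonpos (not_lt.1 hX)]
    simp [circleMap, add_mul, Complex.exp_add]

theorem fieldRadius_mul_circleMap (X β γ t φ : ℝ) :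
    (fieldRadius X β γ t : ℂ) * circleMap 0 1 (realArg X + φ) =
      X * Complex.exp (γ * β * t + φ * Complex.I) := by
  rw [fieldRadius, Complex.ofReal_mul, mul_right_comm, abs_mul_circleMap_realArg, Complex.exp_add]
  push_cast
  ring

/-- On the real axis the root is inside the disc of radius `t`. -/
theorem LocalRoot.eventually_realArg_mem (h : LocalRoot P X β ω ε c)
    (hγ : γ ∈ Set.Ioo (-1 : ℝ) 1) :
    ∀ᶠ t in 𝓝[>] (0 : ℝ), realArg X ∈ rootArc ω X ε (fieldRadius X β γ t) t := by
  have hXc : (X : ℂ) ≠ 0 := Complex.ofReal_ne_zero.2 h.X_ne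
  have hβc : (β : ℂ) ≠ 0 := Complex.ofReal_ne_zero.2 h.β_ne
  have hγ1 : |γ| < 1 := abs_lt.2 hγ
  set g : ℝ → ℂ := fun t => X * Complex.exp (γ * β * t) with hg
  have hgd : HasDerivAt g (X * (γ * β)) 0 := by
    have h1 : HasDerivAt (fun t : ℝ => (γ * β * t : ℂ)) (γ * β * 1) 0 :=
      (Complex.ofRealCLM.hasDerivAt (x := (0 : ℝ))).const_mul _
    have h2 := (h1.cexp).const_mul (X : ℂ)
    simpa using h2
  have hg0 : g 0 = X := by simp [hg]
  -- Along the real direction `ω` grows like `γ t`, and `|γ| < 1` keeps it inside the disc of radius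
  -- `t`.
  have hωg : HasDerivAt (fun t => ω (g t)) (γ : ℂ) 0 := by
    have h1 : HasDerivAt ω (1 / (X * β)) (g 0) := by rw [hg0]; exact h.hasDerivAt
    refine (h1.scomp (0 : ℝ) hgd).congr_deriv ?_
    rw [smul_eq_mul]
    field_simp
  have hlo := hωg.isLittleO.def (show 0 < (1 - |γ|) / 2 by linarith)
  have hnear : ∀ᶠ t in 𝓝 (0 : ℝ), ‖g t - X‖ < ε := by
    have h1 : Tendsto g (𝓝 0) (𝓝 (X : ℂ)) := by
      have := hgd.continuousAt.tendsto
      rwa [hg0] at this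
    filter_upwards [h1.eventually (Metric.ball_mem_nhds _ h.ε_pos)] with t ht
      using mem_ball_iff_norm.1 ht
  filter_upwards [hlo.filter_mono nhdsWithin_le_nhds, hnear.filter_mono nhdsWithin_le_nhds,
    self_mem_nhdsWithin] with t h1 h2 ht
  have ht : 0 < t := ht
  have hZ : (fieldRadius X β γ t : ℂ) * circleMap 0 1 (realArg X) = g t := by
    have := fieldRadius_mul_circleMap X β γ t 0
    simpa [hg] using this
  rw [rootArc, Set.mem_ofPred_eq, hZ]
  refine ⟨h2, ?_⟩
  simp only [sub_zero, hg0, h.root_self, Real.norm_eq_abs, abs_of_pos ht] at h1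
  have h3 := norm_sub_norm_le (ω (g t)) (t • (γ : ℂ))
  rw [norm_smul, Complex.norm_real, Real.norm_eq_abs, Real.norm_eq_abs, abs_of_pos ht] at h3
  nlinarith

theorem exists_arc_near (X β γ : ℝ) {ε : ℝ} (hε : 0 < ε) :
    ∃ δ : ℝ, 0 < δ ∧ δ ≤ 1 ∧ ∀ t φ : ℝ, |t| < δ → φ ∈ Set.Icc 0 δ →
      ‖(fieldRadius X β γ t : ℂ) * circleMap 0 1 (realArg X + φ) - X‖ < ε := by
  have h1 : Continuous fun q : ℝ × ℝ =>
      (fieldRadius X β γ q.1 : ℂ) * circleMap 0 1 (realArg X + q.2) - X := by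
    have := continuous_fieldRadius X β γ
    fun_prop
  have h2 : ‖(fieldRadius X β γ (0 : ℝ × ℝ).1 : ℂ) *
      circleMap 0 1 (realArg X + (0 : ℝ × ℝ).2) - X‖ < ε := by
    rw [fieldRadius_mul_circleMap]
    simpa using hε
  obtain ⟨δ, hδ, hball⟩ := Metric.eventually_nhds_iff.1
    (h1.norm.continuousAt.eventually (gt_mem_nhds h2))
  refine ⟨min (δ / 2) 1, by positivity, min_le_right _ _, fun t φ ht hφ => hball (y := (t, φ)) ?_⟩
  have h4 : min (δ / 2) 1 < δ := (min_le_left _ _).trans_lt (by linarith)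
  rw [Prod.dist_eq]
  refine max_lt ?_ ?_
  · rw [Real.dist_eq, Prod.fst_zero, sub_zero]
    exact ht.trans h4
  · rw [Real.dist_eq, Prod.snd_zero, sub_zero, abs_of_nonneg hφ.1]
    exact hφ.2.trans_lt h4

/-- Intermediate values of `|ω|` along an arc of fixed small angle `δ`: it is below `t` on the real
axis, and at the far end it is bounded below by `c |Z - X|`, which does not shrink with `t`. -/
theorem LocalRoot.exists_torus_root (h : LocalRoot P X β ω ε c)
    (hγ : γ ∈ Set.Ioo (-1 : ℝ) 1) :
    ∀ᶠ t in 𝓝[>] (0 : ℝ), ∃ z w : ℂ, ‖z‖ = 1 ∧ ‖w‖ = 1 ∧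
      P (fieldRadius X β γ t * z) (t * w) = 0 := by
  have hXc : (X : ℂ) ≠ 0 := Complex.ofReal_ne_zero.2 h.X_ne
  obtain ⟨δ, hδ0, hδ, hδε⟩ := exists_arc_near X β γ h.ε_pos
  set Y : ℝ → ℂ := fun t => (fieldRadius X β γ t : ℂ) * circleMap 0 1 (realArg X + δ) with hY
  have hYX : Y 0 ≠ X := by
    rw [hY]
    simp only
    rw [fieldRadius_mul_circleMap]
    intro h0
    have h1 : Complex.exp (δ * Complex.I) = 1 := by
      have : (X : ℂ) * Complex.exp (δ * Complex.I) = X * 1 := by simpa using h0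
      exact mul_left_cancel₀ hXc this
    have h2 := congrArg Complex.im h1
    rw [Complex.exp_ofReal_mul_I_im, Complex.one_im] at h2
    exact (Real.sin_pos_of_pos_of_lt_pi hδ0 (by linarith [Real.pi_gt_three])).ne' h2
  have hYcont : ContinuousAt Y 0 := by
    have h1 := continuous_fieldRadius X β γ
    have : Continuous Y := by fun_prop
    exact this.continuousAt
  have hbig : ∀ᶠ t in 𝓝 (0 : ℝ), t < c * ‖Y t - X‖ := by
    have h1 : Tendsto (fun t => c * ‖Y t - X‖ - t) (𝓝 0) (𝓝 (c * ‖Y 0 - X‖ - 0)) :=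
      ((hYcont.sub continuousAt_const).norm.tendsto.const_mul c).sub tendsto_id
    have h2 : 0 < c * ‖Y 0 - X‖ - 0 := by
      rw [sub_zero]
      exact mul_pos h.c_pos (norm_pos_iff.2 (sub_ne_zero.2 hYX))
    filter_upwards [h1.eventually (lt_mem_nhds h2)] with t ht
    linarith
  filter_upwards [h.eventually_realArg_mem hγ, hbig.filter_mono nhdsWithin_le_nhds,
    self_mem_nhdsWithin, (gt_mem_nhds hδ0 : ∀ᶠ t in 𝓝 (0 : ℝ), t < δ).filter_mono
      nhdsWithin_le_nhds, (gt_mem_nhds h.ε_pos : ∀ᶠ t in 𝓝 (0 : ℝ), t < ε).filter_mono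
      nhdsWithin_le_nhds] with t ht1 ht2 ht0 htδ htε
  have ht0 : 0 < t := ht0
  set ρ := fieldRadius X β γ t with hρ
  have hin : ∀ φ ∈ Set.Icc 0 δ, ‖(ρ : ℂ) * circleMap 0 1 (realArg X + φ) - X‖ < ε :=
    fun φ hφ => hδε t φ (by rwa [abs_of_pos ht0]) hφ
  have hcont : ContinuousOn (fun φ : ℝ => ‖ω ((ρ : ℂ) * circleMap 0 1 (realArg X + φ))‖)
      (Set.Icc 0 δ) := by
    intro φ hφ
    have h1 : Continuous fun φ : ℝ => (ρ : ℂ) * circleMap 0 1 (realArg X + φ) := by fun_prop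
    exact (ContinuousAt.comp (f := fun φ : ℝ => (ρ : ℂ) * circleMap 0 1 (realArg X + φ)) (x := φ)
      (h.differentiableAt _ (hin φ hφ)).continuousAt h1.continuousAt).norm.continuousWithinAt
  have hivt := intermediate_value_Icc hδ0.le hcont
  have hlast : t ≤ ‖ω ((ρ : ℂ) * circleMap 0 1 (realArg X + δ))‖ :=
    ht2.le.trans (h.lower _ (hin δ ⟨hδ0.le, le_rfl⟩))
  obtain ⟨φ, hφ, hval⟩ := hivt ⟨by simpa using ht1.2.le, hlast⟩
  have hval : ‖ω ((ρ : ℂ) * circleMap 0 1 (realArg X + φ))‖ = t := hval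
  have htc : (t : ℂ) ≠ 0 := Complex.ofReal_ne_zero.2 ht0.ne'
  refine ⟨circleMap 0 1 (realArg X + φ), ω ((ρ : ℂ) * circleMap 0 1 (realArg X + φ)) / t,
    by simp, ?_, ?_⟩
  · rw [norm_div, hval, Complex.norm_real, Real.norm_eq_abs, abs_of_pos ht0, div_self ht0.ne']
  · rw [mul_div_cancel₀ _ htc]
    exact (h.root_iff _ _ (hin φ hφ) (by rw [hval]; exact htε)).2 rfl

/-- Normalized measure of the root arc. -/
def arcMass (ω : ℂ → ℂ) (X ε ρ t : ℝ) : ℝ :=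
  (2 * Real.pi)⁻¹ * volume.real (rootArc ω X ε ρ t ∩ Set.Ioc 0 (2 * Real.pi))

theorem LocalRoot.eventually_arcMass_pos (h : LocalRoot P X β ω ε c)
    (hγ : γ ∈ Set.Ioo (-1 : ℝ) 1) :
    ∀ᶠ t in 𝓝[>] (0 : ℝ), 0 < arcMass ω X ε (fieldRadius X β γ t) t := by
  filter_upwards [h.eventually_realArg_mem hγ] with t ht
  have hopen := h.isOpen_rootArc (fieldRadius X β γ t) t
  have hcl : realArg X ∈ closure (Set.Ioo 0 (2 * Real.pi)) := by
    rw [closure_Ioo (by positivity)]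
    unfold realArg
    split_ifs
    · exact ⟨le_rfl, by positivity⟩
    · exact ⟨Real.pi_pos.le, by linarith [Real.pi_pos]⟩
  have hne := mem_closure_iff.1 hcl _ hopen ht
  have hpos : 0 < volume (rootArc ω X ε (fieldRadius X β γ t) t ∩ Set.Ioo 0 (2 * Real.pi)) :=
    (hopen.inter isOpen_Ioo).measure_pos volume hne
  have hpos2 : 0 < volume (rootArc ω X ε (fieldRadius X β γ t) t ∩ Set.Ioc 0 (2 * Real.pi)) :=
    hpos.trans_le (measure_mono (Set.inter_subset_inter_right _ Set.Ioo_subset_Ioc_self))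
  have hfin : volume (rootArc ω X ε (fieldRadius X β γ t) t ∩ Set.Ioc 0 (2 * Real.pi)) ≠ ⊤ :=
    (measure_mono Set.inter_subset_right).trans_lt measure_Ioc_lt_top |>.ne
  exact mul_pos (by positivity) (ENNReal.toReal_pos hpos2.ne' hfin)

/-- Jordan's inequality on each quarter turn, reflected to the first quadrant. -/
theorem mem_of_abs_sin_le {θ s : ℝ} (h0 : 0 ≤ θ) (h1 : θ ≤ 2 * Real.pi) (hs : |Real.sin θ| ≤ s) :
    θ ∈ (Set.Icc 0 (Real.pi / 2 * s) ∪
      Set.Icc (Real.pi - Real.pi / 2 * s) (Real.pi + Real.pi / 2 * s)) ∪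
      Set.Icc (2 * Real.pi - Real.pi / 2 * s) (2 * Real.pi) := by
  have hpi := Real.pi_pos
  have key : ∀ x : ℝ, 0 ≤ x → x ≤ Real.pi / 2 → Real.sin x ≤ s → x ≤ Real.pi / 2 * s := by
    intro x hx0 hx1 hxs
    have h2 := (Real.mul_le_sin hx0 hx1).trans hxs
    have h3 := mul_le_mul_of_nonneg_left h2 (show 0 ≤ Real.pi / 2 by positivity)
    have h4 : Real.pi / 2 * (2 / Real.pi * x) = x := by field_simp
    linarith
  have hle := le_abs_self (Real.sin θ)
  have hneg := neg_le_abs (Real.sin θ)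
  rcases le_total θ (Real.pi / 2) with h2 | h2
  · exact Or.inl (Or.inl ⟨h0, key θ h0 h2 (hle.trans hs)⟩)
  rcases le_total θ Real.pi with h3 | h3
  · have := key (Real.pi - θ) (by linarith) (by linarith) (by rw [Real.sin_pi_sub]; linarith)
    exact Or.inl (Or.inr ⟨by linarith, by linarith⟩)
  rcases le_total θ (3 * Real.pi / 2) with h4 | h4
  · have := key (θ - Real.pi) (by linarith) (by linarith) (by rw [Real.sin_sub_pi]; linarith)
    exact Or.inl (Or.inr ⟨by linarith, by linarith⟩)
  · have := key (2 * Real.pi - θ) (by linarith) (by linarith)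
      (by rw [Real.sin_two_pi_sub]; linarith)
    exact Or.inr ⟨by linarith, h1⟩

theorem LocalRoot.arcMass_isBigO (h : LocalRoot P X β ω ε c) (γ : ℝ) :
    (fun t => arcMass ω X ε (fieldRadius X β γ t) t) =O[𝓝[>] 0] fun t : ℝ => t := by
  have hX := abs_pos.2 h.X_ne
  have hρ : ∀ᶠ t in 𝓝 (0 : ℝ), |X| / 2 < fieldRadius X β γ t := by
    have h1 := (continuous_fieldRadius X β γ).tendsto 0
    rw [fieldRadius_zero] at h1
    exact h1.eventually (lt_mem_nhds (by linarith))
  have hc := h.c_pos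
  refine IsBigO.of_bound (2 / (c * |X|)) ?_
  filter_upwards [hρ.filter_mono nhdsWithin_le_nhds, self_mem_nhdsWithin] with t ht ht0
  have ht0 : 0 < t := ht0
  set ρ := fieldRadius X β γ t
  have hρ0 : 0 < ρ := by linarith
  set s : ℝ := 2 * t / (c * |X|) with hs
  have hs0 : 0 ≤ s := by positivity
  have hpi := Real.pi_pos
  have hsub : rootArc ω X ε ρ t ∩ Set.Ioc 0 (2 * Real.pi) ⊆
      (Set.Icc 0 (Real.pi / 2 * s) ∪
      Set.Icc (Real.pi - Real.pi / 2 * s) (Real.pi + Real.pi / 2 * s)) ∪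
      Set.Icc (2 * Real.pi - Real.pi / 2 * s) (2 * Real.pi) := by
    rintro θ ⟨⟨h1, h2⟩, h3⟩
    refine mem_of_abs_sin_le h3.1.le h3.2 ?_
    have h4 := h.lower _ h1
    -- `X` is real, so the imaginary part bounds the distance to `X` from below whatever the sign of
    -- `X`.
    have h5 : ρ * |Real.sin θ| ≤ ‖(ρ * circleMap 0 1 θ : ℂ) - X‖ := by
      have h6 := Complex.abs_im_le_norm ((ρ * circleMap 0 1 θ : ℂ) - X)
      have h7 : ((ρ * circleMap 0 1 θ : ℂ) - X).im = ρ * Real.sin θ := by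
        simp [circleMap, Complex.exp_ofReal_mul_I_im]
      rwa [h7, abs_mul, abs_of_pos hρ0] at h6
    have h8 : c * (ρ * |Real.sin θ|) < t :=
      (mul_le_mul_of_nonneg_left h5 hc.le).trans_lt (h4.trans_lt h2)
    rw [hs, le_div_iff₀ (by positivity)]
    have h9 : |Real.sin θ| * (c * (|X| / 2)) ≤ |Real.sin θ| * (c * ρ) :=
      mul_le_mul_of_nonneg_left (mul_le_mul_of_nonneg_left ht.le hc.le) (abs_nonneg _)
    linarith
  have hvol : volume.real (rootArc ω X ε ρ t ∩ Set.Ioc 0 (2 * Real.pi)) ≤ 2 * Real.pi * s := by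
    have hfin : volume ((Set.Icc 0 (Real.pi / 2 * s) ∪
      Set.Icc (Real.pi - Real.pi / 2 * s) (Real.pi + Real.pi / 2 * s)) ∪
      Set.Icc (2 * Real.pi - Real.pi / 2 * s) (2 * Real.pi)) ≠ ⊤ :=
      ((isCompact_Icc.union isCompact_Icc).union isCompact_Icc).measure_lt_top.ne
    refine (measureReal_mono hsub hfin).trans ((measureReal_union_le _ _).trans ?_)
    refine (add_le_add_left (measureReal_union_le _ _) _).trans ?_
    have hps : 0 ≤ Real.pi / 2 * s := by positivity
    rw [Real.volume_real_Icc_of_le hps, Real.volume_real_Icc_of_le (by linarith),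
      Real.volume_real_Icc_of_le (by linarith)]
    linarith
  rw [Real.norm_eq_abs, Real.norm_eq_abs, abs_of_pos ht0, arcMass, abs_of_nonneg (by positivity)]
  calc (2 * Real.pi)⁻¹ * volume.real (rootArc ω X ε ρ t ∩ Set.Ioc 0 (2 * Real.pi))
      ≤ (2 * Real.pi)⁻¹ * (2 * Real.pi * s) := mul_le_mul_of_nonneg_left hvol (by positivity)
    _ = 2 / (c * |X|) * t := by rw [hs]; field_simp

end ArcMeasure

/-! ### Residues for means over the unit circle. -/

section CircleMean

/-- The mean over the unit circle of a function holomorphic in the disc. -/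
theorem circleAverage_of_differentiableOn {f : ℂ → ℂ} {U : Set ℂ} (hU : IsOpen U)
    (hsub : Metric.closedBall 0 1 ⊆ U) (hf : DifferentiableOn ℂ f U) :
    Real.circleAverage f 0 1 = f 0 := by
  rw [Real.circleAverage_eq_circleIntegral one_ne_zero]
  exact Complex.two_pi_I_inv_smul_circleIntegral_sub_inv_smul_of_differentiable_on_off_countable
    Set.countable_empty (by simp) (hf.continuousOn.mono hsub)
    fun x hx => (hf x (hsub (Metric.ball_subset_closedBall hx.1))).differentiableAt
      (hU.mem_nhds (hsub (Metric.ball_subset_closedBall hx.1)))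

/-- The mean is taken against `dw / w`; partial fractions of `1 / (w (w - a))` reduce it to two
Cauchy formulas. -/
theorem circleAverage_div_sub {f : ℂ → ℂ} {U : Set ℂ} (hU : IsOpen U)
    (hsub : Metric.closedBall 0 1 ⊆ U) (hf : DifferentiableOn ℂ f U) {a : ℂ} (ha : a ≠ 0)
    (ha1 : ‖a‖ < 1) :
    Real.circleAverage (fun w => f w / (w - a)) 0 1 = (f a - f 0) / a := by
  have hval := fun b (hb : ‖b‖ < 1) =>
    Complex.two_pi_I_inv_smul_circleIntegral_sub_inv_smul_of_differentiable_on_off_countable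
      (w := b) (c := 0) (R := 1) Set.countable_empty (by simpa using hb)
      (hf.continuousOn.mono hsub)
      fun x hx => (hf x (hsub (Metric.ball_subset_closedBall hx.1))).differentiableAt
        (hU.mem_nhds (hsub (Metric.ball_subset_closedBall hx.1)))
  have hint : ∀ b : ℂ, ‖b‖ < 1 → CircleIntegrable (fun w => (w - b)⁻¹ • f w) 0 1 := by
    intro b hb
    refine ContinuousOn.circleIntegrable zero_le_one ?_
    refine ContinuousOn.smul (ContinuousOn.inv₀
      ((continuous_id.sub continuous_const).continuousOn (f := fun w : ℂ => w - b)) fun w hw => ?_)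
      (hf.continuousOn.mono (Metric.sphere_subset_closedBall.trans hsub))
    rw [sub_ne_zero]
    rintro rfl
    rw [mem_sphere_zero_iff_norm] at hw
    exact hb.ne hw
  have hcongr : (∮ w in C(0, 1), (w - 0)⁻¹ • (f w / (w - a))) =
      ∮ w in C(0, 1), a⁻¹ • ((w - a)⁻¹ • f w - (w - 0)⁻¹ • f w) := by
    refine circleIntegral.integral_congr zero_le_one fun w hw => ?_
    have hw1 : ‖w‖ = 1 := by simpa using hw
    have hw0 : w ≠ 0 := norm_ne_zero_iff.1 (by rw [hw1]; exact one_ne_zero)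
    have hwa : w - a ≠ 0 := by
      rw [sub_ne_zero]
      rintro rfl
      exact ha1.ne hw1
    simp only [smul_eq_mul, sub_zero]
    field_simp
    ring
  rw [Real.circleAverage_eq_circleIntegral one_ne_zero, hcongr, circleIntegral.integral_smul,
    circleIntegral.integral_sub (hint a ha1) (hint 0 (by simp)), smul_comm, smul_sub,
    hval a ha1, hval 0 (by simp), smul_eq_mul]
  ring

theorem circleAverage_div_of_ne_zero {f p : ℂ → ℂ} (hf : Differentiable ℂ f)
    (hp : Differentiable ℂ p) (hne : ∀ w : ℂ, ‖w‖ ≤ 1 → p w ≠ 0) :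
    Real.circleAverage (fun w => f w / p w) 0 1 = f 0 / p 0 := by
  have hU : IsOpen {w | p w ≠ 0} := isOpen_ne.preimage hp.continuous
  refine circleAverage_of_differentiableOn (f := fun w => f w / p w) hU
    (fun w hw => hne w (by simpa using hw)) fun w hw => ?_
  exact ((hf w).div (hp w) hw).differentiableWithinAt

theorem circleAverage_div_of_simple_zero {f p : ℂ → ℂ} (hf : Differentiable ℂ f)
    (hp : Differentiable ℂ p) {a : ℂ} (ha : a ≠ 0) (ha1 : ‖a‖ < 1) (hpa : p a = 0)
    (hda : deriv p a ≠ 0) (hne : ∀ w : ℂ, ‖w‖ ≤ 1 → w ≠ a → p w ≠ 0) :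
    Real.circleAverage (fun w => f w / p w) 0 1 = f 0 / p 0 + f a / (a * deriv p a) := by
  -- Dividing out the zero: `p = (w - a) q` with `q` entire, nonvanishing on the closed disc, and `q
  -- a = p' a`.
  have hq : Differentiable ℂ (dslope p a) := by
    rw [← differentiableOn_univ] at hp ⊢
    exact (Complex.differentiableOn_dslope univ_mem).2 hp
  have hpq : ∀ w, p w = (w - a) * dslope p a w := by
    intro w
    have := sub_smul_dslope p a w
    rw [hpa, sub_zero, smul_eq_mul] at this
    exact this.symm
  have hqa : dslope p a a = deriv p a := dslope_same p a
  have hq0 : ∀ w : ℂ, ‖w‖ ≤ 1 → dslope p a w ≠ 0 := by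
    intro w hw h0
    rcases eq_or_ne w a with rfl | hwa
    · exact hda (hqa ▸ h0)
    · exact hne w hw hwa (by rw [hpq, h0, mul_zero])
  have hU : IsOpen {w | dslope p a w ≠ 0} := isOpen_ne.preimage hq.continuous
  have h := circleAverage_div_sub (f := fun w => f w / dslope p a w) hU
    (fun w hw => hq0 w (by simpa using hw))
    (fun w hw => ((hf w).div (hq w) hw).differentiableWithinAt) ha ha1
  have hfun : (fun w => f w / p w) = fun w => f w / dslope p a w / (w - a) := by
    funext w
    rw [hpq w, div_div, mul_comm (w - a)]
  have h0 := hq0 0 (by simp)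
  rw [hfun, h, hqa, hpq 0]
  field_simp
  ring

end CircleMean

/-! ### The mean over `w` at a fixed `Z`. -/

section InnerMean

variable {P : ℂ → ℂ → ℂ} {X β : ℝ} {ω : ℂ → ℂ} {ε c γ : ℝ}

/-- Contribution to the mean over `w` of `T / P` of the small root of `P Z`. -/
def rootTerm (P T : ℂ → ℂ → ℂ) (ω : ℂ → ℂ) (Z : ℂ) : ℂ :=
  T Z (ω Z) / (ω Z * deriv (P Z) (ω Z))

/-- Value of the mean over `w` of `T / P` at the point of angle `θ`. -/
def innerValue (P T : ℂ → ℂ → ℂ) (ω : ℂ → ℂ) (X ε ρ t θ : ℝ) : ℂ :=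
  T (ρ * circleMap 0 1 θ) 0 / P (ρ * circleMap 0 1 θ) 0 +
    (rootArc ω X ε ρ t).indicator (fun θ => rootTerm P T ω (ρ * circleMap 0 1 θ)) θ

theorem differentiable_snd_of_contDiff {T : ℂ → ℂ → ℂ}
    (hT : ContDiff ℂ ⊤ fun x : ℂ × ℂ => T x.1 x.2) (Z : ℂ) : Differentiable ℂ (T Z) :=
  (hT.differentiable (by simp)).comp ((differentiable_const Z).prodMk differentiable_id)

/-- Outside countably many angles there is no zero at `w = 0` nor on `|w| = 1`. Any zero in the disc
is `ω(Z) / t`, it is simple, and it is present exactly on the root arc. The exceptional angles do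
not depend on `T`. -/
theorem LocalRoot.eventually_innerMean (h : LocalRoot P X β ω ε c)
    (hγ : γ ∈ Set.Ioo (-1 : ℝ) 1) :
    ∀ᶠ t in 𝓝[>] (0 : ℝ), ∀ᵐ θ : ℝ, P (fieldRadius X β γ t * circleMap 0 1 θ) 0 ≠ 0 ∧
      ∀ T : ℂ → ℂ → ℂ, (ContDiff ℂ ⊤ fun x : ℂ × ℂ => T x.1 x.2) →
      Real.circleAverage (fun w => T (fieldRadius X β γ t * circleMap 0 1 θ) (t * w) /
        P (fieldRadius X β γ t * circleMap 0 1 θ) (t * w)) 0 1 =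
      innerValue P T ω X ε (fieldRadius X β γ t) t θ := by
  filter_upwards [h.eventually_countable_level hγ,
    (h.eventually_countable_zero γ).filter_mono nhdsWithin_le_nhds,
    (h.eventually_root γ univ_mem).filter_mono nhdsWithin_le_nhds,
    (gt_mem_nhds h.ε_pos : ∀ᶠ t in 𝓝 (0 : ℝ), t < ε).filter_mono nhdsWithin_le_nhds,
    self_mem_nhdsWithin] with t hc1 hc2 hroot htε ht0
  have ht0 : 0 < t := ht0
  have htc : (t : ℂ) ≠ 0 := Complex.ofReal_ne_zero.2 ht0.ne'
  filter_upwards [hc1.ae_notMem volume, hc2.ae_notMem volume] with θ h1 h2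
  set Z : ℂ := fieldRadius X β γ t * circleMap 0 1 θ with hZ
  have hZ0 : P Z 0 ≠ 0 := h2
  refine ⟨hZ0, fun T hT => ?_⟩
  have hscale : Differentiable ℂ fun w : ℂ => (t : ℂ) * w := by fun_prop
  have hf : Differentiable ℂ fun w : ℂ => T Z (t * w) :=
    (differentiable_snd_of_contDiff hT Z).comp hscale
  have hp : Differentiable ℂ fun w : ℂ => P Z (t * w) :=
    (differentiable_snd_of_contDiff h.contDiff Z).comp hscale
  have hlevel : ∀ w : ℂ, ‖w‖ = 1 → P Z (t * w) ≠ 0 := fun w hw h0 => h1 ⟨w, hw, h0⟩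
  have hwn : ∀ w : ℂ, ‖(t : ℂ) * w‖ = t * ‖w‖ := fun w => by
    rw [norm_mul, Complex.norm_real, Real.norm_eq_abs, abs_of_pos ht0]
  rw [innerValue]
  by_cases hmem : θ ∈ rootArc ω X ε (fieldRadius X β γ t) t
  · rw [Set.indicator_of_mem hmem]
    obtain ⟨hm1, hm2⟩ := hmem
    rw [← hZ] at hm1 hm2
    have hPω : P Z (ω Z) = 0 := (h.root_iff Z (ω Z) hm1 (hm2.trans htε)).2 rfl
    have hω0 : ω Z ≠ 0 := fun h0 => hZ0 (by rwa [h0] at hPω)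
    have hd : HasDerivAt (fun w : ℂ => P Z (t * w)) (deriv (P Z) (ω Z) * t) (ω Z / t) := by
      have h3 : HasDerivAt (P Z) (deriv (P Z) (ω Z)) (t * (ω Z / t)) := by
        rw [mul_div_cancel₀ _ htc]
        exact (differentiable_snd_of_contDiff h.contDiff Z _).hasDerivAt
      have h4 : HasDerivAt (fun w : ℂ => (t : ℂ) * w) (t : ℂ) (ω Z / t) := by
        simpa using (hasDerivAt_id (ω Z / t)).const_mul (t : ℂ)
      exact h3.comp _ h4
    have hval := circleAverage_div_of_simple_zero hf hp (a := ω Z / t) (div_ne_zero hω0 htc)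
      (by rw [norm_div, Complex.norm_real, Real.norm_eq_abs, abs_of_pos ht0, div_lt_one ht0]
          exact hm2)
      (by rw [mul_div_cancel₀ _ htc]; exact hPω)
      (by rw [hd.deriv]; exact mul_ne_zero (h.deriv_snd_ne Z hm1) htc)
      (fun w hw hwa h0 => hwa (by
        obtain ⟨-, -, h3⟩ := hroot (circleMap 0 1 θ) w (by simp) hw h0
        rw [← hZ] at h3
        rw [h3, mul_div_cancel_left₀ _ htc]))
    rw [hval, hd.deriv, mul_zero, mul_div_cancel₀ _ htc, rootTerm]
    congr 2
    rw [← hZ]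
    field_simp
  · rw [Set.indicator_of_notMem hmem, add_zero]
    have hval := circleAverage_div_of_ne_zero hf hp fun w hw h0 => by
      obtain ⟨-, h3, h4⟩ := hroot (circleMap 0 1 θ) w (by simp) hw h0
      rw [← hZ] at h3 h4
      -- A zero inside the disc would put the angle on the arc; a zero on the circle is one of the
      -- excluded levels.
      rcases hw.lt_or_eq with hlt | heq
      · refine hmem ⟨h3, ?_⟩
        rw [← hZ, h4, hwn]
        nlinarith
      · exact hlevel w heq h0
    rw [hval, mul_zero]

theorem innerValue_add (T₁ T₂ : ℂ → ℂ → ℂ) (ρ t θ : ℝ) :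
    innerValue P (fun Z w => T₁ Z w + T₂ Z w) ω X ε ρ t θ =
      innerValue P T₁ ω X ε ρ t θ + innerValue P T₂ ω X ε ρ t θ := by
  by_cases hmem : θ ∈ rootArc ω X ε ρ t
  · simp only [innerValue, Set.indicator_of_mem hmem, rootTerm]
    ring
  · simp only [innerValue, Set.indicator_of_notMem hmem]
    ring

theorem LocalRoot.eventually_innerValue_self (h : LocalRoot P X β ω ε c)
    (hγ : γ ∈ Set.Ioo (-1 : ℝ) 1) :
    ∀ᶠ t in 𝓝[>] (0 : ℝ), ∀ᵐ θ : ℝ, innerValue P P ω X ε (fieldRadius X β γ t) t θ = 1 := by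
  filter_upwards [h.eventually_innerMean hγ,
    (gt_mem_nhds h.ε_pos : ∀ᶠ t in 𝓝 (0 : ℝ), t < ε).filter_mono nhdsWithin_le_nhds]
    with t ht htε
  filter_upwards [ht] with θ hθ
  rw [innerValue, div_self hθ.1]
  by_cases hmem : θ ∈ rootArc ω X ε (fieldRadius X β γ t) t
  · rw [Set.indicator_of_mem hmem, rootTerm, (h.root_iff _ _ hmem.1 (hmem.2.trans htε)).2 rfl, zero_div, add_zero]
  · rw [Set.indicator_of_notMem hmem, add_zero]

end InnerMean

/-! ### Numerators divisible by `ω` on the zero set. -/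

section RootMultiple

variable {P : ℂ → ℂ → ℂ} {X β : ℝ} {ω : ℂ → ℂ} {ε c γ : ℝ}

/-- `T` equals `ω` times `L` on the zero set `W = ω Z`, near `X`. -/
structure RootMultiple (X : ℝ) (ω : ℂ → ℂ) (T : ℂ → ℂ → ℂ) (L : ℂ → ℂ) : Prop where
  contDiff : ContDiff ℂ ⊤ fun x : ℂ × ℂ => T x.1 x.2
  eq_mul : ∀ᶠ Z in 𝓝[≠] (X : ℂ), T Z (ω Z) = ω Z * L Z
  differentiableAt : DifferentiableAt ℂ L X

theorem RootMultiple.add {T₁ T₂ : ℂ → ℂ → ℂ} {L₁ L₂ : ℂ → ℂ} (h₁ : RootMultiple X ω T₁ L₁)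
    (h₂ : RootMultiple X ω T₂ L₂) :
    RootMultiple X ω (fun Z w => T₁ Z w + T₂ Z w) fun Z => L₁ Z + L₂ Z where
  contDiff := h₁.contDiff.add h₂.contDiff
  eq_mul := by
    filter_upwards [h₁.eq_mul, h₂.eq_mul] with Z hZ₁ hZ₂
    rw [hZ₁, hZ₂]
    ring
  differentiableAt := h₁.differentiableAt.add h₂.differentiableAt

theorem RootMultiple.apply_self {T : ℂ → ℂ → ℂ} {L : ℂ → ℂ} (hT : RootMultiple X ω T L)
    (h : LocalRoot P X β ω ε c) : T X 0 = 0 := by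
  have hω : ContinuousAt ω X := (h.hasDerivAt).continuousAt
  have h1 : ContinuousAt (fun Z => T Z (ω Z)) (X : ℂ) :=
    ContinuousAt.comp (f := fun Z => (Z, ω Z)) (g := fun x : ℂ × ℂ => T x.1 x.2)
      hT.contDiff.continuous.continuousAt (continuousAt_id.prodMk hω)
  have h2 : ContinuousAt (fun Z => ω Z * L Z) (X : ℂ) := hω.mul hT.differentiableAt.continuousAt
  have h3 : Tendsto (fun Z => T Z (ω Z)) (𝓝[≠] (X : ℂ)) (𝓝 (ω X * L X)) :=
    (h2.tendsto.mono_left nhdsWithin_le_nhds).congr' (hT.eq_mul.mono fun _ hZ => hZ.symm)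
  have h4 := tendsto_nhds_unique (h1.tendsto.mono_left nhdsWithin_le_nhds) h3
  simpa [h.root_self] using h4

theorem differentiable_fst_of_contDiff {T : ℂ → ℂ → ℂ}
    (hT : ContDiff ℂ ⊤ fun x : ℂ × ℂ => T x.1 x.2) (w : ℂ) : Differentiable ℂ fun Z => T Z w :=
  (hT.differentiable (by simp)).comp (differentiable_id.prodMk (differentiable_const w))

/-- On the circle through `X` the only zero of `P(·, 0)` is simple, and the numerator vanishes there
too. The quotient of the two slopes is continuous on the circle, and compactness carries the bound
to nearby radii. -/
theorem LocalRoot.exists_bound_quotient (h : LocalRoot P X β ω ε c) (γ : ℝ) {T : ℂ → ℂ → ℂ}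
    {L : ℂ → ℂ} (hT : RootMultiple X ω T L) :
    ∃ C : ℝ, ∀ᶠ t in 𝓝 (0 : ℝ), ∀ z : ℂ, ‖z‖ = 1 →
      ‖T (fieldRadius X β γ t * z) 0 / P (fieldRadius X β γ t * z) 0‖ ≤ C := by
  have hds : ∀ T : ℂ → ℂ → ℂ, (ContDiff ℂ ⊤ fun x : ℂ × ℂ => T x.1 x.2) →
      Continuous (dslope (fun Z => T Z 0) X) := by
    intro T hT
    have h1 := differentiable_fst_of_contDiff hT 0
    rw [← differentiableOn_univ] at h1
    have h2 := (Complex.differentiableOn_dslope (c := (X : ℂ)) univ_mem).2 h1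
    exact (differentiableOn_univ.1 h2).continuous
  set τ := dslope (fun Z => T Z 0) X with hτ
  set π := dslope (fun Z => P Z 0) X with hπ
  have hτc : Continuous τ := hds T hT.contDiff
  have hπc : Continuous π := hds P h.contDiff
  have hTX := hT.apply_self h
  have heq : ∀ Z : ℂ, ‖T Z 0 / P Z 0‖ ≤ ‖τ Z / π Z‖ := by
    intro Z
    have h1 := sub_smul_dslope (fun Z => T Z 0) (X : ℂ) Z
    have h2 := sub_smul_dslope (fun Z => P Z 0) (X : ℂ) Z
    simp only [hTX, h.apply_self, sub_zero, smul_eq_mul] at h1 h2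
    rcases eq_or_ne Z (X : ℂ) with rfl | hZ
    · rw [hTX, zero_div, norm_zero]
      exact norm_nonneg _
    · rw [← h1, ← h2, mul_div_mul_left _ _ (sub_ne_zero.2 hZ)]
  have hπ0 : ∀ Z : ℂ, ‖Z‖ = |X| → π Z ≠ 0 := by
    intro Z hZ h0
    rcases eq_or_ne Z (X : ℂ) with rfl | hne
    · exact h.deriv_fst_ne (by rwa [hπ, dslope_same] at h0)
    · have h2 := sub_smul_dslope (fun Z => P Z 0) (X : ℂ) Z
      rw [← hπ, h0, smul_zero, h.apply_self, sub_zero] at h2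
      exact h.ne_zero Z hZ hne h2.symm
  have hnorm : ∀ z : ℂ, ‖z‖ = 1 → ‖(fieldRadius X β γ 0 : ℂ) * z‖ = |X| := by
    intro z hz
    rw [fieldRadius_zero, norm_mul, hz, mul_one, Complex.norm_real, Real.norm_eq_abs, abs_abs]
  have hK : IsCompact (Metric.sphere (0 : ℂ) 1) := isCompact_sphere 0 1
  have hcont : ContinuousOn (fun z : ℂ => ‖τ (fieldRadius X β γ 0 * z) /
      π (fieldRadius X β γ 0 * z)‖) (Metric.sphere (0 : ℂ) 1) := by
    refine (ContinuousOn.div (by fun_prop) (by fun_prop) fun z hz => ?_).norm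
    exact hπ0 _ (hnorm z (by simpa using hz))
  obtain ⟨C, hC⟩ := hK.bddAbove_image hcont
  refine ⟨C + 1, ?_⟩
  have hev := hK.eventually_forall_of_forall_eventually (x₀ := (0 : ℝ))
    (P := fun t z => ‖τ (fieldRadius X β γ t * z) / π (fieldRadius X β γ t * z)‖ < C + 1)
    (fun z hz => by
      have h1 : ContinuousAt (fun q : ℝ × ℂ => ‖τ (fieldRadius X β γ q.1 * q.2) /
          π (fieldRadius X β γ q.1 * q.2)‖) (0, z) := by
        have h2 := continuous_fieldRadius X β γ
        refine (ContinuousAt.div (Continuous.continuousAt (by fun_prop))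
          (Continuous.continuousAt (by fun_prop)) ?_).norm
        exact hπ0 _ (hnorm z (by simpa using hz))
      refine h1.eventually (gt_mem_nhds ?_)
      exact (hC ⟨z, hz, rfl⟩).trans_lt (lt_add_one C))
  filter_upwards [hev] with t ht z hz
  exact (heq _).trans (ht z (by simpa using hz)).le

theorem LocalRoot.norm_sub_le_of_mem_rootArc (h : LocalRoot P X β ω ε c) {ρ t θ : ℝ}
    (hθ : θ ∈ rootArc ω X ε ρ t) : ‖(ρ * circleMap 0 1 θ : ℂ) - X‖ ≤ c⁻¹ * t := by
  rw [inv_mul_eq_div, le_div_iff₀' h.c_pos]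
  exact (h.lower _ hθ.1).trans hθ.2.le

/-- The factor `ω` of the numerator cancels that of the residue, leaving `L / ∂₂P`, which is
differentiable at `X`; on the arc `|Z - X|` is at most `t / c`. -/
theorem LocalRoot.exists_rootTerm_approx (h : LocalRoot P X β ω ε c) {T : ℂ → ℂ → ℂ}
    {L : ℂ → ℂ} (hT : RootMultiple X ω T L) (y : ℤ) :
    ∃ C : ℝ, 0 ≤ C ∧ ∀ᶠ t in 𝓝[>] (0 : ℝ), ∀ ρ : ℝ, ∀ θ ∈ rootArc ω X ε ρ t,
      (ρ * circleMap 0 1 θ : ℂ) ≠ X →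
      ‖(ρ * circleMap 0 1 θ : ℂ) ^ (-y) * rootTerm P T ω (ρ * circleMap 0 1 θ) -
        (X : ℂ) ^ (-y) * (L X / deriv (P X) 0)‖ ≤ C * t := by
  have hXc : (X : ℂ) ≠ 0 := Complex.ofReal_ne_zero.2 h.X_ne
  have hne : deriv (P X) (ω X) ≠ 0 := h.deriv_snd_ne X (by simpa using h.ε_pos)
  set Φ : ℂ → ℂ := fun Z => Z ^ (-y) * (L Z / deriv (P Z) (ω Z)) with hΦ
  have hd : DifferentiableAt ℂ Φ X :=
    (differentiableAt_zpow.2 (Or.inl hXc)).mul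
      (hT.differentiableAt.div h.differentiableAt_deriv_snd hne)
  obtain ⟨C, hC⟩ := hd.isBigO_sub.bound
  have hev : ∀ᶠ Z : ℂ in 𝓝 (X : ℂ), Z ≠ X →
      ‖Z ^ (-y) * rootTerm P T ω Z - Φ X‖ ≤ C * ‖Z - X‖ := by
    filter_upwards [hC, eventually_nhdsWithin_iff.1 hT.eq_mul, Metric.ball_mem_nhds _ h.ε_pos]
      with Z h1 h2 h3 hZ
    have hω : ω Z ≠ 0 := by
      intro h0
      have h4 := h.lower Z (mem_ball_iff_norm.1 h3)
      rw [h0, norm_zero] at h4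
      exact absurd h4 (not_le.2 (mul_pos h.c_pos (norm_pos_iff.2 (sub_ne_zero.2 hZ))))
    rw [rootTerm, h2 hZ, mul_div_mul_left _ _ hω]
    exact h1
  obtain ⟨δ, hδ, hball⟩ := Metric.eventually_nhds_iff.1 hev
  have hC0 : 0 ≤ |C| * c⁻¹ := mul_nonneg (abs_nonneg _) (inv_nonneg.2 h.c_pos.le)
  refine ⟨|C| * c⁻¹, hC0, ?_⟩
  have hsmall : ∀ᶠ t in 𝓝 (0 : ℝ), c⁻¹ * t < δ := by
    have h1 : Tendsto (fun t : ℝ => c⁻¹ * t) (𝓝 0) (𝓝 (c⁻¹ * 0)) := tendsto_id.const_mul _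
    rw [mul_zero] at h1
    exact h1.eventually (gt_mem_nhds hδ)
  filter_upwards [hsmall.filter_mono nhdsWithin_le_nhds] with t ht ρ θ hθ hZ
  have h1 := h.norm_sub_le_of_mem_rootArc hθ
  have h2 := hball (y := (ρ * circleMap 0 1 θ : ℂ)) (by rw [dist_eq_norm]; linarith) hZ
  have h3 : Φ X = (X : ℂ) ^ (-y) * (L X / deriv (P X) 0) := by
    rw [hΦ]
    simp only [h.root_self]
  rw [h3] at h2
  refine h2.trans ?_
  calc C * ‖(ρ * circleMap 0 1 θ : ℂ) - X‖ ≤ |C| * (c⁻¹ * t) :=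
        mul_le_mul (le_abs_self C) h1 (norm_nonneg _) (abs_nonneg _)
    _ = |C| * c⁻¹ * t := by ring

theorem LocalRoot.measurable_innerValue (h : LocalRoot P X β ω ε c) {T : ℂ → ℂ → ℂ}
    (hT : ContDiff ℂ ⊤ fun x : ℂ × ℂ => T x.1 x.2) (ρ t : ℝ) :
    AEStronglyMeasurable (innerValue P T ω X ε ρ t) volume := by
  have hZc : Continuous fun θ : ℝ => (ρ * circleMap 0 1 θ : ℂ) :=
    continuous_const.mul (continuous_circleMap 0 1)
  have hq : Measurable fun θ : ℝ =>
      T (ρ * circleMap 0 1 θ) 0 / P (ρ * circleMap 0 1 θ) 0 :=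
    ((hT.continuous.comp (hZc.prodMk continuous_const)).measurable).div
      ((h.contDiff.continuous.comp (hZc.prodMk continuous_const)).measurable)
  have hdc : Continuous fun x : ℂ × ℂ => deriv (P x.1) x.2 := by
    have h1 : ∀ x : ℂ × ℂ, deriv (P x.1) x.2 =
        fderiv ℂ (fun x : ℂ × ℂ => P x.1 x.2) x (0, 1) := by
      intro x
      have h2 : HasFDerivAt (fun x : ℂ × ℂ => P x.1 x.2)
          (fderiv ℂ (fun x : ℂ × ℂ => P x.1 x.2) x) (x.1, x.2) :=
        (h.contDiff.differentiable (by simp) _).hasFDerivAt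
      exact (h2.comp_hasDerivAt (f := fun W => (x.1, W)) x.2
        ((hasDerivAt_const x.2 x.1).prodMk (hasDerivAt_id x.2))).deriv
    simp only [h1]
    exact (h.contDiff.continuous_fderiv (by simp)).clm_apply continuous_const
  have hA := (h.isOpen_rootArc ρ t).measurableSet
  have hωc : ContinuousOn (fun θ : ℝ => ω (ρ * circleMap 0 1 θ)) (rootArc ω X ε ρ t) :=
    fun θ hθ => (ContinuousAt.comp (f := fun θ : ℝ => (ρ * circleMap 0 1 θ : ℂ)) (x := θ)
      (h.differentiableAt _ hθ.1).continuousAt hZc.continuousAt).continuousWithinAt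
  have hnum : ContinuousOn (fun θ : ℝ => T (ρ * circleMap 0 1 θ) (ω (ρ * circleMap 0 1 θ)))
      (rootArc ω X ε ρ t) :=
    hT.continuous.comp_continuousOn (hZc.continuousOn.prodMk hωc)
  have hden : ContinuousOn (fun θ : ℝ => ω (ρ * circleMap 0 1 θ) *
      deriv (P (ρ * circleMap 0 1 θ)) (ω (ρ * circleMap 0 1 θ))) (rootArc ω X ε ρ t) :=
    hωc.mul (hdc.comp_continuousOn (hZc.continuousOn.prodMk hωc))
  have hr : AEStronglyMeasurable (fun θ : ℝ => rootTerm P T ω (ρ * circleMap 0 1 θ))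
      (volume.restrict (rootArc ω X ε ρ t)) :=
    ((hnum.aestronglyMeasurable hA).aemeasurable.div
      (hden.aestronglyMeasurable hA).aemeasurable).aestronglyMeasurable
  exact hq.aestronglyMeasurable.add ((aestronglyMeasurable_indicator_iff hA).2 hr)

theorem LocalRoot.exists_bound_innerValue (h : LocalRoot P X β ω ε c)
    (hγ : γ ∈ Set.Ioo (-1 : ℝ) 1) {T : ℂ → ℂ → ℂ} {L : ℂ → ℂ} (hT : RootMultiple X ω T L) :
    ∃ C : ℝ, ∀ᶠ t in 𝓝[>] (0 : ℝ), ∀ᵐ θ : ℝ,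
      ‖innerValue P T ω X ε (fieldRadius X β γ t) t θ‖ ≤ C := by
  obtain ⟨C₁, h1⟩ := h.exists_bound_quotient γ hT
  obtain ⟨C₂, hC₂, h2⟩ := h.exists_rootTerm_approx hT 0
  refine ⟨C₁ + (C₂ + ‖L X / deriv (P X) 0‖), ?_⟩
  filter_upwards [h1.filter_mono nhdsWithin_le_nhds, h2, h.eventually_innerMean hγ,
    (gt_mem_nhds one_pos : ∀ᶠ t in 𝓝 (0 : ℝ), t < 1).filter_mono nhdsWithin_le_nhds]
    with t ht1 ht2 hgood ht
  filter_upwards [hgood] with θ hθ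
  have hZX : (fieldRadius X β γ t * circleMap 0 1 θ : ℂ) ≠ X := by
    intro h0
    exact hθ.1 (by rw [h0]; exact h.apply_self)
  refine (norm_add_le _ _).trans (add_le_add (ht1 _ (by simp)) ?_)
  by_cases hmem : θ ∈ rootArc ω X ε (fieldRadius X β γ t) t
  · rw [Set.indicator_of_mem hmem]
    have h3 := ht2 _ θ hmem hZX
    simp only [neg_zero, zpow_zero, one_mul] at h3
    have h4 := norm_le_norm_sub_add (rootTerm P T ω (fieldRadius X β γ t * circleMap 0 1 θ))
      (L X / deriv (P X) 0)
    have h5 : C₂ * t ≤ C₂ := mul_le_of_le_one_right hC₂ ht.le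
    linarith
  · rw [Set.indicator_of_notMem hmem, norm_zero]
    positivity

end RootMultiple

/-! ### Means over the torus and their size. -/

section GreenMean

variable {P : ℂ → ℂ → ℂ} {X β : ℝ} {ω : ℂ → ℂ} {ε c γ : ℝ}

/-- Mean of `z ^ (-y) * T / P` over the torus of radii `ρ` and `t`. -/
def greenMean (P T : ℂ → ℂ → ℂ) (ρ t : ℝ) (y : ℤ) : ℂ :=
  Real.circleAverage (fun z => z ^ (-y) *
    Real.circleAverage (fun w => T (ρ * z) (t * w) / P (ρ * z) (t * w)) 0 1) 0 1

theorem LocalRoot.eventually_greenMean_eq (h : LocalRoot P X β ω ε c)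
    (hγ : γ ∈ Set.Ioo (-1 : ℝ) 1) :
    ∀ᶠ t in 𝓝[>] (0 : ℝ), ∀ T : ℂ → ℂ → ℂ, (ContDiff ℂ ⊤ fun x : ℂ × ℂ => T x.1 x.2) →
      ∀ y : ℤ, greenMean P T (fieldRadius X β γ t) t y =
        (2 * Real.pi)⁻¹ • ∫ θ in (0)..(2 * Real.pi), circleMap 0 1 θ ^ (-y) *
          innerValue P T ω X ε (fieldRadius X β γ t) t θ := by
  filter_upwards [h.eventually_innerMean hγ] with t ht T hT y
  rw [greenMean, Real.circleAverage_def]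
  congr 1
  refine intervalIntegral.integral_congr_ae ?_
  filter_upwards [ht] with θ hθ _
  rw [hθ.2 T hT]

theorem LocalRoot.eventually_intervalIntegrable (h : LocalRoot P X β ω ε c)
    (hγ : γ ∈ Set.Ioo (-1 : ℝ) 1) {T : ℂ → ℂ → ℂ} {L : ℂ → ℂ} (hT : RootMultiple X ω T L) :
    ∀ᶠ t in 𝓝[>] (0 : ℝ), ∀ y : ℤ, IntervalIntegrable (fun θ => circleMap 0 1 θ ^ (-y) *
      innerValue P T ω X ε (fieldRadius X β γ t) t θ) volume 0 (2 * Real.pi) := by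
  obtain ⟨C, hC⟩ := h.exists_bound_innerValue hγ hT
  filter_upwards [hC] with t ht y
  rw [intervalIntegrable_iff]
  have hz : Continuous fun θ : ℝ => circleMap 0 1 θ ^ (-y) :=
    (continuous_circleMap 0 1).zpow₀ _ fun θ => Or.inl (circleMap_ne_center one_ne_zero)
  refine Measure.integrableOn_of_bounded (M := C) (by rw [Set.uIoc_of_le (by positivity)]; exact measure_Ioc_lt_top.ne)
    (hz.aestronglyMeasurable.mul (h.measurable_innerValue hT.contDiff _ t)) ?_
  refine ae_restrict_of_ae ?_
  filter_upwards [ht] with θ hθ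
  rw [norm_mul, norm_zpow, norm_circleMap_zero]
  simpa using hθ

/-- The integrands may be singular at torus roots, so linearity is not taken from the double
integral but from the explicit inner values, which are bounded and additive in the numerator. -/
theorem LocalRoot.eventually_greenMean_add (h : LocalRoot P X β ω ε c)
    (hγ : γ ∈ Set.Ioo (-1 : ℝ) 1) {T₁ T₂ : ℂ → ℂ → ℂ} {L₁ L₂ : ℂ → ℂ}
    (hT₁ : RootMultiple X ω T₁ L₁) (hT₂ : RootMultiple X ω T₂ L₂) :
    ∀ᶠ t in 𝓝[>] (0 : ℝ), ∀ y : ℤ,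
      greenMean P (fun Z w => T₁ Z w + T₂ Z w) (fieldRadius X β γ t) t y =
        greenMean P T₁ (fieldRadius X β γ t) t y + greenMean P T₂ (fieldRadius X β γ t) t y := by
  filter_upwards [h.eventually_greenMean_eq hγ, h.eventually_intervalIntegrable hγ hT₁,
    h.eventually_intervalIntegrable hγ hT₂] with t ht h1 h2 y
  rw [ht _ (hT₁.add hT₂).contDiff, ht _ hT₁.contDiff, ht _ hT₂.contDiff, ← smul_add,
    ← intervalIntegral.integral_add (h1 y) (h2 y)]
  simp only [innerValue_add, mul_add]

theorem LocalRoot.exists_bound_greenMean (h : LocalRoot P X β ω ε c)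
    (hγ : γ ∈ Set.Ioo (-1 : ℝ) 1) {T : ℂ → ℂ → ℂ} {L : ℂ → ℂ} (hT : RootMultiple X ω T L) :
    ∃ C : ℝ, ∀ᶠ t in 𝓝[>] (0 : ℝ), ∀ y : ℤ,
      ‖greenMean P T (fieldRadius X β γ t) t y‖ ≤ C := by
  obtain ⟨C, hC⟩ := h.exists_bound_innerValue hγ hT
  refine ⟨C, ?_⟩
  filter_upwards [h.eventually_greenMean_eq hγ, hC] with t ht h1 y
  have hpi := Real.pi_pos
  have h2 : ‖∫ θ in (0)..(2 * Real.pi), circleMap 0 1 θ ^ (-y) *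
      innerValue P T ω X ε (fieldRadius X β γ t) t θ‖ ≤ C * |2 * Real.pi - 0| := by
    refine intervalIntegral.norm_integral_le_of_norm_le_const_ae ?_
    filter_upwards [h1] with θ hθ _
    rw [norm_mul, norm_zpow, norm_circleMap_zero]
    simpa using hθ
  rw [sub_zero, abs_of_pos (by positivity)] at h2
  rw [ht _ hT.contDiff, norm_smul, norm_inv, Real.norm_eq_abs, abs_of_pos (by positivity),
    inv_mul_le_iff₀ (by positivity), mul_comm _ C]
  exact h2

theorem circleAverage_zpow (y : ℤ) :
    Real.circleAverage (fun z => z ^ y) 0 1 = if y = 0 then 1 else 0 := by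
  split_ifs with hy
  · simp [hy, Real.circleAverage_const]
  · rw [Real.circleAverage_eq_circleIntegral one_ne_zero]
    have h1 : (∮ z in C(0, 1), (z - 0)⁻¹ • z ^ y) = ∮ z in C(0, 1), (z - 0) ^ (y - 1) := by
      refine circleIntegral.integral_congr zero_le_one fun z hz => ?_
      have hz0 : z ≠ 0 := by
        rintro rfl
        simp at hz
      simp only [smul_eq_mul, sub_zero]
      rw [zpow_sub_one₀ hz0, mul_comm]
    rw [h1, circleIntegral.integral_sub_zpow_of_ne (by omega), smul_zero]

theorem LocalRoot.eventually_greenMean_self (h : LocalRoot P X β ω ε c)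
    (hγ : γ ∈ Set.Ioo (-1 : ℝ) 1) :
    ∀ᶠ t in 𝓝[>] (0 : ℝ), ∀ y : ℤ,
      greenMean P P (fieldRadius X β γ t) t y = if y = 0 then 1 else 0 := by
  filter_upwards [h.eventually_greenMean_eq hγ, h.eventually_innerValue_self hγ] with t ht h1 y
  have h2 := circleAverage_zpow (-y)
  rw [Real.circleAverage_def] at h2
  simp only [neg_eq_zero] at h2
  rw [ht P h.contDiff, ← h2]
  congr 1
  refine intervalIntegral.integral_congr_ae ?_
  filter_upwards [h1] with θ hθ _
  rw [hθ, mul_one]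

/-- A mean whose integrand has no contribution outside the arc is of the order of the arc. -/
theorem LocalRoot.greenMean_asymptotics (h : LocalRoot P X β ω ε c)
    (hγ : γ ∈ Set.Ioo (-1 : ℝ) 1) {T : ℂ → ℂ → ℂ} {L : ℂ → ℂ} (hT : RootMultiple X ω T L)
    (hT0 : ∀ Z, T Z 0 = 0) (y : ℤ) :
    (fun t => greenMean P T (fieldRadius X β γ t) t y /
      arcMass ω X ε (fieldRadius X β γ t) t -
        (|X| : ℝ) ^ y * ((X : ℂ) ^ (-y) * (L X / deriv (P X) 0))) =O[𝓝[>] 0] fun t : ℝ => t := by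
  obtain ⟨C, hC0, hC⟩ := h.exists_rootTerm_approx hT y
  set V : ℂ := (X : ℂ) ^ (-y) * (L X / deriv (P X) 0) with hV
  have hXc : |X| ≠ 0 := abs_ne_zero.2 h.X_ne
  have hkey : ∀ᶠ t in 𝓝[>] (0 : ℝ),
      ‖greenMean P T (fieldRadius X β γ t) t y / arcMass ω X ε (fieldRadius X β γ t) t -
        (fieldRadius X β γ t : ℂ) ^ y * V‖ ≤ ‖(fieldRadius X β γ t : ℂ) ^ y‖ * (C * t) := by
    filter_upwards [hC, h.eventually_greenMean_eq hγ, h.eventually_innerMean hγ,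
      h.eventually_arcMass_pos hγ] with t ht hgreen hgood hM
    have hρ0 : 0 < fieldRadius X β γ t := fieldRadius_pos h.X_ne β γ t
    set ρ := fieldRadius X β γ t with hρ
    have hρc : (ρ : ℂ) ≠ 0 := Complex.ofReal_ne_zero.2 hρ0.ne'
    set A := rootArc ω X ε ρ t ∩ Set.Ioc 0 (2 * Real.pi) with hA
    set M := arcMass ω X ε ρ t with hMdef
    have hMc : (M : ℂ) ≠ 0 := Complex.ofReal_ne_zero.2 hM.ne'
    have hAm : MeasurableSet A := (h.isOpen_rootArc ρ t).measurableSet.inter measurableSet_Ioc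
    have hfin : volume A < ⊤ :=
      (measure_mono Set.inter_subset_right).trans_lt measure_Ioc_lt_top
    set F : ℝ → ℂ := fun θ => (ρ * circleMap 0 1 θ : ℂ) ^ (-y) *
      rootTerm P T ω (ρ * circleMap 0 1 θ) with hF
    -- Only the arc contributes; writing `z = Z / ρ` moves the powers of `ρ` out of the integral.
    have hint : greenMean P T ρ t y = (2 * Real.pi)⁻¹ • ((ρ : ℂ) ^ y * ∫ θ in A, F θ) := by
      rw [hgreen T hT.contDiff, intervalIntegral.integral_of_le (by positivity)]
      congr 1
      rw [← integral_const_mul, hA, Set.inter_comm, ← setIntegral_indicator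
        (h.isOpen_rootArc ρ t).measurableSet]
      refine integral_congr_ae (Eventually.of_forall fun θ => ?_)
      simp only [innerValue, hT0, zero_div, zero_add]
      by_cases hmem : θ ∈ rootArc ω X ε ρ t
      · rw [Set.indicator_of_mem hmem, Set.indicator_of_mem hmem, hF]
        simp only [mul_zpow]
        rw [← mul_assoc, ← mul_assoc, ← zpow_add₀ hρc, add_neg_cancel, zpow_zero, one_mul]
      · rw [Set.indicator_of_notMem hmem, Set.indicator_of_notMem hmem, mul_zero]
    have hFm : AEStronglyMeasurable F (volume.restrict A) := by
      have h1 := h.measurable_innerValue hT.contDiff ρ t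
      have h2 : Continuous fun θ : ℝ => (ρ * circleMap 0 1 θ : ℂ) ^ (-y) :=
        (continuous_const.mul (continuous_circleMap 0 1)).zpow₀ _ fun θ =>
          Or.inl (mul_ne_zero hρc (circleMap_ne_center one_ne_zero))
      have h3 := (h2.aestronglyMeasurable.mul h1).restrict (s := A)
      refine h3.congr ?_
      filter_upwards [ae_restrict_mem hAm] with θ hθ
      simp only [Pi.mul_apply, innerValue, hT0, zero_div, zero_add]
      rw [Set.indicator_of_mem hθ.1]
    have hbd : ∀ᵐ θ ∂volume.restrict A, ‖F θ - V‖ ≤ C * t := by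
      filter_upwards [ae_restrict_mem hAm, ae_restrict_of_ae hgood] with θ hθ hg
      refine ht ρ θ hθ.1 fun h0 => hg.1 ?_
      rw [h0]
      exact h.apply_self
    have hVi : IntegrableOn (fun _ => V) A volume := integrableOn_const hfin.ne
    have hdi : IntegrableOn (fun θ => F θ - V) A volume :=
      haveI : IsFiniteMeasure (volume.restrict A) := ⟨by rwa [Measure.restrict_apply_univ]⟩
      Integrable.of_bound (hFm.sub aestronglyMeasurable_const) (C * t) hbd
    have hsplit : ∫ θ in A, F θ = (∫ θ in A, F θ - V) + volume.real A • V := by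
      rw [← setIntegral_const, ← integral_add hdi hVi]
      simp
    have hn := norm_setIntegral_le_of_norm_le_const_ae hfin hbd
    have hvol : volume.real A = 2 * Real.pi * M := by
      rw [hMdef, arcMass, ← hA]
      field_simp
    -- Dividing by the arc mass turns the integral into an average of `F` over the arc, within `C t`
    -- of the constant `V`.
    have hval : greenMean P T ρ t y / M - (ρ : ℂ) ^ y * V =
        (ρ : ℂ) ^ y * ((2 * Real.pi * M : ℝ) : ℂ)⁻¹ * ∫ θ in A, F θ - V := by
      rw [hint, hsplit, hvol]
      have hpi : (Real.pi : ℂ) ≠ 0 := Complex.ofReal_ne_zero.2 Real.pi_ne_zero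
      simp only [Complex.real_smul]
      push_cast
      field_simp
      ring
    rw [hval, norm_mul, norm_mul, mul_assoc]
    refine mul_le_mul_of_nonneg_left ?_ (norm_nonneg _)
    have h2pi : 0 < 2 * Real.pi * M := by positivity
    rw [norm_inv, Complex.norm_real, Real.norm_eq_abs, abs_of_pos h2pi,
      inv_mul_le_iff₀ h2pi, mul_comm, ← hvol]
    exact hn
  have hρd : DifferentiableAt ℝ (fun t => (fieldRadius X β γ t : ℂ) ^ y) 0 := by
    have h1 : DifferentiableAt ℝ (fun t => fieldRadius X β γ t) 0 := by
      unfold fieldRadius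
      fun_prop
    have h2 : DifferentiableAt ℝ (fun t => fieldRadius X β γ t ^ y) 0 :=
      h1.zpow (Or.inl (by rw [fieldRadius_zero]; exact hXc))
    have h3 := (Complex.ofRealCLM.differentiable.differentiableAt
      (x := fieldRadius X β γ 0 ^ y)).comp (0 : ℝ) h2
    refine h3.congr_of_eventuallyEq (Eventually.of_forall fun t => ?_)
    simp
  have hbig1 : (fun t => (fieldRadius X β γ t : ℂ) ^ y - (|X| : ℝ) ^ y) =O[𝓝[>] 0]
      fun t : ℝ => t := by
    have h1 := hρd.isBigO_sub
    simp only [fieldRadius_zero, sub_zero] at h1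
    exact h1.mono nhdsWithin_le_nhds
  have hbig2 : (fun t => greenMean P T (fieldRadius X β γ t) t y /
      arcMass ω X ε (fieldRadius X β γ t) t - (fieldRadius X β γ t : ℂ) ^ y * V) =O[𝓝[>] 0]
      fun t : ℝ => t := by
    have h1 : (fun t => (fieldRadius X β γ t : ℂ) ^ y) =O[𝓝[>] 0] fun _ : ℝ => (1 : ℝ) :=
      (hρd.continuousAt.tendsto.mono_left nhdsWithin_le_nhds).isBigO_one ℝ
    have h2 : (fun t => greenMean P T (fieldRadius X β γ t) t y /
        arcMass ω X ε (fieldRadius X β γ t) t - (fieldRadius X β γ t : ℂ) ^ y * V) =O[𝓝[>] 0]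
        fun t : ℝ => (fieldRadius X β γ t : ℂ) ^ y * t := by
      refine IsBigO.of_bound C ?_
      filter_upwards [hkey, self_mem_nhdsWithin] with t ht ht0
      have ht0 : 0 < t := ht0
      rw [norm_mul, Complex.norm_real, Real.norm_eq_abs, abs_of_pos ht0]
      linarith
    refine h2.trans ?_
    have h3 : (fun t : ℝ => (t : ℂ)) =O[𝓝[>] 0] fun t : ℝ => t :=
      IsBigO.of_bound 1 (Eventually.of_forall fun t => by simp)
    simpa using h1.mul h3
  exact (hbig2.add (hbig1.const_mul_left V)).congr_left fun t => by ring

/-- A mean whose integrand has no contribution outside the arc is small, uniformly in `y`. -/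
theorem LocalRoot.exists_bound_greenMean_of_zero (h : LocalRoot P X β ω ε c)
    (hγ : γ ∈ Set.Ioo (-1 : ℝ) 1) {T : ℂ → ℂ → ℂ} {L : ℂ → ℂ} (hT : RootMultiple X ω T L)
    (hT0 : ∀ Z, T Z 0 = 0) :
    ∃ C : ℝ, ∀ᶠ t in 𝓝[>] (0 : ℝ), ∀ y : ℤ,
      ‖greenMean P T (fieldRadius X β γ t) t y‖ ≤ C * t := by
  obtain ⟨C, hC⟩ := h.exists_bound_innerValue hγ hT
  obtain ⟨C₂, hC₂⟩ := (h.arcMass_isBigO γ).bound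
  refine ⟨|C| * C₂, ?_⟩
  filter_upwards [h.eventually_greenMean_eq hγ, hC, hC₂, self_mem_nhdsWithin,
    h.eventually_arcMass_pos hγ] with t ht h1 h2 ht0 hM y
  have ht0 : 0 < t := ht0
  set ρ := fieldRadius X β γ t
  set A := rootArc ω X ε ρ t ∩ Set.Ioc 0 (2 * Real.pi) with hA
  have hfin : volume A < ⊤ := (measure_mono Set.inter_subset_right).trans_lt measure_Ioc_lt_top
  have hint : greenMean P T ρ t y = (2 * Real.pi)⁻¹ •
      ∫ θ in A, circleMap 0 1 θ ^ (-y) * innerValue P T ω X ε ρ t θ := by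
    rw [ht T hT.contDiff, intervalIntegral.integral_of_le (by positivity), hA, Set.inter_comm,
      ← setIntegral_indicator (h.isOpen_rootArc ρ t).measurableSet]
    congr 1
    refine integral_congr_ae (Eventually.of_forall fun θ => ?_)
    by_cases hmem : θ ∈ rootArc ω X ε ρ t
    · simp only [Set.indicator_of_mem hmem]
    · simp only [innerValue, hT0, zero_div, zero_add, Set.indicator_of_notMem hmem, mul_zero]
  have hn : ‖∫ θ in A, circleMap 0 1 θ ^ (-y) * innerValue P T ω X ε ρ t θ‖ ≤
      |C| * volume.real A := by
    refine norm_setIntegral_le_of_norm_le_const_ae hfin (ae_restrict_of_ae ?_)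
    filter_upwards [h1] with θ hθ
    rw [norm_mul, norm_zpow, norm_circleMap_zero]
    simpa using hθ.trans (le_abs_self C)
  rw [Real.norm_eq_abs, Real.norm_eq_abs, abs_of_pos ht0, abs_of_pos hM, arcMass, ← hA] at h2
  rw [hint, norm_smul, norm_inv, Real.norm_eq_abs, abs_of_pos (by positivity)]
  calc (2 * Real.pi)⁻¹ * ‖∫ θ in A, circleMap 0 1 θ ^ (-y) * innerValue P T ω X ε ρ t θ‖
      ≤ (2 * Real.pi)⁻¹ * (|C| * volume.real A) :=
        mul_le_mul_of_nonneg_left hn (by positivity)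
    _ = |C| * ((2 * Real.pi)⁻¹ * volume.real A) := by ring
    _ ≤ |C| * (C₂ * t) := mul_le_mul_of_nonneg_left h2 (abs_nonneg C)
    _ = |C| * C₂ * t := by ring

end GreenMean

/-! ### From lattice entries to torus means, and numerators attached to edges. -/

section Lattice

variable {m n : ℕ}

/-- The index of the fundamental domain jumps exactly at the rows where the Fourier transform places
the factor `z`. -/
theorem ediv_sub_one (m : ℕ) [NeZero m] (I : ℤ) :
    (I - 1) / (m : ℤ) = I / (m : ℤ) - if (I : ZMod m) = 0 then 1 else 0 := by
  have hm : (0 : ℤ) < m := by exact_mod_cast Nat.pos_of_ne_zero (NeZero.ne m)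
  have h1 := Int.emod_add_mul_ediv I m
  have h2 := Int.emod_nonneg I hm.ne'
  have h3 := Int.emod_lt_of_pos I hm
  have h4 : (I : ZMod m) = 0 ↔ I % m = 0 := by
    rw [ZMod.intCast_zmod_eq_zero_iff_dvd, Int.dvd_iff_emod_eq_zero]
  split_ifs with h
  · rw [h4] at h
    refine ((Int.ediv_emod_unique (r := m - 1) hm).2 ⟨?_, by omega, by omega⟩).1
    rw [mul_sub]
    omega
  · rw [h4] at h
    refine ((Int.ediv_emod_unique (r := I % m - 1) hm).2 ⟨?_, by omega, by omega⟩).1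
    rw [sub_zero]
    omega

theorem ediv_add_one (n : ℕ) [NeZero n] (J : ℤ) :
    (J + 1) / (n : ℤ) = J / (n : ℤ) + if (J : ZMod n) + 1 = 0 then 1 else 0 := by
  have h := ediv_sub_one n (J + 1)
  rw [add_sub_cancel_right, Int.cast_add, Int.cast_one] at h
  omega

/-- The coefficient on an edge at a point `(e ^ Bx z, e ^ By w)`, in terms of the translations
between the fundamental domains of its ends. -/
theorem coeff_exp_mul [NeZero m] [NeZero n] (W : Weights m n) (Bx By : ℝ) (e : Edge) (z w : ℂ) :
    coeff W (Real.exp Bx * z) (Real.exp By * w) e.kind (vertexClass m n e.white) =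
      edgeWeight W Bx By e * z ^ (e.row / (m : ℤ) - e.black.1 / (m : ℤ)) *
        w ^ (e.black.2 / (n : ℤ) - e.col / (n : ℤ)) := by
  obtain ⟨I, J, k⟩ := e
  cases k
  · simp [coeff, edgeWeight, Edge.black, Edge.white]
  · simp only [coeff, edgeWeight, Edge.black, Edge.white, vertexClass, ediv_add_one n J, sub_self,
      zpow_zero, mul_one, add_sub_cancel_left]
    by_cases h : (J : ZMod n) + 1 = 0 <;> simp [h, mul_assoc]
  · simp only [coeff, edgeWeight, Edge.black, Edge.white, vertexClass, ediv_sub_one m I, sub_self,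
      zpow_zero, mul_one, sub_sub_cancel]
    by_cases h : (I : ZMod m) = 0 <;> simp [h, mul_assoc]

theorem norm_coeff_exp_mul [NeZero m] [NeZero n] (W : Weights m n) (Bx By : ℝ) (e : Edge)
    {z w : ℂ} (hz : ‖z‖ = 1) (hw : ‖w‖ = 1) :
    ‖coeff W (Real.exp Bx * z) (Real.exp By * w) e.kind (vertexClass m n e.white)‖ =
      |edgeWeight W Bx By e| := by
  rw [coeff_exp_mul W Bx By e]
  simp [hz, hw]

theorem edgeWeight_pos (W : Weights m n) (Bx By : ℝ) (e : Edge) : 0 < edgeWeight W Bx By e := by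
  obtain ⟨I, J, k⟩ := e
  have h1 := Real.exp_pos Bx
  have h2 := Real.exp_pos By
  cases k
  · exact W.a_pos _ _
  · simp only [edgeWeight, coeff]
    split_ifs
    · exact mul_pos (W.b_pos _ _) h2
    · exact mul_pos (W.b_pos _ _) one_pos
  · simp only [edgeWeight, coeff]
    split_ifs
    · exact mul_pos (W.c_pos _ _) h1
    · exact mul_pos (W.c_pos _ _) one_pos

/-- Numerator, for a given edge and a given white vertex, of the inverse Kasteleyn operator
multiplied by the weight of the edge. -/
def edgeNumerator [NeZero m] [NeZero n] (W : Weights m n) (k : EdgeKind)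
    (p b u : ZMod m × ZMod n) (Z w : ℂ) : ℂ :=
  coeff W Z w k p * comatrix W Z w b u

/-- The powers of `z` and `w` due to the edge leaving its domain are absorbed in the coefficient
`K_e(Z, w)`. With the edge based in the column of `u` no power of `w` is left, and the remaining
power of `z` depends only on the white ends. -/
theorem edgeWeight_mul_invKasteleyn [NeZero m] [NeZero n] (W : Weights m n) (Bx : ℝ) {t : ℝ}
    (ht : 0 < t) (e : Edge) (u : ℤ × ℤ) (hcol : e.col = u.2) :
    (edgeWeight W Bx (Real.log t) e : ℂ) * invKasteleyn W Bx (Real.log t) e.black u =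
      greenMean (charPoly W) (edgeNumerator W e.kind (vertexClass m n e.white)
        (vertexClass m n e.black) (vertexClass m n u)) (Real.exp Bx) t
        (e.row / (m : ℤ) - u.1 / (m : ℤ)) := by
  rw [greenMean, Real.circleAverage_eq_circleIntegral one_ne_zero, invKasteleyn, pow_two,
    smul_eq_mul, mul_assoc, mul_left_comm, ← circleIntegral.integral_const_mul,
    ← circleIntegral.integral_const_mul]
  congr 1
  refine circleIntegral.integral_congr (E := ℂ) zero_le_one fun z hz => ?_
  have hz0 : z ≠ 0 := by
    rintro rfl
    simp at hz
  simp only [Real.circleAverage_eq_circleIntegral (F := ℂ) one_ne_zero, smul_eq_mul, sub_zero]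
  rw [← mul_assoc, ← mul_assoc, ← circleIntegral.integral_const_mul,
    ← circleIntegral.integral_const_mul, ← circleIntegral.integral_const_mul]
  refine circleIntegral.integral_congr (E := ℂ) zero_le_one fun w hw => ?_
  have hw0 : w ≠ 0 := by
    rintro rfl
    simp at hw
  have hcoe := coeff_exp_mul W Bx (Real.log t) e z w
  simp only [edgeNumerator]
  rw [← hcol]
  have hlog : ((t : ℝ) : ℂ) = (Real.exp (Real.log t) : ℝ) := by rw [Real.exp_log ht]
  rw [hlog, hcoe]
  have hzp : z ^ (-(e.black.1 / (m : ℤ) - u.1 / (m : ℤ))) =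
      z ^ (-(e.row / (m : ℤ) - u.1 / (m : ℤ))) *
        z ^ (e.row / (m : ℤ) - e.black.1 / (m : ℤ)) := by
    rw [← zpow_add₀ hz0]
    congr 1
    ring
  rw [hzp]
  field_simp

theorem abs_columnRoot [NeZero m] (W : Weights m n) (j : ZMod n) :
    |columnRoot W j| = columnRatio W j := by
  rw [columnRoot, abs_mul, abs_pow, abs_neg, abs_one, one_pow, one_mul,
    abs_of_pos (columnRatio_pos W j)]

theorem exp_tentacleBx [NeZero m] [NeZero n] (W : Weights m n) (j : ZMod n) (γ t : ℝ) :
    Real.exp (tentacleBx W j γ t) = fieldRadius (columnRoot W j) (tentacleBeta W j) γ t := by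
  rw [tentacleBx, Real.exp_add, Real.exp_log (columnRatio_pos W j), fieldRadius, abs_columnRoot]

variable [NeZero m] [NeZero n] {W : Weights m n} {j₁ : ZMod n}

theorem exists_localRoot_charPoly
    (hgen : ∀ j, j ≠ j₁ → columnRatio W j ≠ columnRatio W j₁) :
    ∃ ω ε c, LocalRoot (charPoly W) (columnRoot W j₁) (tentacleBeta W j₁) ω ε c := by
  obtain ⟨p₁, p₂, hp₁, hp₂, hβ, hd₁, hd₂⟩ := exists_partial_derivatives hgen
  refine exists_localRoot (contDiff_charPoly W) (columnRoot_ne_zero W j₁) ?_ ?_ hd₁ hd₂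
    (Complex.ofReal_ne_zero.2 hp₁) (Complex.ofReal_ne_zero.2 hp₂) (by rw [hβ]; push_cast; ring)
  · intro Z hZ hne
    refine charPoly_ne_zero W ?_ fun j h => ?_
    · intro h0
      rw [h0, norm_zero] at hZ
      exact abs_ne_zero.2 (columnRoot_ne_zero W j₁) hZ.symm
    · rcases eq_or_ne j j₁ with rfl | hj
      · exact hne h
      · refine hgen j hj ?_
        rw [← abs_columnRoot, ← abs_columnRoot W j₁, ← hZ, h]
        simp
  · have h1 := det_cutKasteleyn_columnRoot W j₁ 0
    rw [det_cutKasteleyn] at h1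
    have h2 := Complex.ofRealHom.map_det (kasteleyn W (columnRoot W j₁) (0 : ℝ))
    have h3 : Complex.ofRealHom.mapMatrix (kasteleyn W (columnRoot W j₁) (0 : ℝ)) =
        kasteleyn W (columnRoot W j₁ : ℂ) (0 : ℂ) := by
      ext p q
      have h4 := congrFun (congrFun (cutKasteleyn_map Complex.ofRealAm 0 W (columnRoot W j₁) 0) p) q
      rw [map_zero] at h4
      exact h4
    rw [h3] at h2
    rw [charPoly, ← h2, ← charPoly, h1, map_zero]

/-- Right factor of the adjugate on the zero set, as a function of the black vertex. -/
def blackFactor (W : Weights m n) (j₁ : ZMod n) (b : ZMod m × ZMod n) (Z w : ℂ) : ℂ :=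
  (cutKasteleyn (j₁ + 1) W Z w).adjugate b (0, j₁)

/-- Left factor of the adjugate on the zero set, as a function of the white vertex. -/
def whiteFactor (W : Weights m n) (j₁ : ZMod n) (u : ZMod m × ZMod n) (Z w : ℂ) : ℂ :=
  (cutKasteleyn j₁ W Z w).adjugate (0, j₁) u

theorem contDiff_blackFactor (W : Weights m n) (j₁ : ZMod n) (b : ZMod m × ZMod n) :
    ContDiff ℂ ⊤ fun x : ℂ × ℂ => blackFactor W j₁ b x.1 x.2 :=
  contDiff_cut_adjugate (j₁ + 1) W b (0, j₁)

theorem contDiff_whiteFactor (W : Weights m n) (j₁ : ZMod n) (u : ZMod m × ZMod n) :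
    ContDiff ℂ ⊤ fun x : ℂ × ℂ => whiteFactor W j₁ u x.1 x.2 :=
  contDiff_cut_adjugate j₁ W (0, j₁) u

theorem blackFactor_ne_zero (hgen : ∀ j, j ≠ j₁ → columnRatio W j ≠ columnRatio W j₁)
    (b : ZMod m × ZMod n) : blackFactor W j₁ b (columnRoot W j₁ : ℝ) 0 ≠ 0 := by
  have h := cut_adjugate_ofReal (j₁ + 1) W (columnRoot W j₁) 0 b (0, j₁)
  rw [Complex.ofReal_zero] at h
  rw [blackFactor, h]
  exact Complex.ofReal_ne_zero.2 (cut_adjugate_right_ne_zero hgen b 0)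

theorem whiteFactor_ne_zero (hgen : ∀ j, j ≠ j₁ → columnRatio W j ≠ columnRatio W j₁)
    (u : ZMod m × ZMod n) : whiteFactor W j₁ u (columnRoot W j₁ : ℝ) 0 ≠ 0 := by
  have h := cut_adjugate_ofReal j₁ W (columnRoot W j₁) 0 (0, j₁) u
  rw [Complex.ofReal_zero] at h
  rw [whiteFactor, h]
  exact Complex.ofReal_ne_zero.2 (cut_adjugate_left_ne_zero hgen 0 u)

theorem LocalRoot.differentiableAt_comp {P : ℂ → ℂ → ℂ} {X β : ℝ} {ω : ℂ → ℂ} {ε c : ℝ}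
    (h : LocalRoot P X β ω ε c) {g : ℂ → ℂ → ℂ}
    (hg : ContDiff ℂ ⊤ fun x : ℂ × ℂ => g x.1 x.2) :
    DifferentiableAt ℂ (fun Z => g Z (ω Z)) X :=
  DifferentiableAt.comp (g := fun x : ℂ × ℂ => g x.1 x.2) (f := fun Z => (Z, ω Z)) (X : ℂ)
    (hg.differentiable (by simp) _)
    (differentiableAt_id.prodMk (h.differentiableAt X (by simpa using h.ε_pos)))

theorem RootMultiple.mul_left {P : ℂ → ℂ → ℂ} {X β : ℝ} {ω : ℂ → ℂ} {ε c : ℝ}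
    (h : LocalRoot P X β ω ε c) {g T : ℂ → ℂ → ℂ} {L : ℂ → ℂ} (hT : RootMultiple X ω T L)
    (hg : ContDiff ℂ ⊤ fun x : ℂ × ℂ => g x.1 x.2) :
    RootMultiple X ω (fun Z w => g Z w * T Z w) fun Z => g Z (ω Z) * L Z where
  contDiff := hg.mul hT.contDiff
  eq_mul := hT.eq_mul.mono fun Z hZ => by rw [hZ]; ring
  differentiableAt := (h.differentiableAt_comp hg).mul hT.differentiableAt

variable {β : ℝ} {ω : ℂ → ℂ} {ε c γ : ℝ}

/-- The factorized form on the zero set of the adjugate divided by `w`. -/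
def rootKernel (W : Weights m n) (j₁ : ZMod n) (ω : ℂ → ℂ) (b u : ZMod m × ZMod n) (Z : ℂ) : ℂ :=
  blackFactor W j₁ b Z (ω Z) * whiteFactor W j₁ u Z (ω Z) / whiteFactor W j₁ (0, j₁) Z (ω Z)

theorem LocalRoot.eventually_root_ne_zero {P : ℂ → ℂ → ℂ} {X β : ℝ}
    (h : LocalRoot P X β ω ε c) : ∀ᶠ Z in 𝓝[≠] (X : ℂ), P Z (ω Z) = 0 ∧ ω Z ≠ 0 := by
  have h1 : ∀ᶠ Z in 𝓝 (X : ℂ), ‖ω Z‖ < ε := by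
    have h2 := h.hasDerivAt.continuousAt.norm.tendsto
    rw [h.root_self, norm_zero] at h2
    exact h2.eventually (gt_mem_nhds h.ε_pos)
  filter_upwards [h1.filter_mono nhdsWithin_le_nhds, self_mem_nhdsWithin,
    mem_nhdsWithin_of_mem_nhds (Metric.ball_mem_nhds _ h.ε_pos)] with Z hω hZ hball
  have hball := mem_ball_iff_norm.1 hball
  refine ⟨(h.root_iff Z (ω Z) hball hω).2 rfl, fun h0 => ?_⟩
  have h4 := h.lower Z hball
  rw [h0, norm_zero] at h4
  exact absurd h4 (not_le.2 (mul_pos h.c_pos (norm_pos_iff.2 (sub_ne_zero.2 hZ))))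

theorem differentiableAt_rootKernel
    (h : LocalRoot (charPoly W) (columnRoot W j₁) β ω ε c)
    (hgen : ∀ j, j ≠ j₁ → columnRatio W j ≠ columnRatio W j₁) (b u : ZMod m × ZMod n) :
    DifferentiableAt ℂ (rootKernel W j₁ ω b u) (columnRoot W j₁ : ℝ) := by
  refine ((h.differentiableAt_comp (contDiff_blackFactor W j₁ b)).mul
    (h.differentiableAt_comp (contDiff_whiteFactor W j₁ u))).div
    (h.differentiableAt_comp (contDiff_whiteFactor W j₁ (0, j₁))) ?_
  rw [h.root_self]
  exact whiteFactor_ne_zero hgen _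

theorem eventually_whiteFactor_ne_zero
    (h : LocalRoot (charPoly W) (columnRoot W j₁) β ω ε c)
    (hgen : ∀ j, j ≠ j₁ → columnRatio W j ≠ columnRatio W j₁) (u : ZMod m × ZMod n) :
    ∀ᶠ Z in 𝓝 ((columnRoot W j₁ : ℝ) : ℂ), whiteFactor W j₁ u Z (ω Z) ≠ 0 := by
  refine (h.differentiableAt_comp (contDiff_whiteFactor W j₁ u)).continuousAt.eventually_ne ?_
  rw [h.root_self]
  exact whiteFactor_ne_zero hgen _

/-- On the graph the factor `w` of the rank one factorization is `ω(Z)`. The factorization needs `w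
≠ 0`, so the identity is claimed off `X` only. -/
theorem rootMultiple_comatrix (h : LocalRoot (charPoly W) (columnRoot W j₁) β ω ε c)
    (hgen : ∀ j, j ≠ j₁ → columnRatio W j ≠ columnRatio W j₁) {b u : ZMod m × ZMod n}
    (hb : b.2 = u.2) (hj : u.2 ≠ j₁) :
    RootMultiple (columnRoot W j₁) ω (fun Z w => comatrix W Z w b u)
      (rootKernel W j₁ ω b u) where
  contDiff := contDiff_cut_adjugate 0 W b u
  eq_mul := by
    filter_upwards [h.eventually_root_ne_zero,
      (eventually_whiteFactor_ne_zero h hgen (0, j₁)).filter_mono nhdsWithin_le_nhds]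
      with Z hZ hne
    have h1 := comatrix_of_root_same_column (j₁ := j₁) hZ.1 hZ.2 hb (hb ▸ hj)
    rw [rootKernel, ← mul_div_assoc, eq_div_iff hne, mul_comm]
    exact h1
  differentiableAt := differentiableAt_rootKernel h hgen b u

theorem rootMultiple_next_column (h : LocalRoot (charPoly W) (columnRoot W j₁) β ω ε c)
    (hgen : ∀ j, j ≠ j₁ → columnRatio W j ≠ columnRatio W j₁) {b u : ZMod m × ZMod n}
    (hb : b.2 = u.2 + 1) (hj : u.2 ≠ j₁) :
    RootMultiple (columnRoot W j₁) ω (fun Z w => w * (cutKasteleyn (u.2 + 1) W Z w).adjugate b u)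
      (rootKernel W j₁ ω b u) where
  contDiff := contDiff_snd.mul (contDiff_cut_adjugate (u.2 + 1) W b u)
  eq_mul := by
    filter_upwards [h.eventually_root_ne_zero,
      (eventually_whiteFactor_ne_zero h hgen (0, j₁)).filter_mono nhdsWithin_le_nhds]
      with Z hZ hne
    have h1 := cut_adjugate_of_root_next_column (j₁ := j₁) hZ.1 hZ.2 hb hj
    congr 1
    rw [rootKernel, eq_div_iff hne, mul_comm]
    exact h1
  differentiableAt := differentiableAt_rootKernel h hgen b u

omit [NeZero m] [NeZero n] in
theorem contDiff_coeff (W : Weights m n) (k : EdgeKind) (p : ZMod m × ZMod n) :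
    ContDiff ℂ ⊤ fun x : ℂ × ℂ => coeff W x.1 x.2 k p := by
  cases k <;> simp only [coeff] <;> (try split_ifs) <;> fun_prop

theorem rootMultiple_edgeNumerator (h : LocalRoot (charPoly W) (columnRoot W j₁) β ω ε c)
    (hgen : ∀ j, j ≠ j₁ → columnRatio W j ≠ columnRatio W j₁) (k : EdgeKind)
    (p : ZMod m × ZMod n) {b u : ZMod m × ZMod n} (hb : b.2 = u.2) (hj : u.2 ≠ j₁) :
    RootMultiple (columnRoot W j₁) ω (edgeNumerator W k p b u)
      fun Z => coeff W Z (ω Z) k p * rootKernel W j₁ ω b u Z :=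
  (rootMultiple_comatrix h hgen hb hj).mul_left h (contDiff_coeff W k p)

/-- The identity with the cut moved holds for `w ≠ 0` and extends by continuity; it shows that the
numerator vanishes at `w = 0`, so that a crossing entry has only its arc contribution. -/
theorem edgeNumerator_b_eq (W : Weights m n) {b u : ZMod m × ZMod n} (hb : b.2 = u.2 + 1)
    (i : ZMod m) : edgeNumerator W .b (i, u.2) b u =
      fun Z w => (W.b i u.2 : ℂ) * (w * (cutKasteleyn (u.2 + 1) W Z w).adjugate b u) := by
  funext Z
  have h1 : Continuous (edgeNumerator W .b (i, u.2) b u Z) :=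
    ((contDiff_coeff W .b (i, u.2)).continuous.mul
      (contDiff_cut_adjugate 0 W b u).continuous).comp (Continuous.prodMk_right Z)
  have h3 : Continuous fun w : ℂ => (cutKasteleyn (u.2 + 1) W Z w).adjugate b u :=
    Continuous.comp (f := fun w : ℂ => (Z, w))
      (g := fun x : ℂ × ℂ => (cutKasteleyn (u.2 + 1) W x.1 x.2).adjugate b u)
      (contDiff_cut_adjugate (u.2 + 1) W b u).continuous (Continuous.prodMk_right Z)
  have h2 : Continuous fun w : ℂ =>
      (W.b i u.2 : ℂ) * (w * (cutKasteleyn (u.2 + 1) W Z w).adjugate b u) :=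
    continuous_const.mul (continuous_id.mul h3)
  refine Continuous.ext_on (dense_compl_singleton (0 : ℂ)) h1 h2 fun w hw => ?_
  simp only [edgeNumerator]
  rw [coeff_b_mul_comatrix W Z hw hb i, mul_assoc]

theorem rootMultiple_edgeNumerator_b (h : LocalRoot (charPoly W) (columnRoot W j₁) β ω ε c)
    (hgen : ∀ j, j ≠ j₁ → columnRatio W j ≠ columnRatio W j₁) (i : ZMod m)
    {b u : ZMod m × ZMod n} (hb : b.2 = u.2 + 1) (hj : u.2 ≠ j₁) :
    RootMultiple (columnRoot W j₁) ω (edgeNumerator W .b (i, u.2) b u)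
      fun Z => W.b i u.2 * rootKernel W j₁ ω b u Z := by
  rw [edgeNumerator_b_eq W hb i]
  exact (rootMultiple_next_column h hgen hb hj).mul_left h
    (g := fun _ _ => (W.b i u.2 : ℂ)) contDiff_const

/-- The numerators of the three edges at a white vertex add up to the characteristic
polynomial. -/
theorem edgeNumerator_sum (W : Weights m n) (p u : ZMod m × ZMod n) (Z w : ℂ) :
    edgeNumerator W .a p p u Z w + edgeNumerator W .b p (p.1, p.2 + 1) u Z w +
      edgeNumerator W .c p (p.1 - 1, p.2) u Z w = if p = u then charPoly W Z w else 0 := by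
  have h1 := congrFun (congrFun (Matrix.mul_adjugate (kasteleyn W Z w)) p) u
  rw [Matrix.smul_apply, Matrix.one_apply, smul_eq_mul, mul_ite, mul_one, mul_zero] at h1
  rw [charPoly, ← h1, Matrix.mul_apply]
  simp only [kasteleyn, Matrix.of_apply, add_mul, ite_mul, zero_mul, Finset.sum_add_distrib,
    Finset.sum_ite_eq', Finset.mem_univ, if_true]
  rfl

end Lattice

/-! ### Perturbed contracting recursions. -/

section Decay

theorem le_prod_mul_add {G k : ℕ → ℝ} {K e : ℝ} (hk0 : ∀ l, 0 ≤ k l)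
    (hkK : ∀ l, k l ≤ K) (hK : 1 ≤ K) (he : 0 ≤ e) (hrec : ∀ l, G l ≤ k l * G (l + 1) + e)
    (N l : ℕ) : G l ≤ (∏ i ∈ Finset.range N, k (l + i)) * G (l + N) + N * K ^ N * e := by
  induction N with
  | zero => simp
  | succ N ih =>
    have h1 : 0 ≤ ∏ i ∈ Finset.range N, k (l + i) := Finset.prod_nonneg fun i _ => hk0 _
    have h2 : ∏ i ∈ Finset.range N, k (l + i) ≤ K ^ N := by
      have := Finset.prod_le_prod (s := Finset.range N) (fun i _ => hk0 (l + i))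
        fun i _ => hkK (l + i)
      simpa using this
    have h3 := mul_le_mul_of_nonneg_left (hrec (l + N)) h1
    have h4 : K ^ N ≤ K ^ (N + 1) := pow_le_pow_right₀ hK (Nat.le_succ N)
    have h5 : (∏ i ∈ Finset.range N, k (l + i)) * e ≤ K ^ (N + 1) * e :=
      mul_le_mul_of_nonneg_right (h2.trans h4) he
    have h6 : N * K ^ N * e ≤ N * K ^ (N + 1) * e :=
      mul_le_mul_of_nonneg_right (mul_le_mul_of_nonneg_left h4 (Nat.cast_nonneg N)) he
    rw [Finset.prod_range_succ, ← add_assoc]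
    push_cast
    linarith

/-- Iterating `p` periods leaves `q ^ p` times a bounded quantity, which disappears as `p → ∞`; the
bound is then the sum of a geometric series, free of `B`. -/
theorem le_div_of_contraction {G : ℕ → ℝ} {q e B : ℝ} {m : ℕ} (hq0 : 0 ≤ q) (hq1 : q < 1)
    (hrec : ∀ l, G l ≤ q * G (l + m) + e) (hB : ∀ l, G l ≤ B) (l : ℕ) : G l ≤ e / (1 - q) := by
  have hstep : ∀ p : ℕ, ∀ l, G l ≤ e / (1 - q) + q ^ p * (B - e / (1 - q)) := by
    have hq : 1 - q ≠ 0 := by linarith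
    intro p
    induction p with
    | zero =>
      intro l
      simpa using hB l
    | succ p ih =>
      intro l
      refine (hrec l).trans ?_
      have h1 := mul_le_mul_of_nonneg_left (ih (l + m)) hq0
      have h2 : q * (e / (1 - q)) + e = e / (1 - q) := by field_simp; ring
      rw [pow_succ]
      linarith
  have hlim : Tendsto (fun p : ℕ => e / (1 - q) + q ^ p * (B - e / (1 - q))) atTop
      (𝓝 (e / (1 - q) + 0 * (B - e / (1 - q)))) :=
    tendsto_const_nhds.add ((tendsto_pow_atTop_nhds_zero_of_lt_one hq0 hq1).mul_const _)
  rw [zero_mul, add_zero] at hlim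
  exact ge_of_tendsto' hlim fun p => hstep p l

/-- A bounded solution of a periodic first order recursion which is contracting over a period is of
the order of the inhomogeneity. -/
theorem isBigO_of_recursion {m : ℕ} [NeZero m] {G : ℝ → ℕ → ℝ} {κ : ℝ → ZMod m → ℝ}
    {κ₀ : ZMod m → ℝ} {s : ℕ → ZMod m} {B C : ℝ} (hG : ∀ t l, 0 ≤ G t l)
    (hκ0 : ∀ t i, 0 ≤ κ t i) (hκ : ∀ i, Tendsto (fun t => κ t i) (𝓝[>] 0) (𝓝 (κ₀ i)))
    (hprod : ∏ i, κ₀ i < 1)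
    (hs : ∀ (f : ZMod m → ℝ) (l : ℕ), ∏ i ∈ Finset.range m, f (s (l + i)) = ∏ i, f i)
    (hrec : ∀ᶠ t in 𝓝[>] (0 : ℝ), ∀ l, G t l ≤ κ t (s l) * G t (l + 1) + C * t)
    (hB : ∀ᶠ t in 𝓝[>] (0 : ℝ), ∀ l, G t l ≤ B) (l : ℕ) :
    (fun t => G t l) =O[𝓝[>] 0] fun t : ℝ => t := by
  have hκ₀ : ∀ i, 0 ≤ κ₀ i := fun i => ge_of_tendsto' (hκ i) fun t => hκ0 t i
  set p := ∏ i, κ₀ i with hp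
  have hp0 : 0 ≤ p := Finset.prod_nonneg fun i _ => hκ₀ i
  -- A contraction factor strictly between the limiting product and `1`, valid for all small `t`.
  set q := (p + 1) / 2 with hq
  set K := 1 + ∑ i, (κ₀ i + 1) with hK
  have hq1 : ∀ᶠ t in 𝓝[>] (0 : ℝ), ∏ i, κ t i < q :=
    (tendsto_finsetProd Finset.univ fun i _ => hκ i).eventually (gt_mem_nhds (by linarith))
  have hKt : ∀ᶠ t in 𝓝[>] (0 : ℝ), ∀ i, κ t i < κ₀ i + 1 :=
    eventually_all.2 fun i => (hκ i).eventually (gt_mem_nhds (lt_add_one _))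
  have hKi : ∀ i, κ₀ i + 1 ≤ K := by
    intro i
    have h1 := Finset.single_le_sum (f := fun i => κ₀ i + 1)
      (fun i _ => add_nonneg (hκ₀ i) zero_le_one) (Finset.mem_univ i)
    linarith
  have hK1 : 1 ≤ K := by linarith [hκ₀ 0, hKi 0]
  refine IsBigO.of_bound (m * K ^ m * |C| / (1 - q)) ?_
  filter_upwards [hrec, hB, hq1, hKt, self_mem_nhdsWithin] with t h1 h2 h3 h4 ht
  have ht : 0 < t := ht
  have h5 : ∀ l, G t l ≤ κ t (s l) * G t (l + 1) + |C| * t := fun l =>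
    (h1 l).trans (add_le_add_right (mul_le_mul_of_nonneg_right (le_abs_self C) ht.le) _)
  have h6 : ∀ l, G t l ≤ q * G t (l + m) + m * K ^ m * (|C| * t) := by
    intro l
    have h7 := le_prod_mul_add (k := fun l => κ t (s l)) (fun l => hκ0 t _)
      (fun l => (h4 _).le.trans (hKi _)) hK1 (by positivity) h5 m l
    rw [hs] at h7
    exact h7.trans (add_le_add_left (mul_le_mul_of_nonneg_right h3.le (hG t _)) _)
  have h7 := le_div_of_contraction (by linarith) (by linarith) h6 h2 l
  rw [Real.norm_eq_abs, Real.norm_eq_abs, abs_of_pos ht, abs_of_nonneg (hG t l)]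
  refine h7.trans (le_of_eq ?_)
  ring

end Decay

/-! ### The inverse operator along a column other than `j₁`. -/

section ColumnGreen

variable {m n : ℕ} [NeZero m] [NeZero n] {W : Weights m n} {j₁ : ZMod n} {γ : ℝ}

/-- The bound on the mean is uniform in the row translation, so finitely many classes suffice.
Multiplying by the weight of the `a`-edge costs nothing, as it does not depend on the field. -/
theorem exists_bound_column (hgen : ∀ j, j ≠ j₁ → columnRatio W j ≠ columnRatio W j₁)
    (hγ : γ ∈ Set.Ioo (-1 : ℝ) 1) {J : ℤ} (hJ : (J : ZMod n) ≠ j₁) :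
    ∃ B : ℝ, ∀ᶠ t in 𝓝[>] (0 : ℝ), ∀ I I' : ℤ,
      ‖invKasteleyn W (tentacleBx W j₁ γ t) (Real.log t) (I, J) (I', J)‖ ≤ B := by
  obtain ⟨ω, ε, c, h⟩ := exists_localRoot_charPoly hgen
  have h1 := fun q : ZMod m × ZMod m => h.exists_bound_greenMean hγ
    (rootMultiple_edgeNumerator h hgen .a (q.1, (J : ZMod n)) (b := (q.1, J)) (u := (q.2, J))
      rfl hJ)
  choose C hC using h1
  refine ⟨∑ q : ZMod m × ZMod m, |C q| / W.a q.1 J, ?_⟩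
  filter_upwards [eventually_all.2 hC, self_mem_nhdsWithin] with t ht ht0 I I'
  have h2 := edgeWeight_mul_invKasteleyn W (tentacleBx W j₁ γ t) ht0 ⟨I, J, .a⟩ (I', J) rfl
  have h3 := ht ((I : ZMod m), (I' : ZMod m)) (I / m - I' / m)
  rw [exp_tentacleBx] at h2
  have h4 : edgeWeight W (tentacleBx W j₁ γ t) (Real.log t) ⟨I, J, .a⟩ = W.a I J := rfl
  have ha := W.a_pos I J
  have h5 : W.a I J * ‖invKasteleyn W (tentacleBx W j₁ γ t) (Real.log t) (I, J) (I', J)‖ ≤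
      |C (I, I')| := by
    have h6 := congrArg norm h2
    rw [norm_mul, h4, Complex.norm_real, Real.norm_eq_abs, abs_of_pos ha] at h6
    rw [show (I, J) = (Edge.mk I J .a).black from rfl, h6]
    exact h3.trans (le_abs_self _)
  have h6 : ‖invKasteleyn W (tentacleBx W j₁ γ t) (Real.log t) (I, J) (I', J)‖ ≤
      |C (I, I')| / W.a I J := by
    rw [le_div_iff₀ ha]
    linarith
  exact h6.trans (Finset.single_le_sum (f := fun q : ZMod m × ZMod m => |C q| / W.a q.1 J)
    (fun q _ => div_nonneg (abs_nonneg _) (W.a_pos _ _).le) (Finset.mem_univ ((I : ZMod m), (I' : ZMod m))))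

/-- The numerator of a `b`-edge vanishes at `w = 0`, so this is a bounded integrand over an arc of
length `O(t)`. -/
theorem exists_bound_crossing (hgen : ∀ j, j ≠ j₁ → columnRatio W j ≠ columnRatio W j₁)
    (hγ : γ ∈ Set.Ioo (-1 : ℝ) 1) {J : ℤ} (hJ : (J : ZMod n) ≠ j₁) :
    ∃ C : ℝ, ∀ᶠ t in 𝓝[>] (0 : ℝ), ∀ I I' : ℤ,
      ‖(edgeWeight W (tentacleBx W j₁ γ t) (Real.log t) ⟨I, J, .b⟩ : ℂ) *
        invKasteleyn W (tentacleBx W j₁ γ t) (Real.log t) (I, J + 1) (I', J)‖ ≤ C * t := by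
  obtain ⟨ω, ε, c, h⟩ := exists_localRoot_charPoly hgen
  have h1 := fun q : ZMod m × ZMod m => h.exists_bound_greenMean_of_zero hγ
    (rootMultiple_edgeNumerator_b h hgen q.1 (b := (q.1, (J : ZMod n) + 1)) (u := (q.2, J))
      rfl hJ) (fun Z => by rw [edgeNumerator_b_eq W rfl]; ring)
  choose C hC using h1
  refine ⟨∑ q : ZMod m × ZMod m, |C q|, ?_⟩
  filter_upwards [eventually_all.2 hC, self_mem_nhdsWithin] with t ht ht0 I I'
  have ht1 : 0 < t := ht0
  have h2 := edgeWeight_mul_invKasteleyn W (tentacleBx W j₁ γ t) ht0 ⟨I, J, .b⟩ (I', J) rfl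
  have h3 := ht ((I : ZMod m), (I' : ZMod m)) (I / m - I' / m)
  rw [exp_tentacleBx] at h2
  have h4 : vertexClass m n (I, J + 1) = ((I : ZMod m), (J : ZMod n) + 1) := by
    simp [vertexClass]
  rw [show (Edge.mk I J .b).black = (I, J + 1) from rfl, h4] at h2
  rw [h2]
  have h5 := Finset.single_le_sum (f := fun q : ZMod m × ZMod m => |C q|)
    (fun q _ => abs_nonneg _) (Finset.mem_univ ((I : ZMod m), (I' : ZMod m)))
  exact h3.trans (mul_le_mul_of_nonneg_right ((le_abs_self _).trans h5) ht1.le)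

/-- The inverse Kasteleyn operator is a right inverse along a column. -/
theorem eventually_column_equation
    (hgen : ∀ j, j ≠ j₁ → columnRatio W j ≠ columnRatio W j₁)
    (hγ : γ ∈ Set.Ioo (-1 : ℝ) 1) {J : ℤ} (hJ : (J : ZMod n) ≠ j₁) :
    ∀ᶠ t in 𝓝[>] (0 : ℝ), ∀ I I' : ℤ,
      (edgeWeight W (tentacleBx W j₁ γ t) (Real.log t) ⟨I, J, .a⟩ : ℂ) *
        invKasteleyn W (tentacleBx W j₁ γ t) (Real.log t) (I, J) (I', J) +
      (edgeWeight W (tentacleBx W j₁ γ t) (Real.log t) ⟨I, J, .b⟩ : ℂ) *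
        invKasteleyn W (tentacleBx W j₁ γ t) (Real.log t) (I, J + 1) (I', J) +
      (edgeWeight W (tentacleBx W j₁ γ t) (Real.log t) ⟨I, J, .c⟩ : ℂ) *
        invKasteleyn W (tentacleBx W j₁ γ t) (Real.log t) (I - 1, J) (I', J) =
      if I = I' then 1 else 0 := by
  obtain ⟨ω, ε, c, h⟩ := exists_localRoot_charPoly hgen
  have ha := fun q : ZMod m × ZMod m =>
    rootMultiple_edgeNumerator h hgen .a (q.1, (J : ZMod n)) (b := (q.1, J)) (u := (q.2, J))
      rfl hJ
  have hb := fun q : ZMod m × ZMod m =>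
    rootMultiple_edgeNumerator_b h hgen q.1 (b := (q.1, (J : ZMod n) + 1)) (u := (q.2, J))
      rfl hJ
  have hc := fun q : ZMod m × ZMod m =>
    rootMultiple_edgeNumerator h hgen .c (q.1, (J : ZMod n)) (b := (q.1 - 1, J)) (u := (q.2, J))
      rfl hJ
  have h1 := fun q => h.eventually_greenMean_add hγ (ha q) (hb q)
  have h2 := fun q => h.eventually_greenMean_add hγ ((ha q).add (hb q)) (hc q)
  filter_upwards [eventually_all.2 h1, eventually_all.2 h2, h.eventually_greenMean_self hγ,
    self_mem_nhdsWithin] with t ht1 ht2 ht3 ht0 I I'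
  have ea := edgeWeight_mul_invKasteleyn W (tentacleBx W j₁ γ t) ht0 ⟨I, J, .a⟩ (I', J) rfl
  have eb := edgeWeight_mul_invKasteleyn W (tentacleBx W j₁ γ t) ht0 ⟨I, J, .b⟩ (I', J) rfl
  have ec := edgeWeight_mul_invKasteleyn W (tentacleBx W j₁ γ t) ht0 ⟨I, J, .c⟩ (I', J) rfl
  rw [exp_tentacleBx] at ea eb ec
  have h4 : vertexClass m n (I, J + 1) = ((I : ZMod m), (J : ZMod n) + 1) := by
    simp [vertexClass]
  have h5 : vertexClass m n (I - 1, J) = ((I : ZMod m) - 1, (J : ZMod n)) := by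
    simp [vertexClass]
  rw [show (Edge.mk I J .b).black = (I, J + 1) from rfl, h4] at eb
  rw [show (Edge.mk I J .c).black = (I - 1, J) from rfl, h5] at ec
  have e1 := ht1 ((I : ZMod m), (I' : ZMod m)) (I / m - I' / m)
  have e2 := ht2 ((I : ZMod m), (I' : ZMod m)) (I / m - I' / m)
  simp only at e1 e2
  rw [e1] at e2
  have e3 : (fun Z w => edgeNumerator W .a ((I : ZMod m), (J : ZMod n)) ((I : ZMod m), J)
      ((I' : ZMod m), J) Z w +
      edgeNumerator W .b ((I : ZMod m), (J : ZMod n)) ((I : ZMod m), (J : ZMod n) + 1)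
        ((I' : ZMod m), J) Z w +
      edgeNumerator W .c ((I : ZMod m), (J : ZMod n)) ((I : ZMod m) - 1, J)
        ((I' : ZMod m), J) Z w) =
      fun Z w : ℂ => if (I : ZMod m) = (I' : ZMod m) then charPoly W Z w else 0 := by
    funext Z w
    have := edgeNumerator_sum W ((I : ZMod m), (J : ZMod n)) ((I' : ZMod m), (J : ZMod n)) Z w
    simpa using this
  rw [e3] at e2
  have hea : (edgeWeight W (tentacleBx W j₁ γ t) (Real.log t) ⟨I, J, .a⟩ : ℂ) *
      invKasteleyn W (tentacleBx W j₁ γ t) (Real.log t) (I, J) (I', J) = _ := ea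
  rw [hea, eb, ec]
  refine e2.symm.trans ?_
  by_cases hI : (I : ZMod m) = (I' : ZMod m)
  · simp only [hI, if_true]
    rw [show (fun Z w : ℂ => charPoly W Z w) = charPoly W from rfl, ht3]
    -- Within one class modulo `m`, rows are equal exactly when their translations are.
    refine if_congr ?_ rfl rfl
    have hmod : I % m = I' % m := (ZMod.intCast_eq_intCast_iff I I' m).1 hI
    have d1 := Int.emod_add_mul_ediv I m
    have d2 := Int.emod_add_mul_ediv I' m
    constructor
    · intro h0
      have h6 : I / (m : ℤ) = I' / (m : ℤ) := by omega
      rw [← d1, ← d2, hmod, h6]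
    · rintro rfl
      ring
  · have hne : I ≠ I' := fun h0 => hI (by rw [h0])
    simp only [hI, if_false, hne]
    simp [greenMean, Real.circleAverage_const]

end ColumnGreen

/-! ### Decay of the inverse operator in a frozen column. -/

section ColumnDecay

theorem isBigO_of_weighted_recursion {m : ℕ} [NeZero m] {G : ℝ → ℕ → ℝ} {d ν : ℝ → ZMod m → ℝ}
    {d₀ ν₀ : ZMod m → ℝ} {s : ℕ → ZMod m} {B C : ℝ} (hG : ∀ t l, 0 ≤ G t l)
    (hd : ∀ t i, 0 < d t i) (hν : ∀ t i, 0 < ν t i) (hd₀ : ∀ i, 0 < d₀ i)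
    (hdt : ∀ i, Tendsto (fun t => d t i) (𝓝[>] 0) (𝓝 (d₀ i)))
    (hνt : ∀ i, Tendsto (fun t => ν t i) (𝓝[>] 0) (𝓝 (ν₀ i)))
    (hprod : ∏ i, ν₀ i < ∏ i, d₀ i)
    (hs : ∀ (f : ZMod m → ℝ) (l : ℕ), ∏ i ∈ Finset.range m, f (s (l + i)) = ∏ i, f i)
    (hrec : ∀ᶠ t in 𝓝[>] (0 : ℝ), ∀ l, d t (s l) * G t l ≤ ν t (s l) * G t (l + 1) + C * t)
    (hB : ∀ᶠ t in 𝓝[>] (0 : ℝ), ∀ l, G t l ≤ B) (l : ℕ) :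
    (fun t => G t l) =O[𝓝[>] 0] fun t : ℝ => t := by
  have hinv : ∀ᶠ t in 𝓝[>] (0 : ℝ), ∀ i, (d t i)⁻¹ < (d₀ i)⁻¹ + 1 :=
    eventually_all.2 fun i => ((hdt i).inv₀ (hd₀ i).ne').eventually (gt_mem_nhds (lt_add_one _))
  refine isBigO_of_recursion (κ := fun t i => ν t i / d t i) (κ₀ := fun i => ν₀ i / d₀ i) (s := s)
    (B := B) (C := |C| * ∑ i, ((d₀ i)⁻¹ + 1)) hG (fun t i => (div_pos (hν t i) (hd t i)).le)
    (fun i => (hνt i).div (hdt i) (hd₀ i).ne') ?_ hs ?_ hB l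
  · rw [Finset.prod_div_distrib, div_lt_one (Finset.prod_pos fun i _ => hd₀ i)]
    exact hprod
  · filter_upwards [hrec, hinv, self_mem_nhdsWithin] with t h1 h2 ht l
    have ht : 0 < t := ht
    have h3 := Finset.single_le_sum (f := fun i => (d₀ i)⁻¹ + 1)
      (fun i _ => add_nonneg (inv_nonneg.2 (hd₀ i).le) zero_le_one) (Finset.mem_univ (s l))
    have h4 : (d t (s l))⁻¹ ≤ ∑ i, ((d₀ i)⁻¹ + 1) := (h2 _).le.trans h3
    have h5 := mul_le_mul_of_nonneg_left (h1 l) (inv_nonneg.2 (hd t (s l)).le)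
    rw [inv_mul_cancel_left₀ (hd t (s l)).ne'] at h5
    refine h5.trans ?_
    have h6 : (d t (s l))⁻¹ * (C * t) ≤ (∑ i, ((d₀ i)⁻¹ + 1)) * (|C| * t) :=
      (mul_le_mul_of_nonneg_left (mul_le_mul_of_nonneg_right (le_abs_self C) ht.le)
        (inv_nonneg.2 (hd t (s l)).le)).trans
        (mul_le_mul_of_nonneg_right h4 (mul_nonneg (abs_nonneg C) ht.le))
    rw [mul_add, ← mul_assoc, inv_mul_eq_div]
    linarith

variable {m n : ℕ} [NeZero m] [NeZero n] {W : Weights m n} {j₁ : ZMod n} {γ : ℝ}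

/-- Edge weights on the curve of parameter `γ` inside the tentacle. -/
abbrev fieldWeight (W : Weights m n) (j₁ : ZMod n) (γ t : ℝ) (e : Edge) : ℝ :=
  edgeWeight W (tentacleBx W j₁ γ t) (Real.log t) e

/-- Inverse Kasteleyn operator on the curve of parameter `γ` inside the tentacle. -/
abbrev fieldGreen (W : Weights m n) (j₁ : ZMod n) (γ t : ℝ) (v u : ℤ × ℤ) : ℂ :=
  invKasteleyn W (tentacleBx W j₁ γ t) (Real.log t) v u

/-- Weights of the `c`-edges of a column by class, as a function of the horizontal field. -/
def columnWeight (W : Weights m n) (j : ZMod n) (ρ : ℝ) (i : ZMod m) : ℝ :=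
  W.c i j * if i = 0 then ρ else 1

omit [NeZero m] [NeZero n] in
theorem columnWeight_pos (W : Weights m n) (j : ZMod n) {ρ : ℝ} (hρ : 0 < ρ) (i : ZMod m) :
    0 < columnWeight W j ρ i := by
  unfold columnWeight
  split_ifs
  · exact mul_pos (W.c_pos _ _) hρ
  · exact mul_pos (W.c_pos _ _) one_pos

omit [NeZero n] in
theorem prod_columnWeight (W : Weights m n) (j : ZMod n) (ρ : ℝ) :
    columnRatio W j * ∏ i, columnWeight W j ρ i = ρ * ∏ i, W.a i j := by
  unfold columnWeight
  rw [prod_ite_zero, ← columnRatio_mul]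
  ring

theorem exp_tentacleBx_sub_isBigO :
    (fun t => Real.exp (tentacleBx W j₁ γ t) - columnRatio W j₁) =O[𝓝[>] 0] fun t : ℝ => t := by
  have h1 : DifferentiableAt ℝ (fun t => Real.exp (tentacleBx W j₁ γ t)) 0 := by
    simp only [exp_tentacleBx, fieldRadius]
    fun_prop
  have h2 := h1.isBigO_sub
  simp only [sub_zero, exp_tentacleBx, fieldRadius_zero, abs_columnRoot] at h2
  simp only [exp_tentacleBx]
  exact h2.mono nhdsWithin_le_nhds

theorem columnWeight_sub_isBigO (j : ZMod n) (i : ZMod m) :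
    (fun t => columnWeight W j (Real.exp (tentacleBx W j₁ γ t)) i -
      columnWeight W j (columnRatio W j₁) i) =O[𝓝[>] 0] fun t : ℝ => t := by
  unfold columnWeight
  split_ifs
  · exact (exp_tentacleBx_sub_isBigO.const_mul_left (W.c i j)).congr_left fun t => by ring
  · simpa using isBigO_zero _ _

theorem tendsto_of_sub_isBigO {E : Type*} [NormedAddCommGroup E] {f : ℝ → E} {l : E}
    (h : (fun t => f t - l) =O[𝓝[>] 0] fun t : ℝ => t) : Tendsto f (𝓝[>] 0) (𝓝 l) := by
  have h1 : Tendsto (fun t : ℝ => t) (𝓝[>] 0) (𝓝 0) := tendsto_id.mono_left nhdsWithin_le_nhds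
  exact tendsto_sub_nhds_zero_iff.1 (h.trans_tendsto h1)

theorem prod_range_class_sub (f : ZMod m → ℝ) (x : ZMod m) :
    ∏ i ∈ Finset.range m, f (x - (i : ZMod m)) = ∏ i, f i := by
  rw [prod_range_zmod fun i => f (x - i)]
  exact Equiv.prod_comp (Equiv.subLeft x) f

theorem prod_range_class_add (f : ZMod m → ℝ) (x : ZMod m) :
    ∏ i ∈ Finset.range m, f (x + (i : ZMod m)) = ∏ i, f i := by
  rw [prod_range_zmod fun i => f (x + i)]
  exact Equiv.prod_comp (Equiv.addLeft x) f

/-- Below the diagonal the column equation bounds the entry at row `I` by `c / a` times that at row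
`I - 1`, up to `O(t)`. Iterating moves away from `I'`, and over a period the limiting factor is the
ratio of column `j₁` divided by that of column `J`, less than `1`. -/
theorem fieldGreen_isBigO_of_lt (hgen : ∀ j, j ≠ j₁ → columnRatio W j ≠ columnRatio W j₁)
    (hγ : γ ∈ Set.Ioo (-1 : ℝ) 1) {J : ℤ} (hJ : columnRatio W j₁ < columnRatio W (J : ZMod n))
    {I I' : ℤ} (hI : I < I') :
    (fun t => fieldGreen W j₁ γ t (I, J) (I', J)) =O[𝓝[>] 0] fun t : ℝ => t := by
  have hJ₁ : (J : ZMod n) ≠ j₁ := fun h => hJ.ne (by rw [h])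
  obtain ⟨B, hB⟩ := exists_bound_column hgen hγ hJ₁
  obtain ⟨C, hC⟩ := exists_bound_crossing hgen hγ hJ₁
  have h1 := isBigO_of_weighted_recursion
    (G := fun t l => ‖fieldGreen W j₁ γ t (I' - 1 - (l : ℕ), J) (I', J)‖)
    (d := fun _ i => W.a i J)
    (ν := fun t => columnWeight W J (Real.exp (tentacleBx W j₁ γ t))) (d₀ := fun i => W.a i J)
    (ν₀ := columnWeight W J (columnRatio W j₁))
    (s := fun l => ((I' - 1 - (l : ℕ) : ℤ) : ZMod m)) (B := B) (C := C)
    (fun _ _ => norm_nonneg _) (fun _ _ => W.a_pos _ _)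
    (fun t i => columnWeight_pos W _ (Real.exp_pos _) i) (fun i => W.a_pos _ _)
    (fun i => tendsto_const_nhds) (fun i => tendsto_of_sub_isBigO (columnWeight_sub_isBigO _ i))
    ?_ ?_ ?_ ?_ (I' - 1 - I).toNat
  · have h2 : ((I' - 1 - I).toNat : ℤ) = I' - 1 - I := Int.toNat_of_nonneg (by omega)
    simp only [h2] at h1
    have h3 : I' - 1 - (I' - 1 - I) = I := by ring
    rw [h3] at h1
    exact h1.of_norm_left
  · have h2 := prod_columnWeight W (J : ZMod n) (columnRatio W j₁)
    have h3 : 0 < ∏ i, W.a i (J : ZMod n) := Finset.prod_pos fun i _ => W.a_pos _ _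
    have h4 := mul_lt_mul_of_pos_right hJ h3
    rw [← h2] at h4
    exact lt_of_mul_lt_mul_left h4 (columnRatio_pos W _).le
  · intro f l
    rw [← prod_range_class_sub f ((I' : ZMod m) - 1 - l)]
    refine Finset.prod_congr rfl fun i _ => ?_
    push_cast
    rw [sub_sub _ (l : ZMod m)]
  · filter_upwards [hC, eventually_column_equation hgen hγ hJ₁] with t ht1 ht2 l
    have h2 := ht2 (I' - 1 - l) I'
    rw [if_neg (by omega)] at h2
    have h3 := ht1 (I' - 1 - l) I'
    have h4 : (I' - 1 - (l : ℤ)) - 1 = I' - 1 - ((l + 1 : ℕ) : ℤ) := by push_cast; ring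
    rw [h4] at h2
    have h5 : (fieldWeight W j₁ γ t ⟨I' - 1 - l, J, .a⟩ : ℂ) *
        fieldGreen W j₁ γ t (I' - 1 - l, J) (I', J) =
        -((fieldWeight W j₁ γ t ⟨I' - 1 - l, J, .c⟩ : ℂ) *
          fieldGreen W j₁ γ t (I' - 1 - ((l + 1 : ℕ) : ℤ), J) (I', J)) -
        (fieldWeight W j₁ γ t ⟨I' - 1 - l, J, .b⟩ : ℂ) *
          fieldGreen W j₁ γ t (I' - 1 - l, J + 1) (I', J) := by
      linear_combination h2
    have h6 := (congrArg norm h5).le.trans (norm_sub_le _ _)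
    rw [norm_neg, norm_mul, norm_mul, Complex.norm_real, Complex.norm_real, Real.norm_eq_abs,
      Real.norm_eq_abs, abs_of_pos (edgeWeight_pos _ _ _ _),
      abs_of_pos (edgeWeight_pos _ _ _ _)] at h6
    exact h6.trans (add_le_add_right h3 _)
  · filter_upwards [hB] with t ht l
    exact ht _ _

/-- Same recursion read upwards, with factor `a / c`. The equation used at row `I'` is that of the
white vertex `I' + 1`, so the diagonal entry is included. -/
theorem fieldGreen_isBigO_of_le (hgen : ∀ j, j ≠ j₁ → columnRatio W j ≠ columnRatio W j₁)
    (hγ : γ ∈ Set.Ioo (-1 : ℝ) 1) {J : ℤ} (hJ : columnRatio W (J : ZMod n) < columnRatio W j₁)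
    {I I' : ℤ} (hI : I' ≤ I) :
    (fun t => fieldGreen W j₁ γ t (I, J) (I', J)) =O[𝓝[>] 0] fun t : ℝ => t := by
  have hJ₁ : (J : ZMod n) ≠ j₁ := fun h => hJ.ne (by rw [h])
  obtain ⟨B, hB⟩ := exists_bound_column hgen hγ hJ₁
  obtain ⟨C, hC⟩ := exists_bound_crossing hgen hγ hJ₁
  have h1 := isBigO_of_weighted_recursion
    (G := fun t l => ‖fieldGreen W j₁ γ t (I' + (l : ℕ), J) (I', J)‖)
    (ν := fun _ i => W.a i J)
    (d := fun t => columnWeight W J (Real.exp (tentacleBx W j₁ γ t))) (ν₀ := fun i => W.a i J)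
    (d₀ := columnWeight W J (columnRatio W j₁))
    (s := fun l => ((I' + 1 + (l : ℕ) : ℤ) : ZMod m)) (B := B) (C := C)
    (fun _ _ => norm_nonneg _) (fun t i => columnWeight_pos W _ (Real.exp_pos _) i)
    (fun _ _ => W.a_pos _ _) (fun i => columnWeight_pos W _ (columnRatio_pos W _) i)
    (fun i => tendsto_of_sub_isBigO (columnWeight_sub_isBigO _ i)) (fun i => tendsto_const_nhds)
    ?_ ?_ ?_ ?_ (I - I').toNat
  · have h2 : ((I - I').toNat : ℤ) = I - I' := Int.toNat_of_nonneg (by omega)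
    simp only [h2] at h1
    have h3 : I' + (I - I') = I := by ring
    rw [h3] at h1
    exact h1.of_norm_left
  · have h2 := prod_columnWeight W (J : ZMod n) (columnRatio W j₁)
    have h3 : 0 < ∏ i, W.a i (J : ZMod n) := Finset.prod_pos fun i _ => W.a_pos _ _
    have h4 := mul_lt_mul_of_pos_right hJ h3
    rw [← h2] at h4
    exact lt_of_mul_lt_mul_left h4 (columnRatio_pos W _).le
  · intro f l
    rw [← prod_range_class_add f ((I' : ZMod m) + 1 + l)]
    refine Finset.prod_congr rfl fun i _ => ?_
    push_cast
    rw [add_assoc _ (l : ZMod m)]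
  · filter_upwards [hC, eventually_column_equation hgen hγ hJ₁] with t ht1 ht2 l
    have h2 := ht2 (I' + 1 + l) I'
    rw [if_neg (by omega)] at h2
    have h3 := ht1 (I' + 1 + l) I'
    have h4 : (I' + 1 + (l : ℤ)) - 1 = I' + l := by ring
    have h7 : I' + ((l + 1 : ℕ) : ℤ) = I' + 1 + l := by push_cast; ring
    rw [h4] at h2
    have h5 : (fieldWeight W j₁ γ t ⟨I' + 1 + l, J, .c⟩ : ℂ) *
          fieldGreen W j₁ γ t (I' + l, J) (I', J) =
        -((fieldWeight W j₁ γ t ⟨I' + 1 + l, J, .a⟩ : ℂ) *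
          fieldGreen W j₁ γ t (I' + 1 + l, J) (I', J)) -
        (fieldWeight W j₁ γ t ⟨I' + 1 + l, J, .b⟩ : ℂ) *
          fieldGreen W j₁ γ t (I' + 1 + l, J + 1) (I', J) := by
      linear_combination h2
    have h6 := (congrArg norm h5).le.trans (norm_sub_le _ _)
    rw [norm_neg, norm_mul, norm_mul, Complex.norm_real, Complex.norm_real, Real.norm_eq_abs,
      Real.norm_eq_abs, abs_of_pos (edgeWeight_pos _ _ _ _),
      abs_of_pos (edgeWeight_pos _ _ _ _)] at h6
    simp only [h7]
    exact h6.trans (add_le_add_right h3 _)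
  · filter_upwards [hB] with t ht l
    exact ht _ _

/-- In the column equation on the diagonal the crossing term and the entry below the diagonal are
both `O(t)`. -/
theorem fieldWeight_mul_fieldGreen_a
    (hgen : ∀ j, j ≠ j₁ → columnRatio W j ≠ columnRatio W j₁)
    (hγ : γ ∈ Set.Ioo (-1 : ℝ) 1) {J : ℤ} (hJ : columnRatio W j₁ < columnRatio W (J : ZMod n))
    (I : ℤ) :
    (fun t => (fieldWeight W j₁ γ t ⟨I, J, .a⟩ : ℂ) * fieldGreen W j₁ γ t (I, J) (I, J) - 1)
      =O[𝓝[>] 0] fun t : ℝ => t := by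
  have hJ₁ : (J : ZMod n) ≠ j₁ := fun h => hJ.ne (by rw [h])
  obtain ⟨C, hC⟩ := exists_bound_crossing hgen hγ hJ₁
  have h1 : (fun t => (fieldWeight W j₁ γ t ⟨I, J, .b⟩ : ℂ) *
      fieldGreen W j₁ γ t (I, J + 1) (I, J)) =O[𝓝[>] 0] fun t : ℝ => t := by
    refine IsBigO.of_bound C ?_
    filter_upwards [hC, self_mem_nhdsWithin] with t ht ht0
    rw [Real.norm_eq_abs, abs_of_pos ht0]
    exact ht I I
  have h2 : (fun t => (fieldWeight W j₁ γ t ⟨I, J, .c⟩ : ℂ)) =O[𝓝[>] 0] fun _ : ℝ => (1 : ℝ) :=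
    ((Complex.continuous_ofReal.tendsto _).comp
      (tendsto_of_sub_isBigO (columnWeight_sub_isBigO (J : ZMod n) (I : ZMod m)))).isBigO_one ℝ
  have h3 := h2.mul (fieldGreen_isBigO_of_lt hgen hγ hJ (show I - 1 < I by omega))
  simp only [one_mul] at h3
  refine (h1.add h3).neg_left.congr' ?_ EventuallyEq.rfl
  filter_upwards [eventually_column_equation hgen hγ hJ₁] with t ht
  have h4 := ht I I
  rw [if_pos rfl] at h4
  linear_combination -h4

theorem fieldWeight_mul_fieldGreen_c
    (hgen : ∀ j, j ≠ j₁ → columnRatio W j ≠ columnRatio W j₁)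
    (hγ : γ ∈ Set.Ioo (-1 : ℝ) 1) {J : ℤ} (hJ : columnRatio W (J : ZMod n) < columnRatio W j₁)
    (I : ℤ) :
    (fun t => (fieldWeight W j₁ γ t ⟨I, J, .c⟩ : ℂ) * fieldGreen W j₁ γ t (I - 1, J) (I, J) - 1)
      =O[𝓝[>] 0] fun t : ℝ => t := by
  have hJ₁ : (J : ZMod n) ≠ j₁ := fun h => hJ.ne (by rw [h])
  obtain ⟨C, hC⟩ := exists_bound_crossing hgen hγ hJ₁
  have h1 : (fun t => (fieldWeight W j₁ γ t ⟨I, J, .b⟩ : ℂ) *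
      fieldGreen W j₁ γ t (I, J + 1) (I, J)) =O[𝓝[>] 0] fun t : ℝ => t := by
    refine IsBigO.of_bound C ?_
    filter_upwards [hC, self_mem_nhdsWithin] with t ht ht0
    rw [Real.norm_eq_abs, abs_of_pos ht0]
    exact ht I I
  have h3 := (fieldGreen_isBigO_of_le hgen hγ hJ (le_refl I)).const_mul_left (W.a I J : ℂ)
  refine (h1.add h3).neg_left.congr' ?_ EventuallyEq.rfl
  filter_upwards [eventually_column_equation hgen hγ hJ₁] with t ht
  have h4 := ht I I
  rw [if_pos rfl] at h4
  have h5 : fieldWeight W j₁ γ t ⟨I, J, .a⟩ = W.a I J := rfl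
  rw [← h5]
  linear_combination -h4

end ColumnDecay

/-! ### Calculus of limits with error `O(t)`. -/

section LinearRate

/-- `f t` tends to `l` as `t → 0⁺`, with an error of order `t`. -/
def LinearRate {E : Type*} [NormedAddCommGroup E] (f : ℝ → E) (l : E) : Prop :=
  (fun t => f t - l) =O[𝓝[>] 0] fun t : ℝ => t

variable {E : Type*} [NormedAddCommGroup E] {𝕜 : Type*} [NormedField 𝕜]

theorem LinearRate.tendsto {f : ℝ → E} {l : E} (h : LinearRate f l) :
    Tendsto f (𝓝[>] 0) (𝓝 l) := tendsto_of_sub_isBigO h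

theorem LinearRate.congr' {f g : ℝ → E} {l : E} (h : LinearRate f l)
    (hfg : ∀ᶠ t in 𝓝[>] (0 : ℝ), f t = g t) : LinearRate g l :=
  IsBigO.congr' h (hfg.mono fun t ht => by simp only [ht]) EventuallyEq.rfl

theorem linearRate_const (l : E) : LinearRate (fun _ => l) l := by
  simpa [LinearRate] using isBigO_zero _ _

theorem LinearRate.mul {f g : ℝ → 𝕜} {l k : 𝕜} (hf : LinearRate f l) (hg : LinearRate g k) :
    LinearRate (fun t => f t * g t) (l * k) := by
  have h1 : (fun t => (f t - l) * g t) =O[𝓝[>] 0] fun t : ℝ => t * (1 : ℝ) :=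
    IsBigO.mul hf (hg.tendsto.isBigO_one ℝ)
  simp only [mul_one] at h1
  exact (h1.add (IsBigO.const_mul_left hg l)).congr_left fun t => by ring

theorem LinearRate.inv {f : ℝ → 𝕜} {l : 𝕜} (hf : LinearRate f l) (hl : l ≠ 0) :
    LinearRate (fun t => (f t)⁻¹) l⁻¹ := by
  have h1 : (fun t => (f t - l) * ((f t)⁻¹ * -l⁻¹)) =O[𝓝[>] 0] fun t : ℝ => t * (1 : ℝ) :=
    IsBigO.mul hf (((hf.tendsto.inv₀ hl).mul_const (-l⁻¹)).isBigO_one ℝ)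
  simp only [mul_one] at h1
  refine h1.congr' ?_ EventuallyEq.rfl
  filter_upwards [hf.tendsto.eventually_ne hl] with t ht
  field_simp
  ring

theorem LinearRate.div {f g : ℝ → 𝕜} {l k : 𝕜} (hf : LinearRate f l) (hg : LinearRate g k)
    (hk : k ≠ 0) : LinearRate (fun t => f t / g t) (l / k) := by
  simp only [div_eq_mul_inv]
  exact hf.mul (hg.inv hk)

theorem LinearRate.prod {ι : Type*} {f : ι → ℝ → 𝕜} {l : ι → 𝕜} (s : Finset ι)
    (h : ∀ i ∈ s, LinearRate (f i) (l i)) :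
    LinearRate (fun t => ∏ i ∈ s, f i t) (∏ i ∈ s, l i) := by
  classical
  induction s using Finset.induction_on with
  | empty => simpa using linearRate_const (1 : 𝕜)
  | insert a s ha ih =>
    simp only [Finset.prod_insert ha]
    exact (h a (Finset.mem_insert_self a s)).mul
      (ih fun i hi => h i (Finset.mem_insert_of_mem hi))

theorem LinearRate.norm {f : ℝ → E} {l : E} (h : LinearRate f l) :
    LinearRate (fun t => ‖f t‖) ‖l‖ :=
  (IsBigO.of_bound 1 (Eventually.of_forall fun t => by
    simpa using abs_norm_sub_norm_le (f t) l)).trans h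

theorem LinearRate.isBigO_sub {f g : ℝ → E} {l : E} (hf : LinearRate f l)
    (hg : LinearRate g l) : (fun t => f t - g t) =O[𝓝[>] 0] fun t : ℝ => t :=
  (IsBigO.sub hf hg).congr_left fun t => by abel

end LinearRate

/-! ### A determinant dominated by one cyclic permutation. -/

section Determinant

/-- The last index must go to `0`, hence every other one increases, by at least as much as under the
rotation; since both permutations have the same sum of values, equality holds everywhere. -/
theorem eq_finRotate_of_forall {N : ℕ} (σ : Equiv.Perm (Fin (N + 1)))
    (h : ∀ i, σ i = 0 ∨ i < σ i) : σ = finRotate (N + 1) := by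
  have hlast : σ (Fin.last N) = 0 :=
    (h (Fin.last N)).resolve_right (not_lt.2 (Fin.le_last _))
  have hle : ∀ i, (finRotate (N + 1) i : Fin (N + 1)).val ≤ (σ i).val := by
    intro i
    rcases eq_or_ne i (Fin.last N) with rfl | hi
    · rw [finRotate_last]
      exact Nat.zero_le _
    · have h1 : σ i ≠ 0 := fun h0 => hi (σ.injective (h0.trans hlast.symm))
      have h2 : i < σ i := (h i).resolve_left h1
      rw [coe_finRotate_of_ne_last hi]
      exact h2
  have hsum : ∑ i, (finRotate (N + 1) i : Fin (N + 1)).val = ∑ i, (σ i).val := by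
    rw [Equiv.sum_comp (finRotate (N + 1)) fun i : Fin (N + 1) => i.val,
      Equiv.sum_comp σ fun i : Fin (N + 1) => i.val]
  have h3 := (Finset.sum_eq_sum_iff_of_le fun i _ => hle i).1 hsum
  ext i
  exact (h3 i (Finset.mem_univ i)).symm

/-- A determinant whose rows, except the first one, are small on and above the diagonal and tend to
`1` just below it. -/
theorem linearRate_norm_det {N : ℕ} {A : ℝ → Matrix (Fin (N + 1)) (Fin (N + 1)) ℂ}
    {L : Fin (N + 1) → ℂ} (h0 : ∀ j, LinearRate (fun t => A t 0 j) (L j))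
    (hbd : ∀ i j, (fun t => A t i j) =O[𝓝[>] 0] fun _ : ℝ => (1 : ℝ))
    (hsmall : ∀ i j, i ≠ 0 → i ≤ j → (fun t => A t i j) =O[𝓝[>] 0] fun t : ℝ => t)
    (hone : ∀ i : Fin N, LinearRate (fun t => A t i.succ i.castSucc) 1) :
    LinearRate (fun t => ‖(A t).det‖) ‖L (Fin.last N)‖ := by
  classical
  set s : ℂ := ((Equiv.Perm.sign (finRotate (N + 1)) : ℤ) : ℂ) with hs
  have hsn : ‖s‖ = 1 := by
    rcases Int.units_eq_one_or (Equiv.Perm.sign (finRotate (N + 1))) with h | h <;> simp [hs, h]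
  have hmain : LinearRate (fun t => s * ∏ i, A t (finRotate (N + 1) i) i)
      (s * L (Fin.last N)) := by
    refine (linearRate_const s).mul ?_
    simp only [Fin.prod_univ_castSucc]
    have h1 : LinearRate (fun t => ∏ i : Fin N,
        A t (finRotate (N + 1) i.castSucc) i.castSucc) (∏ i : Fin N, 1) := by
      refine LinearRate.prod _ fun i _ => ?_
      have h2 : finRotate (N + 1) i.castSucc = i.succ := by
        rw [finRotate_apply, Fin.coeSucc_eq_succ]
      rw [h2]
      exact hone i
    have h3 : LinearRate (fun t => A t (finRotate (N + 1) (Fin.last N)) (Fin.last N))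
        (L (Fin.last N)) := by
      rw [finRotate_last]
      exact h0 _
    simpa using h1.mul h3
  have hrest : (fun t => (A t).det - s * ∏ i, A t (finRotate (N + 1) i) i) =O[𝓝[>] 0]
      fun t : ℝ => t := by
    have h1 : ∀ t, (A t).det - s * ∏ i, A t (finRotate (N + 1) i) i =
        ∑ σ ∈ Finset.univ.erase (finRotate (N + 1)),
          ((Equiv.Perm.sign σ : ℤ) : ℂ) * ∏ i, A t (σ i) i := by
      intro t
      rw [Matrix.det_apply', ← Finset.add_sum_erase _ _ (Finset.mem_univ (finRotate (N + 1))),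
        add_sub_cancel_left]
    simp only [h1]
    refine IsBigO.fun_sum fun σ hσ => ?_
    refine IsBigO.const_mul_left ?_ _
    -- Any other permutation uses a small entry, on or above the diagonal and outside the first row.
    have h2 : ∃ i, σ i ≠ 0 ∧ σ i ≤ i := by
      by_contra! h
      exact (Finset.mem_erase.1 hσ).1 (eq_finRotate_of_forall σ fun i => by
        by_cases h0 : σ i = 0
        · exact Or.inl h0
        · exact Or.inr (h i h0))
    obtain ⟨i, hi0, hi⟩ := h2
    have h3 : (fun t => ∏ j ∈ Finset.univ.erase i, A t (σ j) j) =O[𝓝[>] 0]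
        fun _ : ℝ => (1 : ℝ) := by
      have := IsBigO.finsetProd (s := Finset.univ.erase i) (l := 𝓝[>] (0 : ℝ))
        (f := fun j t => A t (σ j) j) (g := fun _ _ => (1 : ℝ)) fun j _ => hbd (σ j) j
      simpa using this
    have h4 := (hsmall (σ i) i hi0 hi).mul h3
    simp only [mul_one] at h4
    refine h4.congr_left fun t => ?_
    exact Finset.mul_prod_erase Finset.univ (fun j => A t (σ j) j) (Finset.mem_univ i)
  have hdet : LinearRate (fun t => (A t).det) (s * L (Fin.last N)) :=
    (hrest.add hmain).congr_left fun t => by ring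
  have h5 := hdet.norm
  rwa [norm_mul, hsn, one_mul] at h5

end Determinant

/-! ### Run length events as cylinder events. -/

section RunLength

theorem le_runLength_iff (f : ℕ → Edge) (ω : DimerConfig) (N : ℕ) :
    (N : ℕ∞) ≤ runLength f ω ↔ ∀ i ∈ Finset.Icc 1 N, f i ∈ ω.1 := by
  constructor
  · intro h
    by_contra hN
    have hlt : runLength f ω ≤ ((N - 1 : ℕ) : ℕ∞) := by
      refine iSup₂_le fun k hk => ?_
      have hkN : k < N := by
        by_contra! hle
        exact hN fun i hi => hk i (Finset.Icc_subset_Icc_right hle hi)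
      exact_mod_cast (show k ≤ N - 1 by omega)
    -- The subtraction is truncated: the inequality leaves only `N = 0`, where the condition is
    -- empty.
    have h1 : N ≤ N - 1 := by exact_mod_cast h.trans hlt
    have h2 : N = 0 := by omega
    subst h2
    exact hN fun i hi => by simp at hi
  · intro h
    exact le_iSup₂ (f := fun (N : ℕ) (_ : ∀ i ∈ Finset.Icc 1 N, f i ∈ ω.1) => (N : ℕ∞)) N h

theorem measurableSet_mem (e : Edge) : MeasurableSet {ω : DimerConfig | e ∈ ω.1} := by
  have h1 : Measurable fun ω : DimerConfig => ω.1 := measurable_subtype_coe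
  exact measurableSet_setOfPred.2 ((measurable_set_mem e).comp h1)

theorem measurableSet_le_runLength (f : ℕ → Edge) (N : ℕ) :
    MeasurableSet {ω | (N : ℕ∞) ≤ runLength f ω} := by
  have h : {ω | (N : ℕ∞) ≤ runLength f ω} = ⋂ i ∈ Finset.Icc 1 N, {ω : DimerConfig | f i ∈ ω.1} := by
    ext ω
    simp only [Set.mem_ofPred_eq, Set.mem_iInter, le_runLength_iff]
  rw [h]
  exact Finset.measurableSet_biInter _ fun i _ => measurableSet_mem _

theorem inter_le_runLength (e₀ : Edge) (f : ℕ → Edge) (N : ℕ) :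
    {ω : DimerConfig | e₀ ∈ ω.1} ∩ {ω | (N : ℕ∞) ≤ runLength f ω} =
      {ω | ∀ i : Fin (N + 1), (Fin.cons e₀ (fun i : Fin N => f (i + 1)) : Fin (N + 1) → Edge) i
        ∈ ω.1} := by
  ext ω
  simp only [Set.mem_inter_iff, Set.mem_ofPred_eq, le_runLength_iff, Fin.forall_fin_succ,
    Fin.cons_zero, Fin.cons_succ]
  refine and_congr_right fun _ => ⟨fun h i => h _ (Finset.mem_Icc.2 ⟨by omega, by omega⟩),
    fun h i hi => ?_⟩
  obtain ⟨h1, h2⟩ := Finset.mem_Icc.1 hi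
  have h3 := h ⟨i - 1, by omega⟩
  simp only at h3
  rwa [Nat.sub_add_cancel h1] at h3

end RunLength

/-! ### Probability of the bead followed by a run. -/

section Run

variable {m n : ℕ} [NeZero m] [NeZero n] {W : Weights m n} {j₁ : ZMod n} {γ : ℝ} {J₀ : ℤ}
  {e δ : ℕ → Edge} {ν d : ℕ → ℝ}

/-- A run of successive non-typical edges `e 1, e 2, …` of column `J₀`; the edge `δ (i + 1)` joins
the black end of `e (i + 1)` to the white end of `e i`. -/
structure IsColumnRun (W : Weights m n) (j₁ : ZMod n) (γ : ℝ) (J₀ : ℤ) (e δ : ℕ → Edge)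
    (ν d : ℕ → ℝ) : Prop where
  col_ne : (J₀ : ZMod n) ≠ j₁
  injective : Function.Injective e
  kind_ne : ∀ i, (e i).kind ≠ .b
  white_snd : ∀ i, (e i).white.2 = J₀
  black_snd : ∀ i, (e i).black.2 = J₀
  black_eq : ∀ i, (δ (i + 1)).black = (e (i + 1)).black
  white_eq : ∀ i, (δ (i + 1)).white = (e i).white
  ν_pos : ∀ i, 0 < ν i
  d_pos : ∀ i, 0 < d i
  rate_e : ∀ i, LinearRate (fun t => fieldWeight W j₁ γ t (e (i + 1))) (ν i)
  rate_δ : ∀ i, LinearRate (fun t => fieldWeight W j₁ γ t (δ (i + 1))) (d i)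
  small : ∀ i j, i + 1 ≤ j →
    (fun t => fieldGreen W j₁ γ t (e (i + 1)).black (e j).white) =O[𝓝[>] 0] fun t : ℝ => t
  one : ∀ i, LinearRate (fun t => (fieldWeight W j₁ γ t (δ (i + 1)) : ℂ) *
    fieldGreen W j₁ γ t (e (i + 1)).black (e i).white) 1

/-- Limit of the rescaled inverse Kasteleyn operator at the bead. -/
def crossingLimit (W : Weights m n) (j₁ : ZMod n) (i : ZMod m) (b u : ZMod m × ZMod n) (y : ℤ) :
    ℂ :=
  (|columnRoot W j₁| : ℝ) ^ y * ((columnRoot W j₁ : ℂ) ^ (-y) *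
    (W.b i u.2 * (blackFactor W j₁ b (columnRoot W j₁ : ℝ) 0 *
      whiteFactor W j₁ u (columnRoot W j₁ : ℝ) 0 /
      whiteFactor W j₁ (0, j₁) (columnRoot W j₁ : ℝ) 0) /
      deriv (charPoly W (columnRoot W j₁ : ℂ)) 0))

theorem norm_crossingLimit (W : Weights m n) (j₁ : ZMod n) (i : ZMod m)
    (b u : ZMod m × ZMod n) (y : ℤ) :
    ‖crossingLimit W j₁ i b u y‖ =
      W.b i u.2 * ‖blackFactor W j₁ b (columnRoot W j₁ : ℝ) 0‖ /
        (‖whiteFactor W j₁ (0, j₁) (columnRoot W j₁ : ℝ) 0‖ *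
          ‖deriv (charPoly W (columnRoot W j₁ : ℂ)) 0‖) *
        ‖whiteFactor W j₁ u (columnRoot W j₁ : ℝ) 0‖ := by
  have hX : |columnRoot W j₁| ≠ 0 := abs_ne_zero.2 (columnRoot_ne_zero W j₁)
  have h1 : |columnRoot W j₁| ^ y * |columnRoot W j₁| ^ (-y) = 1 := by
    rw [← zpow_add₀ hX, add_neg_cancel, zpow_zero]
  rw [crossingLimit]
  simp only [norm_mul, norm_div, norm_zpow, Complex.norm_real, Real.norm_eq_abs, abs_abs,
    abs_of_pos (W.b_pos i u.2)]
  rw [← mul_assoc, h1]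
  ring

/-- The bead row scaled by the arc mass; its limit depends on the column of the matrix only through
the white factor and a phase. -/
theorem linearRate_crossing {ω : ℂ → ℂ} {ε c : ℝ}
    (hgen : ∀ j, j ≠ j₁ → columnRatio W j ≠ columnRatio W j₁) (hγ : γ ∈ Set.Ioo (-1 : ℝ) 1)
    (h : LocalRoot (charPoly W) (columnRoot W j₁) (tentacleBeta W j₁) ω ε c)
    (hJ : (J₀ : ZMod n) ≠ j₁) (I I' : ℤ) :
    LinearRate (fun t => (fieldWeight W j₁ γ t ⟨I, J₀, .b⟩ : ℂ) /
        arcMass ω (columnRoot W j₁) ε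
          (fieldRadius (columnRoot W j₁) (tentacleBeta W j₁) γ t) t *
        fieldGreen W j₁ γ t (I, J₀ + 1) (I', J₀))
      (crossingLimit W j₁ I ((I : ZMod m), (J₀ : ZMod n) + 1) ((I' : ZMod m), (J₀ : ZMod n))
        (I / m - I' / m)) := by
  have h1 := h.greenMean_asymptotics hγ
    (rootMultiple_edgeNumerator_b h hgen (I : ZMod m) (b := ((I : ZMod m), (J₀ : ZMod n) + 1))
      (u := ((I' : ZMod m), (J₀ : ZMod n))) rfl hJ)
    (fun Z => by rw [edgeNumerator_b_eq W rfl]; ring) (I / m - I' / m)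
  simp only [rootKernel, h.root_self] at h1
  refine LinearRate.congr' h1 ?_
  filter_upwards [self_mem_nhdsWithin] with t ht
  have h2 := edgeWeight_mul_invKasteleyn W (tentacleBx W j₁ γ t) ht ⟨I, J₀, .b⟩ (I', J₀) rfl
  rw [exp_tentacleBx] at h2
  have h4 : vertexClass m n (I, J₀ + 1) = ((I : ZMod m), (J₀ : ZMod n) + 1) := by
    simp [vertexClass]
  rw [show (Edge.mk I J₀ .b).black = (I, J₀ + 1) from rfl, h4] at h2
  rw [div_mul_eq_mul_div]
  congr 1
  exact h2.symm

/-- The bead and the edge `e 0` share their white vertex, so the columns of the matrix of local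
statistics are indexed by the white ends of `e 0, …, e N`. The surviving permutation picks the entry
of the bead row at `e N`. The constant `κ` and the scale `M` do not depend on `N`, and so drop out
of conditional probabilities. -/
theorem exists_linearRate_measure {μ : ℝ → Measure DimerConfig}
    (hgen : ∀ j, j ≠ j₁ → columnRatio W j ≠ columnRatio W j₁) (hγ : γ ∈ Set.Ioo (-1 : ℝ) 1)
    (hμ : ∀ᶠ t in 𝓝[>] (0 : ℝ),
      IsDimerGibbsMeasure W (tentacleBx W j₁ γ t) (Real.log t) (μ t))
    (hrun : IsColumnRun W j₁ γ J₀ e δ ν d) {I₀ : ℤ} (he : (e 0).white = (I₀, J₀)) :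
    ∃ (κ : ℝ) (M : ℝ → ℝ), 0 < κ ∧ (∀ᶠ t in 𝓝[>] (0 : ℝ), 0 < M t) ∧ ∀ N : ℕ,
      LinearRate (fun t => (μ t).real ({ω | (⟨I₀, J₀, .b⟩ : Edge) ∈ ω.1} ∩
        {ω | (N : ℕ∞) ≤ runLength e ω}) / M t)
        (κ * ((∏ i ∈ Finset.range N, ν i / d i) *
          ‖whiteFactor W j₁ (vertexClass m n (e N).white) (columnRoot W j₁ : ℝ) 0‖)) := by
  obtain ⟨ω, ε, c, h⟩ := exists_localRoot_charPoly hgen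
  set M : ℝ → ℝ := fun t => arcMass ω (columnRoot W j₁) ε
    (fieldRadius (columnRoot W j₁) (tentacleBeta W j₁) γ t) t with hM
  have hMpos : ∀ᶠ t in 𝓝[>] (0 : ℝ), 0 < M t := h.eventually_arcMass_pos hγ
  obtain ⟨B, hB⟩ := exists_bound_column (m := m) hgen hγ hrun.col_ne
  set κ : ℝ := W.b I₀ (J₀ : ZMod n) *
    ‖blackFactor W j₁ ((I₀ : ZMod m), (J₀ : ZMod n) + 1) (columnRoot W j₁ : ℝ) 0‖ /
        (‖whiteFactor W j₁ (0, j₁) (columnRoot W j₁ : ℝ) 0‖ *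
          ‖deriv (charPoly W (columnRoot W j₁ : ℂ)) 0‖) with hκ
  have hκ0 : 0 < κ := by
    have h1 : deriv (charPoly W (columnRoot W j₁ : ℂ)) 0 ≠ 0 := by
      have := h.deriv_snd_ne (columnRoot W j₁ : ℂ) (by simpa using h.ε_pos)
      rwa [h.root_self] at this
    exact div_pos (mul_pos (W.b_pos _ _) (norm_pos_iff.2 (blackFactor_ne_zero hgen _)))
      (mul_pos (norm_pos_iff.2 (whiteFactor_ne_zero hgen _)) (norm_pos_iff.2 h1))
  refine ⟨κ, M, hκ0, hMpos, fun N => ?_⟩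
  have hwhite : ∀ j, (e j).white = ((e j).white.1, J₀) := fun j => by rw [← hrun.white_snd j]
  have hblack : ∀ j, (e j).black = ((e j).black.1, J₀) := fun j => by rw [← hrun.black_snd j]
  set E : Fin (N + 1) → Edge := Fin.cons ⟨I₀, J₀, .b⟩ (fun i : Fin N => e (i + 1)) with hE
  have hEw : ∀ j, (E j).white = (e j).white := by
    intro j
    refine Fin.cases ?_ (fun i => ?_) j
    · rw [hE, Fin.cons_zero, Fin.val_zero, he]
      rfl
    · rw [hE, Fin.cons_succ, Fin.val_succ]
  have hEinj : Function.Injective E := by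
    rw [hE, Fin.cons_injective_iff]
    refine ⟨?_, fun i j hij => ?_⟩
    · rintro ⟨i, hi⟩
      exact hrun.kind_ne (i + 1) (congrArg Edge.kind hi)
    · exact Fin.ext (Nat.succ_injective (hrun.injective hij))
  -- The bead row is divided by `M`; the row of `e (i + 1)` is scaled by the weight of the typical
  -- edge `δ (i + 1)`, which makes its subdiagonal entry tend to `1`.
  set v : ℝ → Fin (N + 1) → ℂ := fun t =>
    Fin.cons ((fieldWeight W j₁ γ t ⟨I₀, J₀, .b⟩ : ℂ) / M t)
      (fun i : Fin N => (fieldWeight W j₁ γ t (δ (i + 1)) : ℂ)) with hv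
  set A : ℝ → Matrix (Fin (N + 1)) (Fin (N + 1)) ℂ := fun t =>
    Matrix.of fun i j => v t i * (Matrix.of fun i j =>
      fieldGreen W j₁ γ t (E i).black (E j).white) i j with hA
  have hdet : LinearRate (fun t => ‖(A t).det‖)
      (κ * ‖whiteFactor W j₁ (vertexClass m n (e N).white) (columnRoot W j₁ : ℝ) 0‖) := by
    have hrow0 : ∀ j, LinearRate (fun t => A t 0 j)
        (crossingLimit W j₁ (I₀ : ZMod m) ((I₀ : ZMod m), (J₀ : ZMod n) + 1)
          (vertexClass m n (e j).white) (I₀ / m - (e j).white.1 / m)) := by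
      intro j
      have h1 := linearRate_crossing hgen hγ h hrun.col_ne I₀ (e j).white.1
      have h2 : vertexClass m n (e j).white = (((e j).white.1 : ZMod m), (J₀ : ZMod n)) := by
        rw [hwhite j]
        rfl
      rw [h2]
      refine h1.congr' (Eventually.of_forall fun t => ?_)
      simp only [hA, hv, Matrix.of_apply, Fin.cons_zero, hEw]
      rw [hwhite j]
      rfl
    have hsucc : ∀ t (i : Fin N) j, A t i.succ j = (fieldWeight W j₁ γ t (δ (i + 1)) : ℂ) *
        fieldGreen W j₁ γ t (e (i + 1)).black (e j).white := by
      intro t i j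
      simp only [hA, hv, Matrix.of_apply, Fin.cons_succ, hEw]
      rfl
    have hwO : ∀ i : Fin N, (fun t => (fieldWeight W j₁ γ t (δ (i + 1)) : ℂ)) =O[𝓝[>] 0]
        fun _ : ℝ => (1 : ℝ) := fun i =>
      ((Complex.continuous_ofReal.tendsto _).comp (hrun.rate_δ i).tendsto).isBigO_one ℝ
    have h1 := linearRate_norm_det hrow0 ?_ ?_ ?_
    · rw [norm_crossingLimit] at h1
      rw [show (vertexClass m n (e (Fin.last N : ℕ)).white).2 = (J₀ : ZMod n) by
        rw [hwhite]; rfl] at h1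
      exact h1
    · intro i j
      refine Fin.cases ?_ (fun i => ?_) i
      · exact (hrow0 j).tendsto.isBigO_one ℝ
      · simp only [hsucc]
        have h2 : (fun t => fieldGreen W j₁ γ t (e (i + 1)).black (e j).white) =O[𝓝[>] 0]
            fun _ : ℝ => (1 : ℝ) := by
          refine IsBigO.of_bound B ?_
          filter_upwards [hB] with t ht
          rw [norm_one, mul_one, hwhite j, hblack (i + 1)]
          exact ht _ _
        simpa using (hwO i).mul h2
    · intro i j
      refine Fin.cases (fun h0 => absurd rfl h0) (fun i _ hij => ?_) i
      simp only [hsucc]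
      have h2 := (hwO i).mul (hrun.small i j (by simpa [Fin.le_def] using hij))
      simpa using h2
    · intro i
      simp only [hsucc]
      exact hrun.one i
  -- Compensates for the weights of `δ` used in place of those of `e`.
  have hratio : LinearRate (fun t => ∏ i ∈ Finset.range N,
      fieldWeight W j₁ γ t (e (i + 1)) / fieldWeight W j₁ γ t (δ (i + 1)))
      (∏ i ∈ Finset.range N, ν i / d i) :=
    LinearRate.prod _ fun i _ => (hrun.rate_e i).div (hrun.rate_δ i) (hrun.d_pos i).ne'
  have hfinal := hratio.mul hdet
  rw [show (∏ i ∈ Finset.range N, ν i / d i) * (κ *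
      ‖whiteFactor W j₁ (vertexClass m n (e N).white) (columnRoot W j₁ : ℝ) 0‖) =
      κ * ((∏ i ∈ Finset.range N, ν i / d i) *
      ‖whiteFactor W j₁ (vertexClass m n (e N).white) (columnRoot W j₁ : ℝ) 0‖) by ring]
    at hfinal
  refine hfinal.congr' ?_
  filter_upwards [hμ, hMpos] with t ht hMt
  have hstat := ht.localStatistics (N + 1) E hEinj
  have hMc : (M t : ℂ) ≠ 0 := Complex.ofReal_ne_zero.2 hMt.ne'
  have hdetA : (A t).det = (∏ i, v t i) *
      (Matrix.of fun i j => fieldGreen W j₁ γ t (E i).black (E j).white).det :=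
    Matrix.det_mul_column (v t) _
  rw [inter_le_runLength]
  rw [Fin.prod_univ_succ] at hstat
  rw [Fin.prod_univ_succ] at hdetA
  simp only [hv, Fin.cons_zero, Fin.cons_succ] at hdetA
  simp only [hE, Fin.cons_zero, Fin.cons_succ] at hstat
  rw [← hE] at hstat
  have hδ : ∀ i : Fin N, (fieldWeight W j₁ γ t (δ (i + 1)) : ℂ) ≠ 0 := fun i =>
    Complex.ofReal_ne_zero.2 (edgeWeight_pos _ _ _ _).ne'
  have hδp := Finset.prod_ne_zero_iff.2 fun i (_ : i ∈ (Finset.univ : Finset (Fin N))) => hδ i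
  have hkey : (((μ t).real {ω | ∀ i, E i ∈ ω.1} / M t : ℝ) : ℂ) =
      ((∏ i ∈ Finset.range N,
        fieldWeight W j₁ γ t (e (i + 1)) / fieldWeight W j₁ γ t (δ (i + 1)) : ℝ) : ℂ) *
        (A t).det := by
    rw [hdetA, Complex.ofReal_div, hstat, Finset.prod_range fun i =>
      fieldWeight W j₁ γ t (e (i + 1)) / fieldWeight W j₁ γ t (δ (i + 1))]
    push_cast
    rw [Finset.prod_div_distrib]
    field_simp
  have hnorm := congrArg norm hkey
  rw [norm_mul, Complex.norm_real, Complex.norm_real, Real.norm_eq_abs, Real.norm_eq_abs,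
    abs_of_nonneg (div_nonneg measureReal_nonneg hMt.le),
    abs_of_nonneg (Finset.prod_nonneg fun i _ =>
      (div_pos (edgeWeight_pos _ _ _ _) (edgeWeight_pos _ _ _ _)).le)] at hnorm
  exact hnorm.symm

end Run

/-! ### Dual lengths at torus roots. -/

section DualLength

variable {m n : ℕ} [NeZero m] [NeZero n] {W : Weights m n} {j₁ : ZMod n} {γ : ℝ} {J₀ : ℤ}
  {e δ : ℕ → Edge} {ν d : ℕ → ℝ} {z₀ w₀ : ℝ → ℂ}

theorem whiteFactor_mul_dualLength {Bx By : ℝ} {z w : ℂ} (hroot : IsTorusRoot W Bx By z w)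
    {e : Edge} (hcol : e.black.2 = e.white.2) (hj : (e.white.2 : ZMod n) ≠ j₁) :
    ‖whiteFactor W j₁ (0, j₁) (Real.exp Bx * z) (Real.exp By * w)‖ * dualLength W Bx By z w e =
      edgeWeight W Bx By e * (Real.exp By *
        (‖blackFactor W j₁ (vertexClass m n e.black) (Real.exp Bx * z) (Real.exp By * w)‖ *
        ‖whiteFactor W j₁ (vertexClass m n e.white) (Real.exp Bx * z) (Real.exp By * w)‖)) := by
  obtain ⟨hz, hw, hP⟩ := hroot
  have hw0 : (Real.exp By : ℂ) * w ≠ 0 :=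
    mul_ne_zero (Complex.ofReal_ne_zero.2 (Real.exp_pos _).ne')
      (norm_ne_zero_iff.1 (by rw [hw]; exact one_ne_zero))
  have hb : (vertexClass m n e.black).2 = (vertexClass m n e.white).2 := by
    simp only [vertexClass, hcol]
  have h1 := congrArg norm (comatrix_of_root_same_column (j₁ := j₁) hP hw0 hb (by rw [hb]; exact hj))
  rw [norm_mul, norm_mul, norm_mul, norm_mul, hw, mul_one, Complex.norm_real, Real.norm_eq_abs,
    abs_of_pos (Real.exp_pos _)] at h1
  rw [dualLength, norm_mul, norm_mul, Complex.norm_I, one_mul, norm_coeff_exp_mul W Bx By e hz hw,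
    abs_of_pos (edgeWeight_pos _ _ _ _), mul_left_comm]
  congr 1

/-- Along torus roots, smooth functions tend linearly to their value at `(X, 0)`. -/
theorem linearRate_torusRoot (hgen : ∀ j, j ≠ j₁ → columnRatio W j ≠ columnRatio W j₁)
    (hroot : ∀ᶠ t in 𝓝[>] (0 : ℝ),
      IsTorusRoot W (tentacleBx W j₁ γ t) (Real.log t) (z₀ t) (w₀ t))
    {g : ℂ → ℂ → ℂ} (hg : ContDiff ℂ ⊤ fun x : ℂ × ℂ => g x.1 x.2) :
    LinearRate (fun t => g (Real.exp (tentacleBx W j₁ γ t) * z₀ t) (Real.exp (Real.log t) * w₀ t))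
      (g (columnRoot W j₁ : ℝ) 0) := by
  obtain ⟨ω, ε, c, h⟩ := exists_localRoot_charPoly hgen
  have hev : ∀ᶠ t in 𝓝[>] (0 : ℝ),
      ‖(Real.exp (tentacleBx W j₁ γ t) * z₀ t : ℂ) - columnRoot W j₁‖ ≤ c⁻¹ * t ∧
      ‖(Real.exp (Real.log t) * w₀ t : ℂ)‖ ≤ t := by
    filter_upwards [hroot, (h.eventually_root γ univ_mem).filter_mono nhdsWithin_le_nhds,
      self_mem_nhdsWithin] with t ht hr ht0
    have ht0 : 0 < t := ht0
    obtain ⟨hz, hw, hP⟩ := ht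
    rw [Real.exp_log ht0, exp_tentacleBx] at hP ⊢
    obtain ⟨-, h1, h2⟩ := hr _ _ hz hw.le hP
    have h3 : ‖(t : ℂ) * w₀ t‖ = t := by
      rw [norm_mul, hw, mul_one, Complex.norm_real, Real.norm_eq_abs, abs_of_pos ht0]
    refine ⟨?_, h3.le⟩
    have h4 := h.lower _ h1
    rw [h2, h3] at h4
    rw [inv_mul_eq_div, le_div_iff₀' h.c_pos]
    exact h4
  have hZ : LinearRate (fun t => (Real.exp (tentacleBx W j₁ γ t) * z₀ t : ℂ))
      ((columnRoot W j₁ : ℝ) : ℂ) := by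
    refine IsBigO.of_bound c⁻¹ ?_
    filter_upwards [hev, self_mem_nhdsWithin] with t ht ht0
    rw [Real.norm_eq_abs, abs_of_pos ht0]
    exact ht.1
  have hw : LinearRate (fun t => (Real.exp (Real.log t) * w₀ t : ℂ)) (0 : ℂ) := by
    refine IsBigO.of_bound 1 ?_
    filter_upwards [hev, self_mem_nhdsWithin] with t ht ht0
    rw [Real.norm_eq_abs, abs_of_pos ht0, sub_zero, one_mul]
    exact ht.2
  have h1 := ((hg.differentiable (by simp)) (((columnRoot W j₁ : ℝ) : ℂ), (0 : ℂ))).isBigO_sub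
  have h2 := h1.comp_tendsto (hZ.tendsto.prodMk_nhds hw.tendsto)
  exact h2.trans (IsBigO.prod_left hZ hw)

/-- At a common black vertex the black factor and the scale `e ^ By` cancel; the factors involved
are nonzero for small `t`, being so at `(X, 0)`. -/
theorem eventually_dualLength_div_of_black
    (hgen : ∀ j, j ≠ j₁ → columnRatio W j ≠ columnRatio W j₁)
    (hroot : ∀ᶠ t in 𝓝[>] (0 : ℝ),
      IsTorusRoot W (tentacleBx W j₁ γ t) (Real.log t) (z₀ t) (w₀ t))
    {e e' : Edge} (hcol : e.black.2 = e.white.2) (hcol' : e'.black.2 = e'.white.2)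
    (hj : (e.white.2 : ZMod n) ≠ j₁) (hb : e.black = e'.black) :
    ∀ᶠ t in 𝓝[>] (0 : ℝ),
      dualLength W (tentacleBx W j₁ γ t) (Real.log t) (z₀ t) (w₀ t) e /
        dualLength W (tentacleBx W j₁ γ t) (Real.log t) (z₀ t) (w₀ t) e' =
      fieldWeight W j₁ γ t e / fieldWeight W j₁ γ t e' *
        (‖whiteFactor W j₁ (vertexClass m n e.white) (Real.exp (tentacleBx W j₁ γ t) * z₀ t)
          (Real.exp (Real.log t) * w₀ t)‖ /
        ‖whiteFactor W j₁ (vertexClass m n e'.white) (Real.exp (tentacleBx W j₁ γ t) * z₀ t)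
          (Real.exp (Real.log t) * w₀ t)‖) := by
  have hne := fun u => (linearRate_torusRoot hgen hroot
    (contDiff_whiteFactor W j₁ u)).tendsto.eventually_ne (whiteFactor_ne_zero hgen u)
  have hne' := fun b => (linearRate_torusRoot hgen hroot
    (contDiff_blackFactor W j₁ b)).tendsto.eventually_ne (blackFactor_ne_zero hgen b)
  have hj' : (e'.white.2 : ZMod n) ≠ j₁ := by rwa [← hcol', ← hb, hcol]
  filter_upwards [hroot, hne (0, j₁), hne (vertexClass m n e'.white),
    hne' (vertexClass m n e'.black)] with t ht h0 h1 h2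
  have e1 := whiteFactor_mul_dualLength ht hcol hj
  have e2 := whiteFactor_mul_dualLength ht hcol' hj'
  rw [hb] at e1
  have h0' := norm_ne_zero_iff.2 h0
  have h1' := norm_ne_zero_iff.2 h1
  have h2' := norm_ne_zero_iff.2 h2
  have hexp := (Real.exp_pos (Real.log t)).ne'
  have hw' := (edgeWeight_pos W (tentacleBx W j₁ γ t) (Real.log t) e').ne'
  rw [← mul_div_mul_left _ _ h0', e1, e2]
  field_simp

theorem eventually_dualLength_div_of_white
    (hgen : ∀ j, j ≠ j₁ → columnRatio W j ≠ columnRatio W j₁)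
    (hroot : ∀ᶠ t in 𝓝[>] (0 : ℝ),
      IsTorusRoot W (tentacleBx W j₁ γ t) (Real.log t) (z₀ t) (w₀ t))
    {e e' : Edge} (hcol : e.black.2 = e.white.2) (hcol' : e'.black.2 = e'.white.2)
    (hj : (e.white.2 : ZMod n) ≠ j₁) (hw : e.white = e'.white) :
    ∀ᶠ t in 𝓝[>] (0 : ℝ),
      dualLength W (tentacleBx W j₁ γ t) (Real.log t) (z₀ t) (w₀ t) e /
        dualLength W (tentacleBx W j₁ γ t) (Real.log t) (z₀ t) (w₀ t) e' =
      fieldWeight W j₁ γ t e / fieldWeight W j₁ γ t e' *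
        (‖blackFactor W j₁ (vertexClass m n e.black) (Real.exp (tentacleBx W j₁ γ t) * z₀ t)
          (Real.exp (Real.log t) * w₀ t)‖ /
        ‖blackFactor W j₁ (vertexClass m n e'.black) (Real.exp (tentacleBx W j₁ γ t) * z₀ t)
          (Real.exp (Real.log t) * w₀ t)‖) := by
  have hne := fun u => (linearRate_torusRoot hgen hroot
    (contDiff_whiteFactor W j₁ u)).tendsto.eventually_ne (whiteFactor_ne_zero hgen u)
  have hne' := fun b => (linearRate_torusRoot hgen hroot
    (contDiff_blackFactor W j₁ b)).tendsto.eventually_ne (blackFactor_ne_zero hgen b)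
  have hj' : (e'.white.2 : ZMod n) ≠ j₁ := by rwa [← hw]
  filter_upwards [hroot, hne (0, j₁), hne (vertexClass m n e'.white),
    hne' (vertexClass m n e'.black)] with t ht h0 h1 h2
  have e1 := whiteFactor_mul_dualLength ht hcol hj
  have e2 := whiteFactor_mul_dualLength ht hcol' hj'
  rw [hw] at e1
  have h0' := norm_ne_zero_iff.2 h0
  have h1' := norm_ne_zero_iff.2 h1
  have h2' := norm_ne_zero_iff.2 h2
  have hexp := (Real.exp_pos (Real.log t)).ne'
  have hw' := (edgeWeight_pos W (tentacleBx W j₁ γ t) (Real.log t) e').ne'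
  rw [← mul_div_mul_left _ _ h0', e1, e2]
  field_simp

theorem prod_Icc_one_eq (f : ℕ → ℝ) (N : ℕ) :
    ∏ i ∈ Finset.Icc 1 N, f i = ∏ i ∈ Finset.range N, f (i + 1) := by
  induction N with
  | zero => simp
  | succ N ih => rw [Finset.prod_Icc_succ_top (by omega), ih, Finset.prod_range_succ]

/-- The pairs `e i`, `δ i` share black vertices and `δ (i + 1)` has the white end of `e i`, so the
white factors telescope. The limit is the one found for the conditional probabilities, and does not
depend on the choice of roots. -/
theorem IsColumnRun.linearRate_dualLength
    (hgen : ∀ j, j ≠ j₁ → columnRatio W j ≠ columnRatio W j₁)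
    (hroot : ∀ᶠ t in 𝓝[>] (0 : ℝ),
      IsTorusRoot W (tentacleBx W j₁ γ t) (Real.log t) (z₀ t) (w₀ t))
    (hrun : IsColumnRun W j₁ γ J₀ e δ ν d) (N : ℕ) :
    LinearRate (fun t => ∏ i ∈ Finset.Icc 1 N,
        dualLength W (tentacleBx W j₁ γ t) (Real.log t) (z₀ t) (w₀ t) (e i) /
        dualLength W (tentacleBx W j₁ γ t) (Real.log t) (z₀ t) (w₀ t) (δ i))
      ((∏ i ∈ Finset.range N, ν i / d i) *
        (‖whiteFactor W j₁ (vertexClass m n (e N).white) (columnRoot W j₁ : ℝ) 0‖ /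
        ‖whiteFactor W j₁ (vertexClass m n (e 0).white) (columnRoot W j₁ : ℝ) 0‖)) := by
  have hne : ∀ u, ‖whiteFactor W j₁ u (columnRoot W j₁ : ℝ) 0‖ ≠ 0 := fun u =>
    norm_ne_zero_iff.2 (whiteFactor_ne_zero hgen u)
  have htel : (‖whiteFactor W j₁ (vertexClass m n (e N).white) (columnRoot W j₁ : ℝ) 0‖ /
      ‖whiteFactor W j₁ (vertexClass m n (e 0).white) (columnRoot W j₁ : ℝ) 0‖) =
      ∏ i ∈ Finset.range N,
        (‖whiteFactor W j₁ (vertexClass m n (e (i + 1)).white) (columnRoot W j₁ : ℝ) 0‖ /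
        ‖whiteFactor W j₁ (vertexClass m n (e i).white) (columnRoot W j₁ : ℝ) 0‖) := by
    induction N with
    | zero => simp [div_self (hne _)]
    | succ N ih =>
      rw [Finset.prod_range_succ, ← ih, div_mul_div_comm, mul_comm, mul_div_mul_right _ _ (hne _)]
  rw [htel, ← Finset.prod_mul_distrib]
  simp only [prod_Icc_one_eq]
  refine LinearRate.prod _ fun i _ => ?_
  have h1 := fun u => (linearRate_torusRoot hgen hroot (contDiff_whiteFactor W j₁ u)).norm
  have h2 := ((hrun.rate_e i).div (hrun.rate_δ i) (hrun.d_pos i).ne').mul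
    ((h1 (vertexClass m n (e (i + 1)).white)).div (h1 (vertexClass m n (e i).white)) (hne _))
  refine h2.congr' ?_
  have h3 := eventually_dualLength_div_of_black hgen hroot (e := e (i + 1)) (e' := δ (i + 1))
    (by rw [hrun.white_snd, hrun.black_snd])
    (by rw [hrun.black_eq, hrun.white_eq, hrun.white_snd, hrun.black_snd])
    (by rw [hrun.white_snd]; exact hrun.col_ne) (hrun.black_eq i).symm
  filter_upwards [h3] with t ht
  rw [ht, hrun.white_eq]

end DualLength

/-! ### Conditional law of the run and its period. -/

section Conclusion

variable {m n : ℕ} [NeZero m] [NeZero n] {W : Weights m n} {j₁ : ZMod n} {γ : ℝ} {I₀ J₀ : ℤ}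
  {e δ : ℕ → Edge} {ν d : ℕ → ℝ} {z₀ w₀ : ℝ → ℂ} {μ : ℝ → Measure DimerConfig}

theorem IsColumnRun.linearRate_cond
    (hgen : ∀ j, j ≠ j₁ → columnRatio W j ≠ columnRatio W j₁) (hγ : γ ∈ Set.Ioo (-1 : ℝ) 1)
    (hμ : ∀ᶠ t in 𝓝[>] (0 : ℝ),
      IsDimerGibbsMeasure W (tentacleBx W j₁ γ t) (Real.log t) (μ t))
    (hrun : IsColumnRun W j₁ γ J₀ e δ ν d) (he : (e 0).white = (I₀, J₀)) (N : ℕ) :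
    LinearRate (fun t => (cond (μ t) {ω | (⟨I₀, J₀, .b⟩ : Edge) ∈ ω.1}).real
        {ω | (N : ℕ∞) ≤ runLength e ω})
      ((∏ i ∈ Finset.range N, ν i / d i) *
        (‖whiteFactor W j₁ (vertexClass m n (e N).white) (columnRoot W j₁ : ℝ) 0‖ /
        ‖whiteFactor W j₁ (vertexClass m n (e 0).white) (columnRoot W j₁ : ℝ) 0‖)) := by
  obtain ⟨κ, M, hκ, hM, h⟩ := exists_linearRate_measure hgen hγ hμ hrun he
  have hg0 : ‖whiteFactor W j₁ (vertexClass m n (e 0).white) (columnRoot W j₁ : ℝ) 0‖ ≠ 0 :=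
    norm_ne_zero_iff.2 (whiteFactor_ne_zero hgen _)
  have h0 := h 0
  rw [Finset.prod_range_zero, one_mul] at h0
  have h1 := (h N).div h0 (mul_ne_zero hκ.ne' hg0)
  rw [mul_div_mul_left _ _ hκ.ne', mul_div_assoc] at h1
  refine h1.congr' ?_
  filter_upwards [hM] with t ht
  rw [measureReal_def (cond _ _), cond_apply (measurableSet_mem _), ENNReal.toReal_mul,
    ENNReal.toReal_inv, ← measureReal_def, ← measureReal_def]
  have h2 : {ω | ((0 : ℕ) : ℕ∞) ≤ runLength e ω} = Set.univ := by
    ext ω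
    simp
  rw [h2, Set.inter_univ, div_div_div_cancel_right₀ ht.ne', inv_mul_eq_div]

/-- Both sides of the first claim have the same limit with error `O(t)`. After `p` periods the white
end is back in its class, the white factors cancel and only `q ^ p` remains; the law of the number
of blocks is a difference of two tails. -/
theorem IsColumnRun.hasGeometricLimit
    (hgen : ∀ j, j ≠ j₁ → columnRatio W j ≠ columnRatio W j₁) (hγ : γ ∈ Set.Ioo (-1 : ℝ) 1)
    (hμ : ∀ᶠ t in 𝓝[>] (0 : ℝ),
      IsDimerGibbsMeasure W (tentacleBx W j₁ γ t) (Real.log t) (μ t))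
    (hroot : ∀ᶠ t in 𝓝[>] (0 : ℝ),
      IsTorusRoot W (tentacleBx W j₁ γ t) (Real.log t) (z₀ t) (w₀ t))
    (hrun : IsColumnRun W j₁ γ J₀ e δ ν d) (he : (e 0).white = (I₀, J₀))
    (hclass : ∀ p, vertexClass m n (e (p * m)).white = vertexClass m n (e 0).white)
    {q : ℝ} (hq0 : 0 < q) (hq1 : q < 1)
    (hprod : ∀ p, ∏ i ∈ Finset.range (p * m), ν i / d i = q ^ p)
    {param : ℝ → ℝ} (hparam : Tendsto param (𝓝[>] 0) (𝓝 q)) :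
    HasGeometricLimit m μ {ω | (⟨I₀, J₀, .b⟩ : Edge) ∈ ω.1} (runLength e)
      (fun t i => dualLength W (tentacleBx W j₁ γ t) (Real.log t) (z₀ t) (w₀ t) (e i) /
        dualLength W (tentacleBx W j₁ γ t) (Real.log t) (z₀ t) (w₀ t) (δ i)) param := by
  have hlim : ∀ p : ℕ, Tendsto (fun t => (cond (μ t) {ω | (⟨I₀, J₀, .b⟩ : Edge) ∈ ω.1}).real
      {ω | ((p * m : ℕ) : ℕ∞) ≤ runLength e ω}) (𝓝[>] 0) (𝓝 (q ^ p)) := by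
    intro p
    have h1 := (hrun.linearRate_cond hgen hγ hμ he (p * m)).tendsto
    rw [hprod, hclass, div_self (norm_ne_zero_iff.2 (whiteFactor_ne_zero hgen _)), mul_one] at h1
    exact h1
  refine ⟨fun N => (hrun.linearRate_cond hgen hγ hμ he N).isBigO_sub
    (hrun.linearRate_dualLength hgen hroot N), q, hq0, hq1, hparam, hlim, fun p => ?_⟩
  have h1 := (hlim p).sub (hlim (p + 1))
  rw [show q ^ p - q ^ (p + 1) = (1 - q) * q ^ p by ring] at h1
  refine h1.congr' ?_
  filter_upwards [hμ] with t ht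
  have := ht.isProbabilityMeasure
  have h2 : {ω | ((p * m : ℕ) : ℕ∞) ≤ runLength e ω ∧
      runLength e ω < (((p + 1) * m : ℕ) : ℕ∞)} =
      {ω | ((p * m : ℕ) : ℕ∞) ≤ runLength e ω} \
        {ω | (((p + 1) * m : ℕ) : ℕ∞) ≤ runLength e ω} := by
    ext ω
    simp only [Set.mem_ofPred_eq, Set.mem_sdiff, not_le]
  rw [h2, measureReal_sdiff (fun ω hω => ?_) (measurableSet_le_runLength _ _)]
  have hω : (((p + 1) * m : ℕ) : ℕ∞) ≤ runLength e ω := hω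
  refine le_trans ?_ hω
  exact_mod_cast Nat.mul_le_mul_right m (Nat.le_succ p)

theorem prod_range_mul_class_add (f : ZMod m → ℝ) (x : ZMod m) (p : ℕ) :
    ∏ i ∈ Finset.range (p * m), f (x + (i : ZMod m)) = (∏ i, f i) ^ p := by
  induction p with
  | zero => simp
  | succ p ih =>
    rw [Nat.succ_mul, Finset.prod_range_add, ih, pow_succ]
    simp only [Nat.cast_add, Nat.cast_mul, CharP.cast_eq_zero, mul_zero, zero_add]
    rw [prod_range_class_add]

theorem prod_range_mul_class_sub (f : ZMod m → ℝ) (x : ZMod m) (p : ℕ) :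
    ∏ i ∈ Finset.range (p * m), f (x - (i : ZMod m)) = (∏ i, f i) ^ p := by
  induction p with
  | zero => simp
  | succ p ih =>
    rw [Nat.succ_mul, Finset.prod_range_add, ih, pow_succ]
    simp only [Nat.cast_add, Nat.cast_mul, CharP.cast_eq_zero, mul_zero, zero_add]
    rw [prod_range_class_sub]

theorem linearRate_fieldWeight_c (I J : ℤ) :
    LinearRate (fun t => fieldWeight W j₁ γ t ⟨I, J, .c⟩)
      (columnWeight W J (columnRatio W j₁) I) :=
  columnWeight_sub_isBigO (J : ZMod n) (I : ZMod m)

theorem linearRate_fieldWeight_a (I J : ℤ) :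
    LinearRate (fun t => fieldWeight W j₁ γ t ⟨I, J, .a⟩) (W.a I J) := linearRate_const _

theorem isColumnRun_of_lt (hgen : ∀ j, j ≠ j₁ → columnRatio W j ≠ columnRatio W j₁)
    (hγ : γ ∈ Set.Ioo (-1 : ℝ) 1) (hJ : columnRatio W j₁ < columnRatio W (J₀ : ZMod n)) (I₀ : ℤ) :
    IsColumnRun W j₁ γ J₀ (fun i => ⟨I₀ + i, J₀, .c⟩) (fun i => ⟨I₀ + i - 1, J₀, .a⟩)
      (fun i => columnWeight W J₀ (columnRatio W j₁) ((I₀ + 1 : ZMod m) + i))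
      (fun i => W.a ((I₀ : ZMod m) + i) J₀) where
  col_ne := fun h => hJ.ne (by rw [h])
  injective := fun i j hij => by
    have h1 := congrArg Edge.row hij
    simp only at h1
    omega
  kind_ne := fun i => by simp
  white_snd := fun i => rfl
  black_snd := fun i => rfl
  black_eq := fun i => rfl
  white_eq := fun i => by
    simp only [Edge.white, Prod.mk.injEq, and_true]
    push_cast
    ring
  ν_pos := fun i => columnWeight_pos W _ (columnRatio_pos W _) _
  d_pos := fun i => W.a_pos _ _
  rate_e := fun i => by
    have h := linearRate_fieldWeight_c (W := W) (j₁ := j₁) (γ := γ) (I₀ + (i + 1 : ℕ)) J₀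
    push_cast at h ⊢
    rwa [show (I₀ : ZMod m) + (i + 1) = I₀ + 1 + i by ring] at h
  rate_δ := fun i => by
    have h := linearRate_fieldWeight_a (W := W) (j₁ := j₁) (γ := γ) (I₀ + (i + 1 : ℕ) - 1) J₀
    push_cast at h ⊢
    rwa [show (I₀ : ZMod m) + (i + 1) - 1 = I₀ + i by ring] at h
  small := fun i j hij =>
    fieldGreen_isBigO_of_lt hgen hγ hJ (by push_cast; omega)
  one := fun i => by
    have h := fieldWeight_mul_fieldGreen_a hgen hγ hJ (I₀ + i)
    have h1 : I₀ + ((i + 1 : ℕ) : ℤ) - 1 = I₀ + i := by push_cast; ring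
    simp only [Edge.black, Edge.white, h1]
    exact h

theorem isColumnRun_of_gt (hgen : ∀ j, j ≠ j₁ → columnRatio W j ≠ columnRatio W j₁)
    (hγ : γ ∈ Set.Ioo (-1 : ℝ) 1) (hJ : columnRatio W (J₀ : ZMod n) < columnRatio W j₁) (I₀ : ℤ) :
    IsColumnRun W j₁ γ J₀ (fun i => ⟨I₀ - i, J₀, .a⟩) (fun i => ⟨I₀ - i + 1, J₀, .c⟩)
      (fun i => W.a ((I₀ - 1 : ZMod m) - i) J₀)
      (fun i => columnWeight W J₀ (columnRatio W j₁) ((I₀ : ZMod m) - i)) where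
  col_ne := fun h => hJ.ne (by rw [h])
  injective := fun i j hij => by
    have h1 := congrArg Edge.row hij
    simp only at h1
    omega
  kind_ne := fun i => by simp
  white_snd := fun i => rfl
  black_snd := fun i => rfl
  black_eq := fun i => by
    simp only [Edge.black, Prod.mk.injEq, and_true]
    ring
  white_eq := fun i => by
    simp only [Edge.white, Prod.mk.injEq, and_true]
    push_cast
    ring
  ν_pos := fun i => W.a_pos _ _
  d_pos := fun i => columnWeight_pos W _ (columnRatio_pos W _) _
  rate_e := fun i => by
    have h := linearRate_fieldWeight_a (W := W) (j₁ := j₁) (γ := γ) (I₀ - (i + 1 : ℕ)) J₀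
    push_cast at h ⊢
    rwa [show (I₀ : ZMod m) - (i + 1) = I₀ - 1 - i by ring] at h
  rate_δ := fun i => by
    have h := linearRate_fieldWeight_c (W := W) (j₁ := j₁) (γ := γ) (I₀ - (i + 1 : ℕ) + 1) J₀
    push_cast at h ⊢
    rwa [show (I₀ : ZMod m) - (i + 1) + 1 = I₀ - i by ring] at h
  small := fun i j hij =>
    fieldGreen_isBigO_of_le hgen hγ hJ (by push_cast; omega)
  one := fun i => by
    have h := fieldWeight_mul_fieldGreen_c hgen hγ hJ (I₀ - i)
    have h2 : I₀ - ((i + 1 : ℕ) : ℤ) = I₀ - i - 1 := by push_cast; ring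
    simp only [Edge.black, Edge.white, h2, sub_add_cancel]
    exact h

omit [NeZero n] in
theorem prod_columnWeight_div (W : Weights m n) (j : ZMod n) (ρ : ℝ) :
    (∏ i, columnWeight W j ρ i) / ∏ i, W.a i j = ρ / columnRatio W j := by
  have h1 := prod_columnWeight W j ρ
  have h2 : ∏ i, W.a i j ≠ 0 := (Finset.prod_pos fun i _ => W.a_pos i j).ne'
  rw [div_eq_div_iff h2 (columnRatio_pos W j).ne', mul_comm, h1]

/-- Over a period the factors of the dual lengths cancel. -/
theorem eventually_prod_dualLength_div
    (hgen : ∀ j, j ≠ j₁ → columnRatio W j ≠ columnRatio W j₁)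
    (hroot : ∀ᶠ t in 𝓝[>] (0 : ℝ),
      IsTorusRoot W (tentacleBx W j₁ γ t) (Real.log t) (z₀ t) (w₀ t))
    (hJ : (J₀ : ZMod n) ≠ j₁) :
    ∀ᶠ t in 𝓝[>] (0 : ℝ), ∏ i ∈ Finset.range m,
        dualLength W (tentacleBx W j₁ γ t) (Real.log t) (z₀ t) (w₀ t) ⟨i, J₀, .c⟩ /
        dualLength W (tentacleBx W j₁ γ t) (Real.log t) (z₀ t) (w₀ t) ⟨i, J₀, .a⟩ =
      Real.exp (tentacleBx W j₁ γ t) / columnRatio W (J₀ : ZMod n) := by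
  have h1 := fun i : ℕ => eventually_dualLength_div_of_white hgen hroot
    (e := ⟨i, J₀, .c⟩) (e' := ⟨i, J₀, .a⟩) rfl rfl hJ rfl
  have h2 := fun b => (linearRate_torusRoot hgen hroot
    (contDiff_blackFactor W j₁ b)).tendsto.eventually_ne (blackFactor_ne_zero hgen b)
  filter_upwards [(Finset.range m).eventually_all.2 fun i _ => h1 i, eventually_all.2 h2]
    with t ht hne
  rw [Finset.prod_congr rfl ht]
  set f : ZMod m → ℝ := fun i => ‖blackFactor W j₁ (i, (J₀ : ZMod n))
    (Real.exp (tentacleBx W j₁ γ t) * z₀ t) (Real.exp (Real.log t) * w₀ t)‖ with hf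
  have hf0 : ∏ i, f i ≠ 0 :=
    Finset.prod_ne_zero_iff.2 fun i _ => norm_ne_zero_iff.2 (hne _)
  set g : ZMod m → ℝ := fun i => columnWeight W J₀ (Real.exp (tentacleBx W j₁ γ t)) i / W.a i J₀ *
    (f (i - 1) / f i) with hg
  have h3 : ∏ i ∈ Finset.range m, g (i : ZMod m) =
      Real.exp (tentacleBx W j₁ γ t) / columnRatio W (J₀ : ZMod n) := by
    -- Here the two edges share the white vertex, so black factors remain; over a full period they
    -- are permuted cyclically and cancel.
    have h4 : ∏ i, f (i - 1) = ∏ i, f i := Equiv.prod_comp (Equiv.subRight (1 : ZMod m)) f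
    rw [prod_range_zmod, hg, Finset.prod_mul_distrib, Finset.prod_div_distrib,
      Finset.prod_div_distrib, prod_columnWeight_div,
      h4, div_self hf0, mul_one]
  rw [← h3]
  refine Finset.prod_congr rfl fun i _ => ?_
  simp only [hg, hf, vertexClass, Edge.black, fieldWeight, edgeWeight, coeff, columnWeight,
    Edge.white]
  push_cast
  rfl

end Conclusion

end

end HoneycombDimer

theorem mainTheorem7 {m n : ℕ} [NeZero m] [NeZero n] (W : Weights m n)
    -- the tentacle of column `j₁`, whose asymptote differs from those of the other columns
    (j₁ : ZMod n) (hgeneric : ∀ j, j ≠ j₁ → columnRatio W j ≠ columnRatio W j₁)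
    (γ : ℝ) (hγ : γ ∈ Set.Ioo (-1 : ℝ) 1)
    -- the Gibbs measures along the curve of parameter `γ` inside this tentacle
    (μ : ℝ → Measure DimerConfig)
    (hμ : ∀ᶠ t in 𝓝[>] (0 : ℝ),
      IsDimerGibbsMeasure W (tentacleBx W j₁ γ t) (Real.log t) (μ t))
    -- the position of the bead
    (I₀ J₀ : ℤ) :
    (∀ᶠ t in 𝓝[>] (0 : ℝ), ∃ z w : ℂ,
      IsTorusRoot W (tentacleBx W j₁ γ t) (Real.log t) z w) ∧
    ∀ z₀ w₀ : ℝ → ℂ,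
      (∀ᶠ t in 𝓝[>] (0 : ℝ),
        IsTorusRoot W (tentacleBx W j₁ γ t) (Real.log t) (z₀ t) (w₀ t)) →
      let ℓ : ℝ → Edge → ℝ := fun t =>
        dualLength W (tentacleBx W j₁ γ t) (Real.log t) (z₀ t) (w₀ t)
      let bead : Set DimerConfig := {ω | (⟨I₀, J₀, .b⟩ : Edge) ∈ ω.1}
      -- column `J₀` is frozen with typical edges of kind `a`
      (columnRatio W j₁ < columnRatio W (J₀ : ZMod n) →
        HasGeometricLimit m μ bead (runLength fun i => ⟨I₀ + i, J₀, .c⟩)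
          (fun t i => ℓ t ⟨I₀ + i, J₀, .c⟩ / ℓ t ⟨I₀ + i - 1, J₀, .a⟩)
          (fun t => ∏ i ∈ Finset.range m, ℓ t ⟨i, J₀, .c⟩ / ℓ t ⟨i, J₀, .a⟩)) ∧
      -- column `J₀` is frozen with typical edges of kind `c`
      (columnRatio W (J₀ : ZMod n) < columnRatio W j₁ →
        HasGeometricLimit m μ bead (runLength fun i => ⟨I₀ - i, J₀, .a⟩)
          (fun t i => ℓ t ⟨I₀ - i, J₀, .a⟩ / ℓ t ⟨I₀ - i + 1, J₀, .c⟩)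
          (fun t => ∏ i ∈ Finset.range m, ℓ t ⟨i, J₀, .a⟩ / ℓ t ⟨i, J₀, .c⟩)) := by
  refine ⟨?_, fun z₀ w₀ hroot => ⟨fun hJ => ?_, fun hJ => ?_⟩⟩
  · obtain ⟨ω, ε, c, h⟩ := exists_localRoot_charPoly hgeneric
    filter_upwards [h.exists_torus_root hγ, self_mem_nhdsWithin] with t ⟨z, w, hz, hw, hP⟩ ht
    refine ⟨z, w, hz, hw, ?_⟩
    rwa [exp_tentacleBx, Real.exp_log ht]
  · have hrun := isColumnRun_of_lt hgeneric hγ hJ I₀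
    have hq : 0 < columnRatio W (J₀ : ZMod n) := columnRatio_pos W _
    refine hrun.hasGeometricLimit hgeneric hγ hμ hroot (by simp [Edge.white]) (fun p => ?_)
      (q := columnRatio W j₁ / columnRatio W (J₀ : ZMod n)) (div_pos (columnRatio_pos W _) hq)
      ((div_lt_one hq).2 hJ) (fun p => ?_) ?_
    · simp [vertexClass, Edge.white]
    · rw [Finset.prod_div_distrib, prod_range_mul_class_add,
        prod_range_mul_class_add fun i => W.a i J₀, ← div_pow, prod_columnWeight_div]
    · refine Tendsto.congr' ((eventually_prod_dualLength_div hgeneric hroot hrun.col_ne).mono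
        fun t ht => ht.symm) ?_
      exact (tendsto_of_sub_isBigO exp_tentacleBx_sub_isBigO).div_const _
  · have hrun := isColumnRun_of_gt hgeneric hγ hJ I₀
    have hq : 0 < columnRatio W (J₀ : ZMod n) := columnRatio_pos W _
    have hq₁ : 0 < columnRatio W j₁ := columnRatio_pos W _
    refine hrun.hasGeometricLimit hgeneric hγ hμ hroot (by simp [Edge.white]) (fun p => ?_)
      (q := columnRatio W (J₀ : ZMod n) / columnRatio W j₁) (div_pos hq hq₁)
      ((div_lt_one hq₁).2 hJ) (fun p => ?_) ?_
    · simp [vertexClass, Edge.white]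
    · rw [Finset.prod_div_distrib, prod_range_mul_class_sub fun i => W.a i J₀,
        prod_range_mul_class_sub, ← div_pow, ← inv_div, prod_columnWeight_div, inv_div]
    -- The parameter is the inverse of the one for the other kind of freezing.
    · have h1 := (tendsto_of_sub_isBigO
        (exp_tentacleBx_sub_isBigO (W := W) (j₁ := j₁) (γ := γ))).div_const
        (columnRatio W (J₀ : ZMod n))
      have h2 := h1.inv₀ (div_pos hq₁ hq).ne'
      rw [inv_div] at h2
      refine h2.congr' ?_
      filter_upwards [eventually_prod_dualLength_div hgeneric hroot hrun.col_ne] with t ht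
      rw [← ht, ← Finset.prod_inv_distrib]
      exact Finset.prod_congr rfl fun i _ => inv_div _ _
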